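/- Let $n\ge 1$ and $k\ge 0$ be integers, and identify $\mathbb H^{n+1}$ with $\mathbb R^{4(n+1)}$ by $q_{l+1}=x_{4l+1}+\mathbf i x_{4l+2}+\mathbf j x_{4l+3}+\mathbf k x_{4l+4}$, $l=0,\dots,n$. Let $\nabla_{AA'}$ ($A=0,\dots,2n+1$, $A'=0',1'$) be the complex vector fields $$\begin{pmatrix}\nabla_{(2l)0'}&\nabla_{(2l)1'}\\ \nabla_{(2l+1)0'}&\nabla_{(2l+1)1'}\end{pmatrix}=\begin{pmatrix}\partial_{4l+1}+\mathrm i\,\partial_{4l+2}&-\partial_{4l+3}-\mathrm i\,\partial_{4l+4}\\ \partial_{4l+3}-\mathrm i\,\partial_{4l+4}&\partial_{4l+1}-\mathrm i\,\partial_{4l+2}\end{pmatrix},\qquad l=0,\dots,n,$$ and put $\nabla_A^{0'}=\nabla_{A1'}$, $\nabla_A^{1'}=-\nabla_{A0'}$. For a smooth $F=\sum_S F_S\,\omega^S$ with values in $\wedge^\tau\mathbb C^{2n+2}$, where $\omega^0,\dots,\omega^{2n+1}$ is a basis of $\mathbb C^{2n+2}$, let $d^{A'}F=\sum_{A,S}\nabla_A^{A'}F_S\,\omega^A\wedge\omega^S$.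 Identify $\odot^\sigma\mathbb C^2$ with the homogeneous polynomials of degree $\sigma$ in $s^{0'},s^{1'}$, and let $\partial_{A'}=\partial/\partial s^{A'}$, $s_{0'}=-s^{1'}$, $s_{1'}=s^{0'}$. Repeated indices $A'$ are summed. The first operators $\Gamma(\mathcal V_0)\xrightarrow{\mathcal D_0}\Gamma(\mathcal V_1)\xrightarrow{\mathcal D_1}\Gamma(\mathcal V_2)$ of the $k$-Cauchy-Fueter complex, with $\mathcal V_0=\odot^k\mathbb C^2$, are $$(\mathcal D_0,\mathcal D_1)=\begin{cases}(d^{0'}d^{1'},\ s_{A'}d^{A'}),&k=0,\\(\partial_{A'}d^{A'},\ d^{0'}d^{1'}),&k=1,\\(\partial_{A'}d^{A'},\ \partial_{A'}d^{A'}),&k\ge2,\end{cases}$$ so that $\mathcal V_1=\wedge^2\mathbb C^{2n+2}$ and $\mathcal V_2=\mathbb C^2\otimes\wedge^3\mathbb C^{2n+2}$ for $k=0$; $\mathcal V_1=\wedge^1\mathbb C^{2n+2}$ and $\mathcal V_2=\wedge^3\mathbb C^{2n+2}$ for $k=1$; $\mathcal V_1=\odot^{k-1}\mathbb C^2\otimes\wedge^1\mathbb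 C^{2n+2}$ and $\mathcal V_2=\odot^{k-2}\mathbb C^2\otimes\wedge^2\mathbb C^{2n+2}$ for $k\ge2$. A smooth $\odot^k\mathbb C^2$-valued function $f$ on an open set is called $k$-regular if $\mathcal D_0f=0$. Let $D\subset\mathbb H^{n+1}$ be a bounded domain with smooth boundary $bD$, i.e. $D=\{\varrho>0\}$ for a smooth real function $\varrho$ on $\mathbb H^{n+1}$ with $d\varrho\ne0$ on $bD$. A smooth $\mathcal V_1$-valued function $u$ on $\mathbb H^{n+1}$ has zero Cauchy data on $bD$ for $\mathcal D_1$ if $$\int_D\langle\mathcal D_1u,\psi\rangle\,dV=\int_D\langle u,\mathcal D_1^*\psi\rangle\,dV$$ for every smooth compactly supported $\psi:\mathbb H^{n+1}\to\mathcal V_2$, where $\mathcal D_1^*$ is the formal adjoint of $\mathcal D_1$. A smooth function $g:\mathbb H^{n+1}\to\odot^k\mathbb C^2$ is said to represent a $k$-CF class on $bD$ if $\mathcal D_0g$ has zero Cauchy data on $bD$ for $\mathcal D_1$ (this is the equation $\mathscr D_0[g]=0$ in the boundary complex). A smooth $k$-CF function on $bD$ is a function $f:bD\to\odot^k\mathbb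 C^2$ of the form $f=g|_{bD}$, where $g$ represents a $k$-CF class on $bD$. **Theorem.** Suppose that $\mathbb H^{n+1}\setminus\overline D$ is connected. 1. If $f$ is a smooth $k$-CF function on $bD$, then there is a smooth function $\widetilde f:\mathbb H^{n+1}\to\odot^k\mathbb C^2$ that is $k$-regular on $D$ and satisfies $\widetilde f=f$ on $bD$. In other words, $f$ extends to a $k$-regular function on $D$ that is smooth up to the boundary. 2. If $k=0$ (where an element of the boundary complex consists of the values and the normal derivative on $bD$) and $g$ represents a $0$-CF class on $bD$, then there is a smooth function $\widetilde f:\mathbb H^{n+1}\to\mathbb C$ that is $0$-regular on $D$ and satisfies $\widetilde f=g$ and $d\widetilde f=dg$ on $bD$. -/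

import Mathlib

open scoped ContDiff

namespace KCF

/-- `ℍ^{n+1}`, identified with `ℝ^{4(n+1)}`: the coordinate `x (l, j)` is `x_{4l+1+j}`, so that
`q_{l+1} = x (l,0) + x (l,1) 𝐢 + x (l,2) 𝐣 + x (l,3) 𝐤` for `l = 0, …, n`. -/
abbrev HSpace (n : ℕ) : Type := EuclideanSpace ℝ (Fin (n + 1) × Fin 4)

/-- The set of unprimed indices `A = 0, …, 2n+1`; here `A.divNat = ⌊A/2⌋` is the number of the
quaternionic variable and `A.modNat = A mod 2` is the row inside the corresponding block. -/
abbrev Idx (n : ℕ) : Type := Fin ((n + 1) * 2)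

/-- `Λ^τ ℂ^{2n+2}` in the basis `ω^{A_1} ∧ ⋯ ∧ ω^{A_τ}`, `A_1 < ⋯ < A_τ`, which is indexed by the
subsets `{A_1, …, A_τ}` with `τ` elements. -/
abbrev Ext (n τ : ℕ) : Type := {S : Finset (Idx n) // S.card = τ} → ℂ

/-- `𝒱^{σ,τ} = ⊙^σ ℂ² ⊗ Λ^τ ℂ^{2n+2}`: the entry `f a` is the coefficient in `Λ^τ ℂ^{2n+2}` of the
`a`-th basis vector of `⊙^σ ℂ²`, `a = 0, …, σ`. With `⊙^σ ℂ²` seen as the homogeneous polynomials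
of degree `σ` in `s^{0'}, s^{1'}`, the basis is `(s^{0'})^{σ-a} (s^{1'})^a / ((σ-a)! a!)`; with
`⊙^σ ℂ²` seen as the symmetric tensors `f_{A_1' ⋯ A_σ'}`, the entry `f a` is the component with
exactly `a` indices equal to `1'`. In particular `𝒱^{k,0}` is `⊙^k ℂ²`. -/
abbrev V (n σ τ : ℕ) : Type := Fin (σ + 1) → Ext n τ

/-- The partial derivative `∂_{4l+1+j}` of a complex-valued function. -/
noncomputable def partialDeriv {n : ℕ} (l : Fin (n + 1)) (j : Fin 4) (f : HSpace n → ℂ) :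
    HSpace n → ℂ :=
  fun x => fderiv ℝ f x (EuclideanSpace.single (l, j) 1)

/-- The coefficients of the `2 × 2` block of vector fields
`(∂₁ + i∂₂, -∂₃ - i∂₄; ∂₃ - i∂₄, ∂₁ - i∂₂)`;
`lowerCoeff r A' j` is the coefficient of `∂_{j+1}` in row `r` and column `A'`. -/
noncomputable def lowerCoeff : Fin 2 → Fin 2 → Fin 4 → ℂ :=
  ![![![1, Complex.I, 0, 0], ![0, 0, -1, -Complex.I]],
    ![![0, 0, 1, -Complex.I], ![1, -Complex.I, 0, 0]]]

/-- The coefficients after raising the primed index: `∇_A^{0'} = ∇_{A1'}`,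
`∇_A^{1'} = -∇_{A0'}`. -/
noncomputable def raisedCoeff (r : Fin 2) : Fin 2 → Fin 4 → ℂ :=
  ![lowerCoeff r 1, -lowerCoeff r 0]

/-- The complex vector field `∇_A^{A'}`. -/
noncomputable def nabla {n : ℕ} (A : Idx n) (A' : Fin 2) (f : HSpace n → ℂ) : HSpace n → ℂ :=
  fun x => ∑ j : Fin 4, raisedCoeff A.modNat A' j * partialDeriv A.divNat j f x

/-- The complex conjugate of the vector field `∇_A^{A'}`. -/
noncomputable def nablaConj {n : ℕ} (A : Idx n) (A' : Fin 2) (f : HSpace n → ℂ) :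
    HSpace n → ℂ :=
  fun x => ∑ j : Fin 4, star (raisedCoeff A.modNat A' j) * partialDeriv A.divNat j f x

/-- For `A ∈ S`, the sign in `ω^A ∧ ω^{S ∖ {A}} = ± ω^S`; for `A ∉ S`, the sign in
`ω^A ∧ ω^S = ± ω^{S ∪ {A}}`. -/
noncomputable def sgn {n : ℕ} (A : Idx n) (S : Finset (Idx n)) : ℂ :=
  (-1) ^ (S.filter (fun B => B < A)).card

/-- `d^{A'} F = ∑_A ∑_S ∇_A^{A'} F_S ω^A ∧ ω^S`. -/
noncomputable def extD {n τ : ℕ} (A' : Fin 2) (F : HSpace n → Ext n τ) :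
    HSpace n → Ext n (τ + 1) :=
  fun x S => ∑ A : {A : Idx n // A ∈ S.1},
    sgn A.1 S.1 * nabla A.1 A' (fun y => F y ⟨S.1.erase A.1, by
      rw [Finset.card_erase_of_mem A.2, S.2, Nat.add_sub_cancel]⟩) x

/-- The formal adjoint of `d^{A'}`, for the inner product in which the `ω^S` are orthonormal. -/
noncomputable def extDAdj {n τ : ℕ} (A' : Fin 2) (G : HSpace n → Ext n (τ + 1)) :
    HSpace n → Ext n τ :=
  fun x T => -∑ A : {A : Idx n // A ∉ T.1},
    sgn A.1 T.1 * nablaConj A.1 A' (fun y => G y ⟨insert A.1 T.1, by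
      rw [Finset.card_insert_of_notMem A.2, T.2]⟩) x

/-- The operator `∂_{A'} d^{A'}`, with `∂_{A'} = ∂/∂s^{A'}` (summation over `A' = 0', 1'`). In
components, `f ↦ (d^{0'} f_b + d^{1'} f_{b+1})_b`. -/
noncomputable def partialD {n σ τ : ℕ} (f : HSpace n → V n (σ + 1) τ) :
    HSpace n → V n σ (τ + 1) :=
  fun x b => extD 0 (fun y => f y b.castSucc) x + extD 1 (fun y => f y b.succ) x

/-- The formal adjoint of `∂_{A'} d^{A'}`. -/
noncomputable def partialDAdj {n σ τ : ℕ} (ψ : HSpace n → V n σ (τ + 1)) :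
    HSpace n → V n (σ + 1) τ :=
  fun x =>
    (Fin.snoc (α := fun _ => Ext n τ) (fun b => extDAdj 0 (fun y => ψ y b) x) 0 : V n (σ + 1) τ)
    + (Fin.cons (α := fun _ => Ext n τ) 0 (fun b => extDAdj 1 (fun y => ψ y b) x) : V n (σ + 1) τ)

/-- The second order operator `d^{0'} d^{1'}`. -/
noncomputable def dd {n τ : ℕ} (f : HSpace n → V n 0 τ) : HSpace n → V n 0 (τ + 2) :=
  fun x _ => extD 0 (extD 1 (fun y => f y 0)) x

/-- The formal adjoint of `d^{0'} d^{1'}`. -/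
noncomputable def ddAdj {n τ : ℕ} (ψ : HSpace n → V n 0 (τ + 2)) : HSpace n → V n 0 τ :=
  fun x _ => extDAdj 1 (extDAdj 0 (fun y => ψ y 0)) x

/-- The operator `s_{A'} d^{A'}` on `Λ^τ ℂ^{2n+2}`-valued functions, in the basis
`s_{0'}, s_{1'}` of `⊙¹ ℂ²`. -/
noncomputable def mulD {n τ : ℕ} (f : HSpace n → V n 0 τ) : HSpace n → V n 1 (τ + 1) :=
  fun x => ![extD 0 (fun y => f y 0) x, extD 1 (fun y => f y 0) x]

/-- The formal adjoint of `s_{A'} d^{A'}`. -/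
noncomputable def mulDAdj {n τ : ℕ} (ψ : HSpace n → V n 1 (τ + 1)) : HSpace n → V n 0 τ :=
  fun x _ => extDAdj 0 (fun y => ψ y 0) x + extDAdj 1 (fun y => ψ y 1) x

/-- `σ_1`: the space `𝒱_1` of the `k`-Cauchy-Fueter complex is `𝒱^{σ_1,τ_1}`. -/
def sigma₁ : ℕ → ℕ
  | 0 => 0
  | k + 1 => k

/-- `τ_1`. -/
def tau₁ : ℕ → ℕ
  | 0 => 2
  | _ + 1 => 1

/-- `σ_2`: the space `𝒱_2` of the `k`-Cauchy-Fueter complex is `𝒱^{σ_2,τ_2}`. -/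
def sigma₂ : ℕ → ℕ
  | 0 => 1
  | 1 => 0
  | k + 2 => k

/-- `τ_2`. -/
def tau₂ : ℕ → ℕ
  | 0 => 3
  | 1 => 3
  | _ + 2 => 2

/-- The `k`-Cauchy-Fueter operator `𝒟_0 : Γ(𝒱_0) → Γ(𝒱_1)`, where `𝒱_0 = ⊙^k ℂ²`: it is
`d^{0'} d^{1'}` for `k = 0` and `∂_{A'} d^{A'}` for `k ≥ 1`. -/
noncomputable def D₀ {n : ℕ} : (k : ℕ) → (HSpace n → V n k 0) →
    (HSpace n → V n (sigma₁ k) (tau₁ k))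
  | 0, f => dd f
  | _ + 1, f => partialD f

/-- The operator `𝒟_1 : Γ(𝒱_1) → Γ(𝒱_2)` of the `k`-Cauchy-Fueter complex: it is
`s_{A'} d^{A'}` for `k = 0`, `d^{0'} d^{1'}` for `k = 1` and `∂_{A'} d^{A'}` for `k ≥ 2`. -/
noncomputable def D₁ {n : ℕ} : (k : ℕ) → (HSpace n → V n (sigma₁ k) (tau₁ k)) →
    (HSpace n → V n (sigma₂ k) (tau₂ k))
  | 0, f => mulD (n := n) (τ := 2) f
  | 1, f => dd (n := n) (τ := 1) f
  | k + 2, f => partialD (n := n) (σ := k) (τ := 1) f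

/-- The formal adjoint of `𝒟_1`. -/
noncomputable def D₁Adj {n : ℕ} : (k : ℕ) → (HSpace n → V n (sigma₂ k) (tau₂ k)) →
    (HSpace n → V n (sigma₁ k) (tau₁ k))
  | 0, ψ => mulDAdj (n := n) (τ := 2) ψ
  | 1, ψ => ddAdj (n := n) (τ := 1) ψ
  | k + 2, ψ => partialDAdj (n := n) (σ := k) (τ := 1) ψ

/-- The Hermitian inner product on `𝒱^{σ,τ}`. -/
noncomputable def herm {n σ τ : ℕ} (u v : V n σ τ) : ℂ :=
  ∑ a, ∑ S, u a S * star (v a S)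

/-- `u` has zero Cauchy data on `bD` for the operator `A` with formal adjoint `Aadj`:
`∫_D ⟨A u, ψ⟩ dV = ∫_D ⟨u, A^* ψ⟩ dV` for all smooth compactly supported `ψ`, which need not
vanish on `bD`. -/
def ZeroCauchyData {n σ τ σ' τ' : ℕ} (D : Set (HSpace n))
    (A : (HSpace n → V n σ τ) → (HSpace n → V n σ' τ'))
    (Aadj : (HSpace n → V n σ' τ') → (HSpace n → V n σ τ))
    (u : HSpace n → V n σ τ) : Prop :=
  ∀ ψ : HSpace n → V n σ' τ', ContDiff ℝ ∞ ψ → HasCompactSupport ψ →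
    ∫ x in D, herm (A u x) (ψ x) = ∫ x in D, herm (u x) (Aadj ψ x)

/-- `D` is a bounded domain with smooth boundary: a bounded connected open set `{ϱ > 0}` with a
smooth defining function `ϱ` whose differential has no zero on the boundary. -/
structure IsSmoothBoundedDomain {n : ℕ} (D : Set (HSpace n)) : Prop where
  isOpen : IsOpen D
  isConnected : IsConnected D
  isBounded : Bornology.IsBounded D
  exists_defining : ∃ ρ : HSpace n → ℝ, ContDiff ℝ ∞ ρ ∧ D = {x | 0 < ρ x} ∧
    ∀ x ∈ frontier D, fderiv ℝ ρ x ≠ 0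

/-- `f` is `k`-regular on `D`: it is smooth on `D` and `𝒟_0 f = 0` there. -/
def IsRegular {n : ℕ} (k : ℕ) (D : Set (HSpace n)) (f : HSpace n → V n k 0) : Prop :=
  ContDiffOn ℝ ∞ f D ∧ ∀ x ∈ D, D₀ k f x = 0

/-- The boundary complex of the `k`-Cauchy-Fueter complex is the quotient complex of the spaces
`Γ(ℍ^{n+1}, 𝒱_j)` by the elements with zero Cauchy data on `bD` for `𝒟_j`. The class of the smooth
function `g` in the zeroth quotient is annihilated by the operator induced by `𝒟_0`, that is,
`𝒟_0 g` has zero Cauchy data on `bD` for `𝒟_1`. The class of `g` is determined by `g` on `bD` if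
`k ≥ 1`, and by `g` and its first derivatives on `bD` if `k = 0`. -/
def IsCFClass {n : ℕ} (k : ℕ) (D : Set (HSpace n)) (g : HSpace n → V n k 0) : Prop :=
  ContDiff ℝ ∞ g ∧ ZeroCauchyData D (D₁ k) (D₁Adj k) (D₀ k g)

/-- `f` is a smooth `k`-CF function on `bD`: it is the boundary value of a smooth function whose
class in the boundary complex is annihilated by the operator induced by `𝒟_0`. -/
def IsCF {n : ℕ} (k : ℕ) (D : Set (HSpace n)) (f : frontier D → V n k 0) : Prop :=
  ∃ g : HSpace n → V n k 0, IsCFClass k D g ∧ ∀ x : frontier D, g x = f x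

end KCF

/-!
Let `g` represent a `k`-CF class, `bD = {ρ = 0}`. The extension is found as in Ehrenpreis' proof of
Hartogs' theorem: `g` is first changed to a smooth `G` with the same boundary data, for which
`𝒟_0 G` vanishes to infinite order on `bD`; then `u`, the function equal to `𝒟_0 G` on `D` and to
zero elsewhere, is smooth with compact support and satisfies `𝒟_1 u = 0`. One solves `𝒟_0 v = u`
with a `v` that vanishes outside of `D`, and `G - v` is the extension.

*The formal solution* (`exists_formal_solution_first_order`, `exists_formal_solution_second_order`,
`exists_formal_solution_exterior`). Suppose that `𝒟_0 g = ρ ^ m c` up to terms of higher order.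
The equation `𝒟_1 𝒟_0 g = 0` gives the relation `σ(𝒟_1) c = 0` on `bD` for the symbols in the
direction `dρ` (`symbol_relation`, `symbol_relation_second_order`). If `m` is smaller than the order
of `𝒟_1`, this equation alone does not see `c`, and the relation comes from the vanishing of the
Cauchy data, that is, from Stokes' formula without boundary term, tested with functions that do not
vanish on `bD`. The symbol sequence is exact; with `δ_{AB}` the symbol of
`Δ_{AB} = ∇_A^{0'} ∇_B^{1'} - ∇_B^{0'} ∇_A^{1'}`, exactness follows from the explicit formula
`symbolInverse` and the identity `∑ δ_{2l,2l+1} = |dρ|²`. Hence a correction of `g` by a multiple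
of `ρ ^ (m + 1)` (of `ρ ^ (m + 2)` if `k = 0`, where `𝒟_0` has order two) raises the order of
vanishing (`exists_correction`), and Borel's theorem along `bD` (`exists_asymptotic_sum`) makes all
the corrections at once.

*The solution with compact support* (`exists_extension`, `exists_extension_exterior`). The operator
`Δ_{2l,2l+1}` is the Laplacian in `q_{l+1}`. Replacing symbols by operators in `symbolInverse`, for
the first quaternionic variable only, and dividing by its Laplacian, that is, taking the Newton
potential in that variable, yields a solution `v` of `𝒟_0 v = u`. Since `n ≥ 1`, it vanishes where
the last variable is large. Outside of `closure D` all the `Δ_{AB}` annihilate `v`, so that `v` is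
harmonic in each quaternionic variable and vanishes on the connected set `(closure D)ᶜ` by unique
continuation (`eq_zero_of_block_harmonic`).

Throughout, the `Λ^τ`-valued functions are handled through their scalar components: the integral
condition is used only with test functions that have a single component (`testForm`).
-/

namespace KCF

open Filter Topology MeasureTheory

/-! ### Orders of vanishing on a set -/

section Vanishing

variable {E W W' W'' : Type*} [NormedAddCommGroup E] [NormedSpace ℝ E]
  [NormedAddCommGroup W] [NormedSpace ℝ W] [NormedAddCommGroup W'] [NormedSpace ℝ W']
  [NormedAddCommGroup W''] [NormedSpace ℝ W'']

/-- `f` vanishes to order `m` on `S`: all derivatives of order less than `m` vanish on `S`. -/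
def VanishesOn (S : Set E) (m : ℕ) (f : E → W) : Prop :=
  ∀ i < m, ∀ x ∈ S, iteratedFDeriv ℝ i f x = 0

variable {S : Set E} {m k : ℕ} {f g : E → W}

lemma contDiff_nat {f : E → W} (hf : ContDiff ℝ ∞ f) (i : ℕ) : ContDiff ℝ i f :=
  hf.of_le (by exact_mod_cast le_top)

lemma contDiff_fderiv {f : E → W} (hf : ContDiff ℝ ∞ f) : ContDiff ℝ ∞ (fderiv ℝ f) :=
  hf.fderiv_right (by simp)

lemma contDiff_fderiv_apply {f : E → W} (hf : ContDiff ℝ ∞ f) {X : E → E} (hX : ContDiff ℝ ∞ X) :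
    ContDiff ℝ ∞ (fun x => fderiv ℝ f x (X x)) :=
  (contDiff_fderiv hf).clm_apply hX

lemma differentiable_of_smooth {f : E → W} (hf : ContDiff ℝ ∞ f) : Differentiable ℝ f :=
  hf.differentiable (by simp)

lemma VanishesOn.zero_order : VanishesOn S 0 f := fun i hi => absurd hi (Nat.not_lt_zero i)

lemma VanishesOn.eq_zero (h : VanishesOn S m f) (hm : 0 < m) {x : E} (hx : x ∈ S) : f x = 0 := by
  have := h 0 hm x hx
  rw [← norm_eq_zero, norm_iteratedFDeriv_zero] at this
  exact norm_eq_zero.1 this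

lemma vanishesOn_one (h : ∀ x ∈ S, f x = 0) : VanishesOn S 1 f := by
  intro i hi x hx
  obtain rfl : i = 0 := by omega
  rw [← norm_eq_zero, norm_iteratedFDeriv_zero, h x hx, norm_zero]

lemma VanishesOn.fderiv (h : VanishesOn S (m + 1) f) : VanishesOn S m (fderiv ℝ f) := by
  intro i hi x hx
  rw [← norm_eq_zero, norm_iteratedFDeriv_fderiv, h (i + 1) (by omega) x hx, norm_zero]

lemma vanishesOn_succ (h0 : ∀ x ∈ S, f x = 0) (h1 : VanishesOn S m (_root_.fderiv ℝ f)) :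
    VanishesOn S (m + 1) f := by
  intro i hi x hx
  cases i with
  | zero => rw [← norm_eq_zero, norm_iteratedFDeriv_zero, h0 x hx, norm_zero]
  | succ i => rw [← norm_eq_zero, ← norm_iteratedFDeriv_fderiv, h1 i (by omega) x hx, norm_zero]

lemma VanishesOn.add (hf : VanishesOn S m f) (hg : VanishesOn S m g) (cf : ContDiff ℝ ∞ f)
    (cg : ContDiff ℝ ∞ g) : VanishesOn S m (fun x => f x + g x) := by
  intro i hi x hx
  rw [fun_iteratedFDeriv_add_apply (contDiff_nat cf i).contDiffAt (contDiff_nat cg i).contDiffAt,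
    hf i hi x hx, hg i hi x hx, add_zero]

lemma VanishesOn.clm_comp (L : W →L[ℝ] W') (hf : VanishesOn S m f) (cf : ContDiff ℝ ∞ f) :
    VanishesOn S m (fun x => L (f x)) := by
  intro i hi x hx
  have := L.norm_iteratedFDeriv_comp_left (contDiff_nat cf i).contDiffAt (x := x) le_rfl
  rw [hf i hi x hx, norm_zero, mul_zero] at this
  exact norm_le_zero_iff.1 this

lemma VanishesOn.neg (hf : VanishesOn S m f) (cf : ContDiff ℝ ∞ f) :
    VanishesOn S m (fun x => -f x) :=
  hf.clm_comp (-ContinuousLinearMap.id ℝ W) cf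

lemma VanishesOn.sub (hf : VanishesOn S m f) (hg : VanishesOn S m g) (cf : ContDiff ℝ ∞ f)
    (cg : ContDiff ℝ ∞ g) : VanishesOn S m (fun x => f x - g x) := by
  simpa [sub_eq_add_neg] using hf.add (hg.neg cg) cf cg.neg

lemma vanishesOn_zero : VanishesOn S m (fun _ => (0 : W)) := by
  intro i _ x _
  simp

lemma VanishesOn.sum {ι : Type*} {s : Finset ι} {F : ι → E → W}
    (h : ∀ i ∈ s, VanishesOn S m (F i)) (cf : ∀ i ∈ s, ContDiff ℝ ∞ (F i)) :
    VanishesOn S m (fun x => ∑ i ∈ s, F i x) := by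
  classical
  induction s using Finset.induction_on with
  | empty => simpa using vanishesOn_zero
  | insert a s ha ih =>
    simp only [Finset.sum_insert ha]
    refine (h a (by simp)).add (ih (fun i hi => h i (by simp [hi])) fun i hi => cf i (by simp [hi]))
      (cf a (by simp)) (ContDiff.sum fun i hi => cf i (by simp [hi]))

lemma VanishesOn.bilin (B : W →L[ℝ] W' →L[ℝ] W'') {f : E → W} {g : E → W'}
    (hf : VanishesOn S m f) (hg : VanishesOn S k g) (cf : ContDiff ℝ ∞ f) (cg : ContDiff ℝ ∞ g) :
    VanishesOn S (m + k) (fun x => B (f x) (g x)) := by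
  intro i hi x hx
  have h := B.norm_iteratedFDeriv_le_of_bilinear (contDiff_nat cf i) (contDiff_nat cg i) x le_rfl
  rw [Finset.sum_eq_zero, mul_zero] at h
  · exact norm_le_zero_iff.1 h
  · intro j hj
    rw [Finset.mem_range] at hj
    rcases lt_or_ge j m with h' | h'
    · rw [hf j h' x hx]; simp
    · rw [hg (i - j) (by omega) x hx]; simp

lemma VanishesOn.smul {f : E → ℝ} {g : E → W}
    (hf : VanishesOn S m f) (hg : VanishesOn S k g) (cf : ContDiff ℝ ∞ f) (cg : ContDiff ℝ ∞ g) :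
    VanishesOn S (m + k) (fun x => f x • g x) :=
  VanishesOn.bilin (ContinuousLinearMap.lsmul ℝ ℝ) hf hg cf cg

lemma VanishesOn.mul {f : E → ℂ} {g : E → ℂ}
    (hf : VanishesOn S m f) (hg : VanishesOn S k g) (cf : ContDiff ℝ ∞ f) (cg : ContDiff ℝ ∞ g) :
    VanishesOn S (m + k) (fun x => f x * g x) :=
  VanishesOn.bilin (ContinuousLinearMap.mul ℝ ℂ) hf hg cf cg

lemma VanishesOn.mul_left {f : E → ℂ} {g : E → ℂ}
    (hg : VanishesOn S k g) (cf : ContDiff ℝ ∞ f) (cg : ContDiff ℝ ∞ g) :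
    VanishesOn S k (fun x => f x * g x) := by
  simpa using (VanishesOn.zero_order (f := f)).mul hg cf cg

lemma VanishesOn.mul_right {f : E → ℂ} {g : E → ℂ}
    (hf : VanishesOn S k f) (cf : ContDiff ℝ ∞ f) (cg : ContDiff ℝ ∞ g) :
    VanishesOn S k (fun x => f x * g x) := by
  simpa using hf.mul (VanishesOn.zero_order (f := g)) cf cg

lemma VanishesOn.fderiv_apply (h : VanishesOn S (m + 1) f) (cf : ContDiff ℝ ∞ f) {X : E → E}
    (hX : ContDiff ℝ ∞ X) : VanishesOn S m (fun x => _root_.fderiv ℝ f x (X x)) := by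
  have := VanishesOn.bilin (ContinuousLinearMap.id ℝ (E →L[ℝ] W)) h.fderiv
    (VanishesOn.zero_order (f := X)) (contDiff_fderiv cf) hX
  simpa using this

lemma vanishesOn_succ_of_apply (h0 : ∀ x ∈ S, f x = 0) (cf : ContDiff ℝ ∞ f)
    (h1 : ∀ v, VanishesOn S m (fun x => _root_.fderiv ℝ f x v)) : VanishesOn S (m + 1) f := by
  refine vanishesOn_succ h0 fun i hi x hx => ?_
  ext w v
  have h2 := h1 v i hi x hx
  have h3 := (ContinuousLinearMap.apply ℝ W v).iteratedFDeriv_comp_left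
    (contDiff_nat (contDiff_fderiv cf) i).contDiffAt (x := x) le_rfl
  have h4 : iteratedFDeriv ℝ i ((ContinuousLinearMap.apply ℝ W v) ∘ _root_.fderiv ℝ f) x = 0 := h2
  rw [h4] at h3
  have := congrArg (fun M => M w) h3
  simpa using this.symm

end Vanishing

/-! ### Expansions along a smooth hypersurface -/

section Hypersurface

variable {E : Type*} [NormedAddCommGroup E] [NormedSpace ℝ E]

/-- `ρ` is a smooth function vanishing on `S`, such that the differentials of the smooth functions
vanishing on `S` are multiples of `dρ` on `S`, and `N` is a smooth vector field, transversal to `S`,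
with `dρ(N) = 1` on `S`. -/
structure IsDefining (S : Set E) (ρ : E → ℝ) (N : E → E) : Prop where
  smooth : ContDiff ℝ ∞ ρ
  smooth_field : ContDiff ℝ ∞ N
  eq_zero : ∀ x ∈ S, ρ x = 0
  fderiv_field : ∀ x ∈ S, fderiv ℝ ρ x (N x) = 1
  tangent : ∀ f : E → ℂ, ContDiff ℝ ∞ f → (∀ x ∈ S, f x = 0) → ∀ x ∈ S, ∀ v,
    fderiv ℝ ρ x v = 0 → fderiv ℝ f x v = 0

lemma fderiv_fderiv_apply {W : Type*} [NormedAddCommGroup W] [NormedSpace ℝ W]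
    {f : E → W} (cf : ContDiff ℝ ∞ f) {X : E → E} (cX : ContDiff ℝ ∞ X) (x v : E) :
    fderiv ℝ (fun y => fderiv ℝ f y (X y)) x v
      = fderiv ℝ (fun y => fderiv ℝ f y v) x (X x) + fderiv ℝ f x (fderiv ℝ X x v) := by
  have d1 : DifferentiableAt ℝ (fderiv ℝ f) x := (differentiable_of_smooth (contDiff_fderiv cf)) x
  have d2 : DifferentiableAt ℝ X x := (differentiable_of_smooth cX) x
  have hs : IsSymmSndFDerivAt ℝ f x :=
    (contDiff_nat cf 2).contDiffAt.isSymmSndFDerivAt (by simp)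
  rw [fderiv_clm_apply d1 d2, fderiv_clm_apply d1 (differentiableAt_const v)]
  simp only [fderiv_fun_const, Pi.zero_apply, _root_.add_apply,
    ContinuousLinearMap.comp_apply, ContinuousLinearMap.flip_apply, ContinuousLinearMap.comp_zero,
    zero_add]
  rw [hs.eq]; abel

variable {S : Set E} {ρ : E → ℝ} {N : E → E}

lemma IsDefining.contDiff_ofReal (h : IsDefining S ρ N) :
    ContDiff ℝ ∞ (fun x => (ρ x : ℂ)) := Complex.ofRealCLM.contDiff.comp h.smooth

lemma IsDefining.vanishesOn (h : IsDefining S ρ N) : VanishesOn S 1 (fun x => (ρ x : ℂ)) :=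
  vanishesOn_one fun x hx => by simp [h.eq_zero x hx]

lemma fderiv_ofReal {ρ : E → ℝ} (h : ContDiff ℝ ∞ ρ) (x v : E) :
    fderiv ℝ (fun x => (ρ x : ℂ)) x v = (fderiv ℝ ρ x v : ℂ) := by
  have := (Complex.ofRealCLM.hasFDerivAt (x := ρ x)).comp x
    (differentiable_of_smooth h x).hasFDerivAt
  have h2 : HasFDerivAt (fun x => (ρ x : ℂ)) (Complex.ofRealCLM.comp (fderiv ℝ ρ x)) x := this
  rw [h2.fderiv]; rfl

lemma IsDefining.vanishesOn_pow (h : IsDefining S ρ N) (m : ℕ) :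
    VanishesOn S m (fun x => (ρ x : ℂ) ^ m) := by
  induction m with
  | zero => exact VanishesOn.zero_order
  | succ m ih =>
    simp only [pow_succ]
    exact ih.mul h.vanishesOn (h.contDiff_ofReal.pow m) h.contDiff_ofReal

/-- Tangential derivatives preserve the order of vanishing. -/
lemma IsDefining.vanishesOn_tangential (h : IsDefining S ρ N) {X : E → E} (cX : ContDiff ℝ ∞ X)
    (hX : ∀ x ∈ S, fderiv ℝ ρ x (X x) = 0) {m : ℕ} {f : E → ℂ} (cf : ContDiff ℝ ∞ f)
    (hf : VanishesOn S m f) : VanishesOn S m (fun x => fderiv ℝ f x (X x)) := by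
  induction m generalizing f with
  | zero => exact VanishesOn.zero_order
  | succ m ih =>
    refine vanishesOn_succ_of_apply (fun x hx => ?_) (contDiff_fderiv_apply cf cX) fun v => ?_
    · exact h.tangent f cf (fun y hy => hf.eq_zero (by omega) hy) x hx _ (hX x hx)
    · simp only [fderiv_fderiv_apply cf cX]
      exact (ih (contDiff_fderiv_apply cf contDiff_const) (hf.fderiv_apply cf contDiff_const)).add
        (hf.fderiv_apply cf (contDiff_fderiv_apply cX contDiff_const))
        (contDiff_fderiv_apply (contDiff_fderiv_apply cf contDiff_const) cX)
        (contDiff_fderiv_apply cf (contDiff_fderiv_apply cX contDiff_const))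

/-- The Euler relation modulo higher order: `m f` agrees with `ρ ∂_N f` to order `m + 1` if `f`
vanishes to order `m`. -/
lemma IsDefining.vanishesOn_euler (h : IsDefining S ρ N) {m : ℕ} {f : E → ℂ}
    (cf : ContDiff ℝ ∞ f) (hf : VanishesOn S m f) :
    VanishesOn S (m + 1) (fun x => (m : ℂ) * f x - (ρ x : ℂ) * fderiv ℝ f x (N x)) := by
  have cρ := h.contDiff_ofReal
  induction m generalizing f with
  | zero =>
    refine vanishesOn_one fun x hx => ?_
    simp [h.eq_zero x hx]
  | succ m ih =>
    have cN := h.smooth_field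
    have cfN := contDiff_fderiv_apply cf cN
    refine vanishesOn_succ_of_apply (fun x hx => ?_)
      ((contDiff_const.mul cf).sub (cρ.mul cfN)) fun v => ?_
    · simp [hf.eq_zero (by omega) hx, h.eq_zero x hx]
    have cv := contDiff_fderiv_apply cf (contDiff_const (c := v))
    have cρv := contDiff_fderiv_apply h.smooth (contDiff_const (c := v))
    -- the tangential part of the constant field `v`; its derivative of `f` stays of order `m + 1`
    have cX : ContDiff ℝ ∞ (fun x => v - fderiv ℝ ρ x v • N x) :=
      contDiff_const.sub (cρv.smul cN)
    have cNv := contDiff_fderiv_apply cN (contDiff_const (c := v))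
    have t1 := h.vanishesOn_tangential cX (fun x hx => by simp [h.fderiv_field x hx]) cf hf
    have t2 := ih cv (hf.fderiv_apply cf contDiff_const)
    have t3 := h.vanishesOn.mul (hf.fderiv_apply cf cNv) cρ (contDiff_fderiv_apply cf cNv)
    rw [add_comm 1 m] at t3
    have c1 := contDiff_fderiv_apply cf cX
    have c2 : ContDiff ℝ ∞ (fun x => (m : ℂ) * fderiv ℝ f x v
        - (ρ x : ℂ) * fderiv ℝ (fun x => fderiv ℝ f x v) x (N x)) :=
      (contDiff_const.mul cv).sub (cρ.mul (contDiff_fderiv_apply cv cN))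
    have c3 := cρ.mul (contDiff_fderiv_apply cf cNv)
    have := (t1.add t2 c1 c2).sub t3 (c1.add c2) c3
    convert this using 2 with x
    have e1 : DifferentiableAt ℝ (fun x => ((m + 1 : ℕ) : ℂ) * f x) x :=
      (differentiable_of_smooth (contDiff_const.mul cf)) x
    have e2 := differentiable_of_smooth cρ x
    have e3 := differentiable_of_smooth cfN x
    have e4 := differentiable_of_smooth cf x
    rw [fderiv_fun_sub e1 (e2.fun_mul e3), fderiv_const_mul e4, fderiv_fun_mul e2 e3]
    simp only [_root_.sub_apply, _root_.add_apply,
      _root_.smul_apply, fderiv_fderiv_apply cf cN, fderiv_ofReal h.smooth, map_sub,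
      map_smul, smul_eq_mul, Complex.real_smul]
    push_cast
    ring

/-- A smooth function vanishing to order `m` has a leading coefficient with respect to `ρ ^ m`. -/
lemma IsDefining.exists_leading (h : IsDefining S ρ N) {m : ℕ} {f : E → ℂ}
    (cf : ContDiff ℝ ∞ f) (hf : VanishesOn S m f) :
    ∃ c : E → ℂ, ContDiff ℝ ∞ c ∧ VanishesOn S (m + 1) (fun x => f x - (ρ x : ℂ) ^ m * c x) := by
  have cρ := h.contDiff_ofReal
  induction m generalizing f with
  | zero => exact ⟨f, cf, by simpa using vanishesOn_zero⟩
  | succ m ih =>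
    have cfN := contDiff_fderiv_apply cf h.smooth_field
    obtain ⟨c, cc, hc⟩ := ih cfN (hf.fderiv_apply cf h.smooth_field)
    refine ⟨fun x => c x / (m + 1 : ℂ), cc.div_const _, ?_⟩
    have t1 := h.vanishesOn_euler cf hf
    have c4 := cfN.sub ((cρ.pow m).mul cc)
    have t2 := h.vanishesOn.mul hc cρ c4
    rw [add_comm 1] at t2
    have c1 := (contDiff_const (c := ((m + 1 : ℕ) : ℂ))).mul cf |>.sub (cρ.mul cfN)
    have c2 := cρ.mul c4
    have := (t1.add t2 c1 c2).mul_left (contDiff_const (c := ((m + 1 : ℂ))⁻¹)) (c1.add c2)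
    convert this using 2 with x
    have : (m + 1 : ℂ) ≠ 0 := by exact_mod_cast Nat.succ_ne_zero m
    push_cast
    field_simp
    ring

lemma IsDefining.eq_zero_of_pow_mul (h : IsDefining S ρ N) {m : ℕ} {b : E → ℂ}
    (cb : ContDiff ℝ ∞ b) (hb : VanishesOn S (m + 1) (fun x => (ρ x : ℂ) ^ m * b x)) :
    ∀ x ∈ S, b x = 0 := by
  have cρ := h.contDiff_ofReal
  induction m generalizing b with
  | zero => intro x hx; simpa using hb.eq_zero (by omega) hx
  | succ m ih =>
    intro x hx
    have cρN : ContDiff ℝ ∞ (fun x => (fderiv ℝ ρ x (N x) : ℂ)) :=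
      Complex.ofRealCLM.contDiff.comp (contDiff_fderiv_apply h.smooth h.smooth_field)
    have cbN := contDiff_fderiv_apply cb h.smooth_field
    have t1 := hb.fderiv_apply ((cρ.pow (m + 1)).mul cb) h.smooth_field
    have t2 := (h.vanishesOn_pow (m + 1)).mul_right (cρ.pow (m + 1)) cbN
    have c1 := contDiff_fderiv_apply ((cρ.pow (m + 1)).mul cb) h.smooth_field
    have c2 := (cρ.pow (m + 1)).mul cbN
    have cb' : ContDiff ℝ ∞ (fun x => (m + 1 : ℂ) * (fderiv ℝ ρ x (N x) : ℂ) * b x) :=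
      (contDiff_const.mul cρN).mul cb
    have t3 := ih cb' (by
      convert t1.sub t2 c1 c2 using 2 with y
      have e1 := differentiable_of_smooth (cρ.pow (m + 1)) y
      have e2 := differentiable_of_smooth cb y
      rw [fderiv_fun_mul e1 e2, fderiv_fun_pow _ (differentiable_of_smooth cρ y)]
      simp only [_root_.add_apply,
        _root_.smul_apply, fderiv_ofReal h.smooth, smul_eq_mul]
      push_cast
      simp
      ring) x hx
    have : (m + 1 : ℂ) ≠ 0 := by exact_mod_cast Nat.succ_ne_zero m
    simpa [h.fderiv_field x hx, this] using t3

end Hypersurface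

universe u

/-! ### Cutting off flat functions -/

section Flat

variable {E W : Type u} [NormedAddCommGroup E] [NormedSpace ℝ E]
  [NormedAddCommGroup W] [NormedSpace ℝ W]

lemma hasFDerivAt_indicator {D : Set E} (hD : IsOpen D) {f : E → W} (cf : ContDiff ℝ ∞ f)
    (hf : VanishesOn (frontier D) 2 f) (x : E) :
    HasFDerivAt (D.indicator f) (D.indicator (fderiv ℝ f) x) x := by
  have hx' := (differentiable_of_smooth cf x).hasFDerivAt
  by_cases hx : x ∈ D
  · rw [Set.indicator_of_mem hx]
    refine hx'.congr_of_eventuallyEq ?_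
    filter_upwards [hD.mem_nhds hx] with y hy using Set.indicator_of_mem hy f
  rw [Set.indicator_of_notMem hx]
  by_cases hx2 : x ∈ closure D
  · have hxf : x ∈ frontier D := by rw [hD.frontier_eq]; exact ⟨hx2, hx⟩
    have h0 : f x = 0 := hf.eq_zero (by omega) hxf
    have h1 : fderiv ℝ f x = 0 := hf.fderiv.eq_zero (by omega) hxf
    rw [h1] at hx'
    rw [hasFDerivAt_iff_isLittleO_nhds_zero] at hx' ⊢
    refine Asymptotics.IsBigO.trans_isLittleO ?_ hx'
    refine Asymptotics.isBigO_of_le _ fun v => ?_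
    simp only [h0, Set.indicator_of_notMem hx, sub_zero, _root_.zero_apply]
    exact norm_indicator_le_norm_self f _
  · refine (hasFDerivAt_const (0 : W) x).congr_of_eventuallyEq ?_
    filter_upwards [isClosed_closure.isOpen_compl.mem_nhds hx2] with y hy
    exact Set.indicator_of_notMem (fun h => hy (subset_closure h)) f

lemma fderiv_indicator {D : Set E} (hD : IsOpen D) {f : E → W} (cf : ContDiff ℝ ∞ f)
    (hf : VanishesOn (frontier D) 2 f) :
    fderiv ℝ (D.indicator f) = D.indicator (fderiv ℝ f) :=
  funext fun x => (hasFDerivAt_indicator hD cf hf x).fderiv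

/-- A function that vanishes to infinite order on the boundary of `D` may be cut off
along it. -/
lemma contDiff_indicator {D : Set E} (hD : IsOpen D) {f : E → W} (cf : ContDiff ℝ ∞ f)
    (hf : ∀ m, VanishesOn (frontier D) m f) : ContDiff ℝ ∞ (D.indicator f) := by
  rw [contDiff_infty]
  intro n
  induction n generalizing W with
  | zero =>
    exact contDiff_zero.2 (Differentiable.continuous (𝕜 := ℝ)
      fun x => (hasFDerivAt_indicator hD cf (hf 2) x).differentiableAt)
  | succ n ih =>
    have : ((n + 1 : ℕ) : WithTop ℕ∞) = (n : WithTop ℕ∞) + 1 := by push_cast; rfl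
    rw [this, contDiff_succ_iff_fderiv]
    refine ⟨fun x => (hasFDerivAt_indicator hD cf (hf 2) x).differentiableAt, by simp, ?_⟩
    rw [fderiv_indicator hD cf (hf 2)]
    exact ih (contDiff_fderiv cf) fun m => (hf (m + 1)).fderiv

end Flat

/-! ### Borel's theorem along a hypersurface -/

section Borel

variable {E W : Type u} [NormedAddCommGroup E] [NormedSpace ℝ E]
  [NormedAddCommGroup W] [NormedSpace ℝ W]

lemma exists_bound_iteratedFDeriv {f : E → W} (cf : ContDiff ℝ ∞ f) (hf : HasCompactSupport f)
    (i : ℕ) : ∃ C, 0 ≤ C ∧ ∀ x, ‖iteratedFDeriv ℝ i f x‖ ≤ C := by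
  obtain ⟨C, hC⟩ := (hf.iteratedFDeriv (𝕜 := ℝ) i).exists_bound_of_continuous
    (cf.continuous_iteratedFDeriv (m := i) (by exact_mod_cast le_top))
  exact ⟨C, (norm_nonneg _).trans (hC 0), hC⟩

/-- The derivatives of order `i` of a function of `ρ / ε` grow at most like `ε ^ (-i)`. -/
lemma exists_bound_rescaled {ρ : E → ℝ} (cρ : ContDiff ℝ ∞ ρ) (i : ℕ) {φ : ℝ → ℝ}
    (cφ : ContDiff ℝ ∞ φ) (hφ : HasCompactSupport φ) {h : E → W} (ch : ContDiff ℝ ∞ h)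
    (hh : HasCompactSupport h) :
    ∃ C, 0 ≤ C ∧ ∀ ε : ℝ, 0 < ε → ε ≤ 1 → ∀ x,
      ‖iteratedFDeriv ℝ i (fun x => φ (ε⁻¹ * ρ x) • h x) x‖ ≤ C * ε⁻¹ ^ i := by
  induction i generalizing W φ with
  | zero =>
    obtain ⟨C, hC0, hC⟩ := exists_bound_iteratedFDeriv ch hh 0
    obtain ⟨C', hC0', hC'⟩ := exists_bound_iteratedFDeriv cφ hφ 0
    refine ⟨C' * C, by positivity, fun ε _ _ x => ?_⟩
    simp only [norm_iteratedFDeriv_zero] at *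
    rw [norm_smul, pow_zero, mul_one]
    exact mul_le_mul (hC' _) (hC _) (norm_nonneg _) hC0'
  | succ i ih =>
    have cφ' : ContDiff ℝ ∞ (deriv φ) := (contDiff_infty_iff_deriv.1 cφ).2
    have cH : ContDiff ℝ ∞ (fun x => (fderiv ℝ ρ x).smulRight (h x)) :=
      ((ContinuousLinearMap.smulRightL ℝ E W).isBoundedBilinearMap).contDiff.comp
        ((contDiff_fderiv cρ).prodMk ch)
    have hH : HasCompactSupport (fun x => (fderiv ℝ ρ x).smulRight (h x)) :=
      hh.mono fun x hx hx' => hx (by ext; simp [hx'])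
    obtain ⟨C1, hC1, h1⟩ := ih cφ' hφ.deriv cH hH
    obtain ⟨C2, hC2, h2⟩ := ih cφ hφ (contDiff_fderiv ch) (hh.fderiv ℝ)
    refine ⟨C1 + C2, by positivity, fun ε hε hε1 x => ?_⟩
    rw [← norm_iteratedFDeriv_fderiv]
    have cερ : ContDiff ℝ ∞ (fun x => ε⁻¹ * ρ x) := contDiff_const.mul cρ
    have key : fderiv ℝ (fun x => φ (ε⁻¹ * ρ x) • h x) = fun x =>
        ε⁻¹ • (deriv φ (ε⁻¹ * ρ x) • (fderiv ℝ ρ x).smulRight (h x))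
          + φ (ε⁻¹ * ρ x) • fderiv ℝ h x := by
      ext1 y
      have d1 : HasFDerivAt (fun x => φ (ε⁻¹ * ρ x))
          (deriv φ (ε⁻¹ * ρ y) • (ε⁻¹ • fderiv ℝ ρ y)) y :=
        (differentiable_of_smooth cφ _).hasDerivAt.comp_hasFDerivAt y
          ((differentiable_of_smooth cρ y).hasFDerivAt.const_mul ε⁻¹)
      rw [(d1.fun_smul (differentiable_of_smooth ch y).hasFDerivAt).fderiv]
      ext v
      simp [smul_smul]
      rw [add_comm]; congr 2; ring
    have c1 : ContDiff ℝ ∞ (fun x => deriv φ (ε⁻¹ * ρ x) • (fderiv ℝ ρ x).smulRight (h x)) :=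
      (cφ'.comp cερ).smul cH
    have c2 : ContDiff ℝ ∞ (fun x => φ (ε⁻¹ * ρ x) • fderiv ℝ h x) :=
      (cφ.comp cερ).smul (contDiff_fderiv ch)
    have c3 : ContDiff ℝ ∞ (fun x => ε⁻¹ •
        (deriv φ (ε⁻¹ * ρ x) • (fderiv ℝ ρ x).smulRight (h x))) := c1.const_smul ε⁻¹
    rw [key, fun_iteratedFDeriv_add_apply (contDiff_nat c3 i).contDiffAt
      (contDiff_nat c2 i).contDiffAt]
    refine (norm_add_le _ _).trans ?_
    have e1 := iteratedFDeriv_const_smul_apply' (a := ε⁻¹) (contDiff_nat c1 i).contDiffAt (x := x)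
    rw [e1, norm_smul, Real.norm_of_nonneg (inv_nonneg.2 hε.le), add_mul]
    have hε' : 1 ≤ ε⁻¹ := (one_le_inv₀ hε).2 hε1
    gcongr ?_ + ?_
    · calc ε⁻¹ * _ ≤ ε⁻¹ * (C1 * ε⁻¹ ^ i) := by gcongr; exact h1 ε hε hε1 x
        _ = _ := by ring
    · refine (h2 ε hε hε1 x).trans ?_
      gcongr
      omega

/-- Borel's theorem along the zero set of `ρ`: every formal power series in `ρ` with smooth
coefficients is the expansion of a smooth function. -/
lemma exists_asymptotic_sum [CompleteSpace W] {S : Set E} {ρ : E → ℝ} (cρ : ContDiff ℝ ∞ ρ)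
    (hρ : ∀ x ∈ S, ρ x = 0) {r : ℕ} (hr : 1 ≤ r) {h : ℕ → E → W} (ch : ∀ j, ContDiff ℝ ∞ (h j))
    (hh : ∀ j, HasCompactSupport (h j)) :
    ∃ G : E → W, ContDiff ℝ ∞ G ∧
      ∀ m, VanishesOn S (m + r) (fun x => G x - ∑ j ∈ Finset.range m, ρ x ^ (j + r) • h j x) := by
  let χ : ContDiffBump (0 : ℝ) := ⟨1, 2, one_pos, one_lt_two⟩
  let φ : ℕ → ℝ → ℝ := fun j s => s ^ (j + r) * χ s
  have cφ : ∀ j, ContDiff ℝ ∞ (φ j) := fun j => (contDiff_id.pow _).mul χ.contDiff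
  have hφ : ∀ j, HasCompactSupport (φ j) := fun j => χ.hasCompactSupport.mul_left
  choose C hC0 hC using fun j i => exists_bound_rescaled cρ i (cφ j) (hφ j) (ch j) (hh j)
  -- the scale of the cut-off in the `j`-th term
  let M : ℕ → ℝ := fun j => 1 + ∑ i ∈ Finset.range (j + 1), C j i
  have hM : ∀ j, 1 ≤ M j := fun j => by
    have : 0 ≤ ∑ i ∈ Finset.range (j + 1), C j i := Finset.sum_nonneg fun i _ => hC0 j i
    simp only [M]; linarith
  let ε : ℕ → ℝ := fun j => (M j)⁻¹ * (1 / 2) ^ j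
  have hε0 : ∀ j, 0 < ε j := fun j => by
    have := hM j
    have : 0 < M j := by linarith
    positivity
  have hε1 : ∀ j, ε j ≤ 1 := fun j =>
    mul_le_one₀ (inv_le_one_of_one_le₀ (hM j)) (by positivity)
      (pow_le_one₀ (by norm_num) (by norm_num))
  let t : ℕ → E → W := fun j x => (ε j) ^ (j + r) • (φ j ((ε j)⁻¹ * ρ x) • h j x)
  have cερ : ∀ j, ContDiff ℝ ∞ (fun x => (ε j)⁻¹ * ρ x) := fun j => contDiff_const.mul cρ
  have ct' : ∀ j, ContDiff ℝ ∞ (fun x => φ j ((ε j)⁻¹ * ρ x) • h j x) := fun j =>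
    ((cφ j).comp (cερ j)).smul (ch j)
  have ct : ∀ j, ContDiff ℝ ∞ (t j) := fun j => contDiff_const.smul (ct' j)
  have bound : ∀ i j x, ‖iteratedFDeriv ℝ i (t j) x‖
      ≤ ε j ^ (j + r) * (C j i * (ε j)⁻¹ ^ i) := by
    intro i j x
    have e1 := iteratedFDeriv_const_smul_apply' (a := ε j ^ (j + r))
      (contDiff_nat (ct' j) i).contDiffAt (x := x)
    simp only [t]
    rw [e1, norm_smul, Real.norm_of_nonneg (pow_nonneg (hε0 j).le _)]
    gcongr
    · exact pow_nonneg (hε0 j).le _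
    · exact hC j i (ε j) (hε0 j) (hε1 j) x
  -- a summable majorant of the `i`-th derivatives; only the terms with `j ≥ i` have to be small
  let v : ℕ → ℕ → ℝ := fun i j => if i ≤ j then (1 / 2) ^ j
    else ε j ^ (j + r) * (C j i * (ε j)⁻¹ ^ i)
  have hv : ∀ i, Summable (v i) := by
    intro i
    refine (summable_geometric_two).congr_cofinite ?_
    rw [Nat.cofinite_eq_atTop]
    filter_upwards [eventually_ge_atTop i] with j hj
    simp [v, hj]
  have htv : ∀ i j x, ‖iteratedFDeriv ℝ i (t j) x‖ ≤ v i j := by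
    intro i j x
    by_cases hij : i ≤ j
    · simp only [v, hij, if_true]
      refine (bound i j x).trans ?_
      have hCM : C j i ≤ M j := by
        have := Finset.single_le_sum (f := fun i => C j i) (fun i _ => hC0 j i)
          (Finset.mem_range.2 (Nat.lt_succ_of_le hij))
        simp only [M]; linarith
      have hp : ε j ^ (j + r) * (ε j)⁻¹ ^ i ≤ ε j := by
        have e : j + r = (j + r - i - 1) + 1 + i := by omega
        rw [e, pow_add, mul_assoc, ← mul_pow, mul_inv_cancel₀ (hε0 j).ne', one_pow, mul_one,
          pow_succ]
        exact mul_le_of_le_one_left (hε0 j).le (pow_le_one₀ (hε0 j).le (hε1 j))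
      have hMp : 0 < M j := by linarith [hM j]
      calc _ = C j i * (ε j ^ (j + r) * (ε j)⁻¹ ^ i) := by ring
        _ ≤ M j * ε j := by
          gcongr
        _ = (1 / 2) ^ j := by simp only [ε]; field_simp
    · simp only [v, hij, if_false]; exact bound i j x
  refine ⟨fun x => ∑' j, t j x, contDiff_tsum (N := ⊤) ct (fun i _ => hv i)
    (fun i j x _ => htv i j x), fun m i hi x hx => ?_⟩
  have cG : ContDiff ℝ ∞ (fun x => ∑' j, t j x) :=
    contDiff_tsum (N := ⊤) ct (fun i _ => hv i) (fun i j x _ => htv i j x)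
  have cs : ∀ j, ContDiff ℝ ∞ (fun x => ρ x ^ (j + r) • h j x) := fun j =>
    (cρ.pow _).smul (ch j)
  rw [fun_iteratedFDeriv_sub_apply (contDiff_nat cG i).contDiffAt
    (contDiff_nat (ContDiff.sum fun j _ => cs j) i).contDiffAt]
  have hts := iteratedFDeriv_tsum_apply (N := ⊤) ct (fun i _ => hv i)
    (fun i j x _ => htv i j x) (k := i) le_top x
  rw [hts]
  -- near `S` the cut-off is `1`, so that the `j`-th term is the `j`-th term of the power series
  have germ : ∀ j, iteratedFDeriv ℝ i (t j) x
      = iteratedFDeriv ℝ i (fun x => ρ x ^ (j + r) • h j x) x := by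
    intro j
    refine (Filter.EventuallyEq.iteratedFDeriv ℝ ?_ i).eq_of_nhds
    have hc : ContinuousAt (fun y => (ε j)⁻¹ * ρ y) x := (cερ j).continuous.continuousAt
    have h0 : (fun y => (ε j)⁻¹ * ρ y) x = 0 := by simp [hρ x hx]
    have : ∀ᶠ y in 𝓝 x, χ ((ε j)⁻¹ * ρ y) = 1 := by
      have := hc.eventually (p := fun s => χ s = 1) (by rw [h0]; exact χ.eventuallyEq_one)
      exact this
    filter_upwards [this] with y hy
    simp only [t, φ, hy, mul_one, smul_smul]
    rw [← mul_pow, ← mul_assoc, mul_inv_cancel₀ (hε0 j).ne', one_mul]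
  have vanish : ∀ j, VanishesOn S (j + r) (fun x => ρ x ^ (j + r) • h j x) := by
    intro j
    have hp : ∀ q, VanishesOn S q (fun x => ρ x ^ q) := by
      intro q
      induction q with
      | zero => exact VanishesOn.zero_order
      | succ q ih =>
        simp only [pow_succ]
        exact ih.smul (vanishesOn_one hρ) (cρ.pow q) cρ
    simpa using (hp (j + r)).smul (VanishesOn.zero_order (f := h j)) (cρ.pow _) (ch j)
  rw [tsum_eq_sum (s := Finset.range m), sub_eq_zero]
  · rw [iteratedFDeriv_fun_sum_apply fun j _ => (contDiff_nat (cs j) i).contDiffAt]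
    exact Finset.sum_congr rfl fun j _ => germ j
  · intro j hj
    rw [Finset.mem_range, not_lt] at hj
    rw [germ j]
    exact vanish j i (by omega) x hx

end Borel

/-- Successive approximation: if `g` may be corrected step by step by terms `ρ ^ (m + r) • h`, all
the corrections may be made at once, up to terms vanishing to high order on `S`. -/
lemma exists_limit_of_corrections {E W : Type u} [NormedAddCommGroup E] [NormedSpace ℝ E]
    [NormedAddCommGroup W] [NormedSpace ℝ W] [CompleteSpace W]
    {S : Set E} {ρ : E → ℝ} (cρ : ContDiff ℝ ∞ ρ)
    (hρ : ∀ x ∈ S, ρ x = 0) {r : ℕ} (hr : 1 ≤ r) (Q : ℕ → (E → W) → Prop) {g : E → W}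
    (cg : ContDiff ℝ ∞ g) (hg : Q 0 g)
    (step : ∀ m f, ContDiff ℝ ∞ f → Q m f → ∃ h : E → W, ContDiff ℝ ∞ h ∧ HasCompactSupport h ∧
      Q (m + 1) (fun x => f x - ρ x ^ (m + r) • h x)) :
    ∃ G : E → W, ContDiff ℝ ∞ G ∧ VanishesOn S r (fun x => G x - g x) ∧
      ∀ m, ∃ f, ContDiff ℝ ∞ f ∧ Q m f ∧ VanishesOn S (m + r) (fun x => G x - f x) := by
  choose! H cH hH hQ using step
  let f : ℕ → E → W := fun m => Nat.rec g (fun m f x => f x - ρ x ^ (m + r) • H m f x) m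
  have f_succ : ∀ m, f (m + 1) = fun x => f m x - ρ x ^ (m + r) • H m (f m) x := fun m => rfl
  have hf : ∀ m, ContDiff ℝ ∞ (f m) ∧ Q m (f m) := by
    intro m
    induction m with
    | zero => exact ⟨cg, hg⟩
    | succ m ih =>
      rw [f_succ]
      exact ⟨ih.1.sub ((cρ.pow _).smul (cH m _ ih.1 ih.2)), hQ m _ ih.1 ih.2⟩
  obtain ⟨B, cB, hB⟩ := exists_asymptotic_sum cρ hρ hr (h := fun j => H j (f j))
    (fun j => cH j _ (hf j).1 (hf j).2) (fun j => hH j _ (hf j).1 (hf j).2)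
  have hsum : ∀ m x, f m x = g x - ∑ j ∈ Finset.range m, ρ x ^ (j + r) • H j (f j) x := by
    intro m x
    induction m with
    | zero => simp [f]
    | succ m ih => simp only [f_succ]; rw [Finset.sum_range_succ, ih]; abel
  have key : ∀ m, VanishesOn S (m + r) (fun x => (g x - B x) - f m x) := by
    intro m
    have := (hB m).neg (cB.sub (ContDiff.sum fun j _ =>
      (cρ.pow _).smul (cH j _ (hf j).1 (hf j).2)))
    convert this using 2 with x
    rw [hsum m x]; abel
  refine ⟨fun x => g x - B x, cg.sub cB, ?_, fun m => ⟨f m, (hf m).1, (hf m).2, key m⟩⟩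
  have := key 0
  rw [zero_add] at this
  exact this

/-! ### Constant complex vector fields -/

section ConstantFields

variable {E : Type*} [NormedAddCommGroup E] [NormedSpace ℝ E]

/-- The derivative of `f` along the constant complex vector field `P.1 + i P.2`. -/
noncomputable def cderiv (P : E × E) (f : E → ℂ) (x : E) : ℂ :=
  fderiv ℝ f x P.1 + Complex.I * fderiv ℝ f x P.2

variable {P Q : E × E} {f g : E → ℂ}

lemma contDiff_cderiv (hf : ContDiff ℝ ∞ f) : ContDiff ℝ ∞ (cderiv P f) :=
  (contDiff_fderiv_apply hf contDiff_const).add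
    (contDiff_const.mul (contDiff_fderiv_apply hf contDiff_const))

lemma cderiv_congr {x : E} (h : f =ᶠ[𝓝 x] g) : cderiv P f x = cderiv P g x := by
  simp only [cderiv, h.fderiv_eq]

lemma cderiv_add (hf : ContDiff ℝ ∞ f) (hg : ContDiff ℝ ∞ g) (x : E) :
    cderiv P (fun x => f x + g x) x = cderiv P f x + cderiv P g x := by
  simp only [cderiv, fderiv_fun_add (differentiable_of_smooth hf x) (differentiable_of_smooth hg x),
    _root_.add_apply]
  ring

lemma cderiv_sub (hf : ContDiff ℝ ∞ f) (hg : ContDiff ℝ ∞ g) (x : E) :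
    cderiv P (fun x => f x - g x) x = cderiv P f x - cderiv P g x := by
  simp only [cderiv, fderiv_fun_sub (differentiable_of_smooth hf x) (differentiable_of_smooth hg x),
    _root_.sub_apply]
  ring

lemma cderiv_const (c : ℂ) (x : E) : cderiv P (fun _ => c) x = 0 := by
  simp [cderiv]

lemma cderiv_mul (hf : ContDiff ℝ ∞ f) (hg : ContDiff ℝ ∞ g) (x : E) :
    cderiv P (fun x => f x * g x) x = f x * cderiv P g x + g x * cderiv P f x := by
  simp only [cderiv, fderiv_fun_mul (differentiable_of_smooth hf x) (differentiable_of_smooth hg x),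
    _root_.add_apply, _root_.smul_apply, smul_eq_mul]
  ring

lemma cderiv_const_mul (c : ℂ) (hf : ContDiff ℝ ∞ f) (x : E) :
    cderiv P (fun x => c * f x) x = c * cderiv P f x := by
  rw [cderiv_mul contDiff_const hf, cderiv_const]; ring

lemma cderiv_neg (hf : ContDiff ℝ ∞ f) (x : E) :
    cderiv P (fun x => - f x) x = - cderiv P f x := by
  have := cderiv_const_mul (P := P) (-1) hf x
  simpa using this

lemma cderiv_sum {ι : Type*} (s : Finset ι) {F : ι → E → ℂ} (hF : ∀ i ∈ s, ContDiff ℝ ∞ (F i))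
    (x : E) : cderiv P (fun x => ∑ i ∈ s, F i x) x = ∑ i ∈ s, cderiv P (F i) x := by
  classical
  induction s using Finset.induction_on with
  | empty => simp [cderiv_const]
  | insert a s ha ih =>
    simp only [Finset.sum_insert ha]
    rw [cderiv_add (hF a (by simp)) (ContDiff.sum fun i hi => hF i (by simp [hi])),
      ih fun i hi => hF i (by simp [hi])]

lemma cderiv_pow (hf : ContDiff ℝ ∞ f) (m : ℕ) (x : E) :
    cderiv P (fun x => f x ^ m) x = m * f x ^ (m - 1) * cderiv P f x := by
  simp only [cderiv, fderiv_fun_pow _ (differentiable_of_smooth hf x), _root_.smul_apply,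
    smul_eq_mul, nsmul_eq_mul]
  ring

lemma cderiv_comm (hf : ContDiff ℝ ∞ f) (x : E) :
    cderiv P (cderiv Q f) x = cderiv Q (cderiv P f) x := by
  have e : ∀ P Q : E × E, cderiv P (cderiv Q f) x =
      fderiv ℝ (fun y => fderiv ℝ f y Q.1) x P.1
      + Complex.I * fderiv ℝ (fun y => fderiv ℝ f y Q.2) x P.1
      + Complex.I * (fderiv ℝ (fun y => fderiv ℝ f y Q.1) x P.2
      + Complex.I * fderiv ℝ (fun y => fderiv ℝ f y Q.2) x P.2) := by
    intro P Q
    have d1 := differentiable_of_smooth (contDiff_fderiv_apply hf (contDiff_const (c := Q.1))) x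
    have d2 := differentiable_of_smooth (contDiff_fderiv_apply hf (contDiff_const (c := Q.2))) x
    have : fderiv ℝ (cderiv Q f) x = fderiv ℝ (fun y => fderiv ℝ f y Q.1) x
        + Complex.I • fderiv ℝ (fun y => fderiv ℝ f y Q.2) x := by
      unfold cderiv
      rw [fderiv_fun_add d1 (d2.const_mul _), fderiv_const_mul d2]
    rw [cderiv, this]
    simp only [_root_.add_apply, _root_.smul_apply, smul_eq_mul]
  have s : ∀ v w : E, fderiv ℝ (fun y => fderiv ℝ f y v) x w
      = fderiv ℝ (fun y => fderiv ℝ f y w) x v := by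
    intro v w
    have := fderiv_fderiv_apply hf (contDiff_const (c := v)) x w
    simpa using this
  rw [e P Q, e Q P, s Q.1 P.1, s Q.1 P.2, s Q.2 P.1, s Q.2 P.2]
  ring

lemma VanishesOn.cderiv {S : Set E} {m : ℕ} (h : VanishesOn S (m + 1) f) (hf : ContDiff ℝ ∞ f) :
    VanishesOn S m (cderiv P f) := by
  have c1 := contDiff_fderiv_apply hf (contDiff_const (c := P.1))
  have c2 := contDiff_fderiv_apply hf (contDiff_const (c := P.2))
  exact (h.fderiv_apply hf contDiff_const).add
    ((h.fderiv_apply hf contDiff_const).mul_left contDiff_const c2) c1 (contDiff_const.mul c2)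

lemma hasCompactSupport_cderiv (h : HasCompactSupport f) : HasCompactSupport (cderiv P f) := by
  refine (h.fderiv ℝ).mono fun x hx hx' => hx ?_
  simp [cderiv, hx']

lemma cderiv_ofReal_comp {φ : ℝ → ℝ} (cφ : ContDiff ℝ ∞ φ) {ρ : E → ℝ} (cρ : ContDiff ℝ ∞ ρ)
    (x : E) : cderiv P (fun x => (φ (ρ x) : ℂ)) x
      = ((deriv φ (ρ x) : ℝ) : ℂ) * cderiv P (fun x => (ρ x : ℂ)) x := by
  have d1 : HasFDerivAt (fun x => φ (ρ x)) (deriv φ (ρ x) • fderiv ℝ ρ x) x :=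
    (differentiable_of_smooth cφ _).hasDerivAt.comp_hasFDerivAt x
      ((differentiable_of_smooth cρ x).hasFDerivAt)
  have c2 : ContDiff ℝ ∞ (fun x => φ (ρ x)) := cφ.comp cρ
  simp only [cderiv, fderiv_ofReal cρ, fderiv_ofReal c2, d1.fderiv, _root_.smul_apply, smul_eq_mul]
  push_cast
  ring

end ConstantFields

/-! ### Cutoff functions -/

section Cutoff

variable {E : Type*} [NormedAddCommGroup E] [NormedSpace ℝ E] [FiniteDimensional ℝ E]

lemma exists_cutoff {K U : Set E} (hK : IsCompact K) (hU : IsOpen U) (hKU : K ⊆ U) :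
    ∃ η : E → ℝ, ContDiff ℝ ∞ η ∧ HasCompactSupport η ∧ tsupport η ⊆ U ∧
      (∀ x ∈ K, η =ᶠ[𝓝 x] fun _ => 1) ∧ ∀ x, 0 ≤ η x ∧ η x ≤ 1 := by
  obtain ⟨L, hL, hKL, hLU⟩ := exists_compact_between hK hU hKU
  obtain ⟨f, hf1, hf0, hf⟩ := exists_contMDiffMap_one_nhds_of_subset_interior
    (n := ⊤) (modelWithCornersSelf ℝ E) hK.isClosed hKL
  have hsupp : Function.support f ⊆ L := fun x hx => by
    by_contra h
    exact hx (hf0 x h)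
  have hts : tsupport f ⊆ L := closure_minimal hsupp hL.isClosed
  refine ⟨f, f.contMDiff.contDiff, hL.of_isClosed_subset (isClosed_tsupport _) hts,
    hts.trans hLU, fun x hx => ?_, fun x => hf x⟩
  filter_upwards [mem_nhdsSet_iff_forall.1 hf1 x hx] with y hy using hy

end Cutoff

lemma integrable_of_smooth {E W : Type*} [NormedAddCommGroup E] [NormedSpace ℝ E]
    [MeasurableSpace E] [BorelSpace E] (μ : Measure E) [IsFiniteMeasureOnCompacts μ]
    [NormedAddCommGroup W] [NormedSpace ℝ W] {f : E → W}
    (cf : ContDiff ℝ ∞ f) (hf : HasCompactSupport f) : Integrable f μ :=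
  cf.continuous.integrable_of_hasCompactSupport hf

/-! ### Integration by parts on the domain -/

section Integration

variable {E : Type} [NormedAddCommGroup E] [NormedSpace ℝ E] [FiniteDimensional ℝ E]
  [MeasurableSpace E] [BorelSpace E] (μ : Measure E) [μ.IsAddHaarMeasure]

lemma integral_fderiv_eq_zero {f : E → ℂ} (cf : Differentiable ℝ f) (hf : Integrable f μ) {v : E}
    (hf' : Integrable (fun x => fderiv ℝ f x v) μ) : ∫ x, fderiv ℝ f x v ∂μ = 0 := by
  have := integral_mul_fderiv_eq_neg_fderiv_mul_of_integrable (μ := μ) (f := fun _ : E => (1 : ℂ))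
    (g := f) (v := v) (by simp) (by simpa using hf') (by simpa using hf)
    (fun x _ => differentiableAt_const _) (fun x _ => cf x)
  simpa using this

lemma integral_cderiv_eq_zero {f : E → ℂ} (cf : ContDiff ℝ ∞ f) (hf : HasCompactSupport f)
    (P : E × E) : ∫ x, cderiv P f x ∂μ = 0 := by
  have h : ∀ v, Integrable (fun x => fderiv ℝ f x v) μ := fun v =>
    integrable_of_smooth μ (contDiff_fderiv_apply cf contDiff_const)
      ((hf.fderiv ℝ).mono fun x hx hx' => hx (by simp [hx']))
  have h0 := fun v => integral_fderiv_eq_zero μ (differentiable_of_smooth cf)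
    (integrable_of_smooth μ cf hf) (h v)
  unfold cderiv
  rw [integral_add (h _) ((h _).const_mul _), integral_const_mul, h0, h0]
  simp

lemma deriv_smoothTransition_of_nonpos {s : ℝ} (hs : s ≤ 0) : deriv Real.smoothTransition s = 0 := by
  refine IsLocalMin.deriv_eq_zero (Eventually.of_forall fun t => ?_)
  rw [Real.smoothTransition.zero_of_nonpos hs]
  exact Real.smoothTransition.nonneg t

lemma deriv_smoothTransition_of_one_le {s : ℝ} (hs : 1 ≤ s) : deriv Real.smoothTransition s = 0 := by
  refine IsLocalMax.deriv_eq_zero (Eventually.of_forall fun t => ?_)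
  rw [Real.smoothTransition.one_of_one_le hs]
  exact Real.smoothTransition.le_one t

/-- The divergence theorem on `{ρ > 0}` for vector fields whose normal component vanishes on the
boundary. -/
lemma integral_divergence_eq_zero {ρ : E → ℝ} (cρ : ContDiff ℝ ∞ ρ) {ι : Type*} [Fintype ι]
    (P : ι → E × E) {X : ι → E → ℂ} (cX : ∀ i, ContDiff ℝ ∞ (X i))
    (hX : ∀ i, HasCompactSupport (X i)) {b : E → ℂ} (hb : Integrable b μ)
    (h : ∀ x, ∑ i, X i x * cderiv (P i) (fun x => (ρ x : ℂ)) x = ρ x * b x) :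
    ∫ x in {x | 0 < ρ x}, ∑ i, cderiv (P i) (X i) x ∂μ = 0 := by
  have hst : ContDiff ℝ ∞ Real.smoothTransition := Real.smoothTransition.contDiff
  have st0 : ∀ s ≤ 0, Real.smoothTransition s = 0 :=
    fun s => Real.smoothTransition.zero_of_nonpos
  have st1 : ∀ s, 1 ≤ s → Real.smoothTransition s = 1 :=
    fun s => Real.smoothTransition.one_of_one_le
  have dst0 : ∀ s ≤ 0, deriv Real.smoothTransition s = 0 :=
    fun s => deriv_smoothTransition_of_nonpos
  have dst1 : ∀ s, 1 ≤ s → deriv Real.smoothTransition s = 0 :=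
    fun s => deriv_smoothTransition_of_one_le
  set st := Real.smoothTransition
  have hst' : Continuous (deriv st) := (contDiff_infty_iff_deriv.1 hst).2.continuous
  obtain ⟨C, hC⟩ := (isCompact_Icc (a := (0 : ℝ)) (b := 1)).exists_bound_of_continuousOn
    hst'.continuousOn
  have hC' : ∀ s, ‖deriv st s * s‖ ≤ C := by
    intro s
    have hC0 : 0 ≤ C := (norm_nonneg _).trans (hC 0 (by simp))
    rcases le_or_gt s 0 with h0 | h0
    · rw [dst0 _ h0]; simpa
    rcases le_or_gt 1 s with h1 | h1
    · rw [dst1 _ h1]; simpa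
    rw [norm_mul]
    have := hC s ⟨h0.le, h1.le⟩
    have h2 : ‖s‖ ≤ 1 := by rw [Real.norm_of_nonneg h0.le]; exact h1.le
    nlinarith [norm_nonneg s, norm_nonneg (deriv st s)]
  let D := {x | 0 < ρ x}
  have hD : MeasurableSet D := (isOpen_lt continuous_const cρ.continuous).measurableSet
  have cdX : ∀ i, ContDiff ℝ ∞ (cderiv (P i) (X i)) := fun i => contDiff_cderiv (cX i)
  have hdiv : Integrable (fun x => ∑ i, cderiv (P i) (X i) x) μ :=
    integrable_finsetSum _ fun i _ => integrable_of_smooth μ (cdX i)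
      (hasCompactSupport_cderiv (hX i))
  have cst : ∀ m : ℕ, ContDiff ℝ ∞ (fun s : ℝ => st (m * s)) := fun m =>
    hst.comp (contDiff_const.mul contDiff_id)
  have cχ : ∀ m : ℕ, ContDiff ℝ ∞ (fun x => (st (m * ρ x) : ℂ)) := fun m =>
    Complex.ofRealCLM.contDiff.comp ((cst m).comp cρ)
  have dst : ∀ (m : ℕ) s, deriv (fun s : ℝ => st (m * s)) s = m * deriv st (m * s) := by
    intro m s
    have := ((differentiable_of_smooth hst (m * s)).hasDerivAt.comp s
      ((hasDerivAt_id s).const_mul (m : ℝ))).deriv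
    rw [mul_one, mul_comm] at this
    exact this
  -- the cut-off `st (m ρ)` tends to the indicator function of `D`; since `∑ X_i P_i ρ = ρ b`, the
  -- derivative of the cut-off contributes the bounded factor `(deriv st) (m ρ) · m ρ`, which tends to `0`
  have key : ∀ m : ℕ, ∫ x, (st (m * ρ x) : ℂ) * ∑ i, cderiv (P i) (X i) x ∂μ
      = - ∫ x, ((deriv st (m * ρ x) * (m * ρ x) : ℝ) : ℂ) * b x ∂μ := by
    intro m
    have hpt : ∀ x, ∑ i, cderiv (P i) (fun x => (st (m * ρ x) : ℂ) * X i x) x =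
        (st (m * ρ x) : ℂ) * ∑ i, cderiv (P i) (X i) x +
          ((deriv st (m * ρ x) * (m * ρ x) : ℝ) : ℂ) * b x := by
      intro x
      have : ((deriv st (m * ρ x) * (m * ρ x) : ℝ) : ℂ) * b x
          = (m * deriv st (m * ρ x) : ℝ) * (ρ x * b x) := by push_cast; ring
      rw [this, ← h x, Finset.mul_sum, Finset.mul_sum, ← Finset.sum_add_distrib]
      refine Finset.sum_congr rfl fun i _ => ?_
      rw [cderiv_mul (cχ m) (cX i), cderiv_ofReal_comp (cst m) cρ, dst]
      ring
    have hz : ∫ x, ∑ i, cderiv (P i) (fun x => (st (m * ρ x) : ℂ) * X i x) x ∂μ = 0 := by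
      have ci := fun i => (cχ m).mul (cX i)
      have hi : ∀ i, HasCompactSupport (fun x => (st (m * ρ x) : ℂ) * X i x) :=
        fun i => (hX i).mul_left
      rw [integral_finsetSum _ fun i _ => integrable_of_smooth μ (contDiff_cderiv (ci i))
        (hasCompactSupport_cderiv (hi i))]
      exact Finset.sum_eq_zero fun i _ => integral_cderiv_eq_zero μ (ci i) (hi i) _
    simp only [hpt] at hz
    rw [integral_add] at hz
    · exact eq_neg_of_add_eq_zero_left hz
    · refine hdiv.bdd_mul (c := 1) (cχ m).continuous.aestronglyMeasurable
        (Eventually.of_forall fun x => ?_)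
      rw [Complex.norm_real, Real.norm_of_nonneg (Real.smoothTransition.nonneg _)]
      exact Real.smoothTransition.le_one _
    · refine hb.bdd_mul (c := C) ?_ (Eventually.of_forall fun x => ?_)
      · have : Continuous fun x => deriv st (m * ρ x) * (m * ρ x) := by
          have := cρ.continuous
          fun_prop
        exact (Complex.continuous_ofReal.comp this).aestronglyMeasurable
      · rw [Complex.norm_real]; exact hC' _
  have lim1 : Tendsto (fun m : ℕ => ∫ x, (st (m * ρ x) : ℂ) * ∑ i, cderiv (P i) (X i) x ∂μ) atTop
      (𝓝 (∫ x in D, ∑ i, cderiv (P i) (X i) x ∂μ)) := by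
    rw [← integral_indicator hD]
    refine tendsto_integral_of_dominated_convergence (fun x => ‖∑ i, cderiv (P i) (X i) x‖)
      (fun m => ((cχ m).continuous.aestronglyMeasurable).mul hdiv.aestronglyMeasurable)
      hdiv.norm (fun m => Eventually.of_forall fun x => ?_) (Eventually.of_forall fun x => ?_)
    · rw [norm_mul, Complex.norm_real, Real.norm_of_nonneg (Real.smoothTransition.nonneg _)]
      exact mul_le_of_le_one_left (norm_nonneg _) (Real.smoothTransition.le_one _)
    · by_cases hx : x ∈ D
      · rw [Set.indicator_of_mem hx]
        refine tendsto_const_nhds.congr' ?_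
        have ht : Tendsto (fun m : ℕ => (m : ℝ) * ρ x) atTop atTop :=
          tendsto_natCast_atTop_atTop.atTop_mul_const hx
        filter_upwards [ht.eventually_ge_atTop 1] with m hm
        rw [st1 _ hm]; simp
      · rw [Set.indicator_of_notMem hx]
        refine tendsto_const_nhds.congr fun m => ?_
        have hx' : ρ x ≤ 0 := not_lt.1 hx
        rw [st0 _ (mul_nonpos_of_nonneg_of_nonpos (Nat.cast_nonneg m) hx')]
        simp
  have lim2 : Tendsto (fun m : ℕ => ∫ x, ((deriv st (m * ρ x) * (m * ρ x) : ℝ) : ℂ) * b x ∂μ) atTop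
      (𝓝 (∫ _, (0 : ℂ) ∂μ)) := by
    refine tendsto_integral_of_dominated_convergence (fun x => C * ‖b x‖)
      (fun m => ?_) (hb.norm.const_mul _) (fun m => Eventually.of_forall fun x => ?_)
      (Eventually.of_forall fun x => ?_)
    · have : Continuous fun x => deriv st (m * ρ x) * (m * ρ x) := by
        have := cρ.continuous
        fun_prop
      exact ((Complex.continuous_ofReal.comp this).aestronglyMeasurable).mul hb.aestronglyMeasurable
    · rw [norm_mul, Complex.norm_real]
      exact mul_le_mul_of_nonneg_right (hC' _) (norm_nonneg _)
    · refine tendsto_const_nhds.congr' ?_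
      rcases le_or_gt (ρ x) 0 with hx | hx
      · refine Eventually.of_forall fun m => ?_
        beta_reduce
        rw [dst0 _ (mul_nonpos_of_nonneg_of_nonpos (Nat.cast_nonneg m) hx)]; simp
      · have ht : Tendsto (fun m : ℕ => (m : ℝ) * ρ x) atTop atTop :=
          tendsto_natCast_atTop_atTop.atTop_mul_const hx
        filter_upwards [ht.eventually_ge_atTop 1] with m hm
        rw [dst1 _ hm]; simp
  rw [integral_zero] at lim2
  simp only [key] at lim1
  have := tendsto_nhds_unique lim1 lim2.neg
  simpa using this

variable {D : Set E} {ρ : E → ℝ} {N : E → E}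

/-- A function vanishing on the boundary may be integrated by parts on `D`. -/
lemma setIntegral_cderiv_eq_zero (hρ : IsDefining (frontier D) ρ N) (hD : D = {x | 0 < ρ x})
    {w : E → ℂ} (cw : ContDiff ℝ ∞ w) (hw : HasCompactSupport w) (hw0 : ∀ x ∈ frontier D, w x = 0)
    (P : E × E) : ∫ x in D, cderiv P w x ∂μ = 0 := by
  have hDo : IsOpen D := by rw [hD]; exact isOpen_lt continuous_const hρ.smooth.continuous
  have cρ := hρ.contDiff_ofReal
  obtain ⟨c, cc, hc⟩ := hρ.exists_leading cw (vanishesOn_one hw0)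
  obtain ⟨η, cη, hη, -, hη1, -⟩ := exists_cutoff hw isOpen_univ (Set.subset_univ _)
  have cη' : ContDiff ℝ ∞ (fun x => (η x : ℂ)) := Complex.ofRealCLM.contDiff.comp cη
  have hη' : HasCompactSupport (fun x => (η x : ℂ)) :=
    hη.mono fun x hx hx' => hx (by simp [hx'])
  have c1 := cη'.mul cc
  have h1 : HasCompactSupport (fun x => (η x : ℂ) * c x) := hη'.mul_right
  have c2 := cρ.mul c1
  have h2 : HasCompactSupport (fun x => (ρ x : ℂ) * ((η x : ℂ) * c x)) := h1.mul_left
  have c3 := cw.sub c2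
  have h3 : HasCompactSupport (fun x => w x - (ρ x : ℂ) * ((η x : ℂ) * c x)) := hw.sub h2
  -- `w = ρ η c + w₂`, where `w₂` vanishes to second order, so that its indicator is differentiable
  have van : VanishesOn (frontier D) 2 (fun x => w x - (ρ x : ℂ) * ((η x : ℂ) * c x)) := by
    have := hc.mul_left cη' (cw.sub ((cρ.pow 1).mul cc))
    convert this using 2 with x
    by_cases hx : x ∈ tsupport w
    · rw [(hη1 x hx).eq_of_nhds]; simp
    · rw [image_eq_zero_of_notMem_tsupport hx]; ring
  have i2 : ∫ x in D, cderiv P (fun x => (ρ x : ℂ) * ((η x : ℂ) * c x)) x ∂μ = 0 := by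
    have := integral_divergence_eq_zero μ hρ.smooth (ι := Unit) (fun _ => P)
      (X := fun _ x => (ρ x : ℂ) * ((η x : ℂ) * c x)) (fun _ => c2) (fun _ => h2)
      (b := fun x => ((η x : ℂ) * c x) * cderiv P (fun x => (ρ x : ℂ)) x)
      (integrable_of_smooth μ (c1.mul (contDiff_cderiv cρ)) h1.mul_right)
      (fun x => by simp; ring)
    rw [hD]
    simpa using this
  have i3 : ∫ x in D, cderiv P (fun x => w x - (ρ x : ℂ) * ((η x : ℂ) * c x)) x ∂μ = 0 := by
    set f := fun x => w x - (ρ x : ℂ) * ((η x : ℂ) * c x)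
    have hi : ∀ v, Integrable (D.indicator (fun x => fderiv ℝ f x v)) μ := fun v =>
      (integrable_of_smooth μ (contDiff_fderiv_apply c3 contDiff_const)
        ((h3.fderiv ℝ).mono fun x hx hx' => hx (by simp [hx']))).indicator hDo.measurableSet
    have e : ∀ v x, fderiv ℝ (D.indicator f) x v = D.indicator (fun x => fderiv ℝ f x v) x := by
      intro v x
      rw [fderiv_indicator hDo c3 van]
      by_cases hx : x ∈ D <;> simp [hx]
    have h0 : ∀ v, ∫ x in D, fderiv ℝ f x v ∂μ = 0 := by
      intro v
      rw [← integral_indicator hDo.measurableSet]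
      simp only [← e]
      refine integral_fderiv_eq_zero μ
        (fun x => (hasFDerivAt_indicator hDo c3 van x).differentiableAt)
        ((integrable_of_smooth μ c3 h3).indicator hDo.measurableSet) ?_
      simp only [e]; exact hi v
    have hi' : ∀ v, Integrable (fun x => fderiv ℝ f x v) (μ.restrict D) := fun v =>
      (integrable_indicator_iff hDo.measurableSet).1 (hi v)
    unfold cderiv
    rw [integral_add (hi' _) ((hi' _).const_mul _), integral_const_mul, h0, h0]
    simp
  have i4 : ∀ x, cderiv P w x = cderiv P (fun x => w x - (ρ x : ℂ) * ((η x : ℂ) * c x)) x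
      + cderiv P (fun x => (ρ x : ℂ) * ((η x : ℂ) * c x)) x := by
    intro x
    rw [← cderiv_add c3 c2]; congr 1; ext y; ring
  simp only [i4]
  rw [integral_add (integrable_of_smooth μ (contDiff_cderiv c3)
    (hasCompactSupport_cderiv h3)).integrableOn (integrable_of_smooth μ (contDiff_cderiv c2)
    (hasCompactSupport_cderiv h2)).integrableOn, i2, i3, add_zero]

/-- The indicator function of `D` is not weakly constant near a boundary point that is also a
boundary point of the exterior. -/
lemma exists_setIntegral_fderiv_ne_zero (hD : IsOpen D) {x₀ : E} (h1 : x₀ ∈ closure D)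
    (h2 : x₀ ∈ closure (closure D)ᶜ) {R : ℝ} (hR : 0 < R) :
    ∃ (φ : E → ℝ) (v : E), ContDiff ℝ ∞ φ ∧ HasCompactSupport φ ∧
      tsupport φ ⊆ Metric.ball x₀ R ∧ ∫ x in D, fderiv ℝ φ x v ∂μ ≠ 0 := by
  by_contra! hcon
  obtain ⟨y, hyD, hy⟩ := Metric.mem_closure_iff.1 h1 (R / 2) (by positivity)
  obtain ⟨z, hzD, hz⟩ := Metric.mem_closure_iff.1 h2 (R / 2) (by positivity)
  obtain ⟨δ₁, hδ₁, hb1⟩ := Metric.isOpen_iff.1 hD y hyD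
  obtain ⟨δ₂, hδ₂, hb2⟩ := Metric.isOpen_iff.1 isClosed_closure.isOpen_compl z hzD
  set δ := min (R / 2) (min δ₁ δ₂) / 2
  have hδ : 0 < δ := by positivity
  have hδ' : 2 * δ = min (R / 2) (min δ₁ δ₂) := by simp only [δ]; ring
  have hδR : 2 * δ ≤ R / 2 := hδ' ▸ min_le_left _ _
  have hδ1 : 2 * δ ≤ δ₁ := hδ' ▸ (min_le_right _ _).trans (min_le_left _ _)
  have hδ2 : 2 * δ ≤ δ₂ := hδ' ▸ (min_le_right _ _).trans (min_le_right _ _)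
  let b : ContDiffBump (0 : E) := ⟨δ / 2, δ, by positivity, by linarith⟩
  have cb : ContDiff ℝ ∞ b := b.contDiff
  -- if the weak gradient of the indicator function vanished near `x₀`, the mollification `J` would be
  -- locally constant, but it is positive near `y ∈ D` and `0` near `z ∉ closure D`
  let J : E → ℝ := convolution (D.indicator (fun _ => (1 : ℝ))) b (ContinuousLinearMap.lsmul ℝ ℝ) μ
  have hloc : LocallyIntegrable (D.indicator (fun _ => (1 : ℝ))) μ :=
    (locallyIntegrable_const 1).indicator hD.measurableSet
  have hJ : ∀ w, J w = ∫ x in D, b (w - x) ∂μ := by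
    intro w
    simp only [J, convolution_def, ContinuousLinearMap.lsmul_apply, smul_eq_mul]
    rw [← integral_indicator hD.measurableSet]
    congr 1; ext x
    by_cases hx : x ∈ D <;> simp [hx]
  have hJ' : ∀ w ∈ Metric.ball x₀ (R / 2), HasFDerivAt J (0 : E →L[ℝ] ℝ) w := by
    intro w hw
    have hd := b.hasCompactSupport.hasFDerivAt_convolution_right (ContinuousLinearMap.lsmul ℝ ℝ)
      hloc (b.contDiff (n := 1)) w
    refine hd.congr_fderiv (ContinuousLinearMap.ext fun e => ?_)
    rw [convolution_precompR_apply (ContinuousLinearMap.lsmul ℝ ℝ) hloc (b.hasCompactSupport.fderiv ℝ)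
      (contDiff_fderiv cb).continuous w e]
    simp only [convolution_def, ContinuousLinearMap.lsmul_apply, smul_eq_mul,
      _root_.zero_apply]
    let φ : E → ℝ := fun x => b (w - x)
    have cφ : ContDiff ℝ ∞ φ := cb.comp (contDiff_const.sub contDiff_id)
    have hsub : tsupport φ ⊆ Metric.closedBall w δ := by
      refine closure_minimal (fun x hx => ?_) Metric.isClosed_closedBall
      have : w - x ∈ Function.support b := hx
      rw [b.support_eq, mem_ball_zero_iff] at this
      rw [Metric.mem_closedBall, dist_comm, dist_eq_norm]
      exact this.le
    have hφ : HasCompactSupport φ :=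
      (isCompact_closedBall w δ).of_isClosed_subset (isClosed_tsupport _) hsub
    have h0 := hcon φ e cφ hφ (hsub.trans fun x hx => by
      rw [Metric.mem_closedBall] at hx
      rw [Metric.mem_ball] at hw ⊢
      linarith [dist_triangle x w x₀])
    have hder : ∀ x, fderiv ℝ φ x e = - fderiv ℝ b (w - x) e := by
      intro x
      have h1 : HasFDerivAt b (fderiv ℝ b (w - x)) (w - x) :=
        (differentiable_of_smooth cb _).hasFDerivAt
      have h2 : HasFDerivAt φ _ x := h1.comp x ((hasFDerivAt_const w x).sub (hasFDerivAt_id x))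
      rw [h2.fderiv]
      simp
    simp only [hder, integral_neg, neg_eq_zero] at h0
    rw [← integral_indicator hD.measurableSet] at h0
    refine Eq.trans ?_ h0
    congr 1; ext x
    by_cases hx : x ∈ D <;> simp [hx]
  have hconst : J y = J z := by
    refine (convex_ball x₀ (R / 2)).is_const_of_fderivWithin_eq_zero (𝕜 := ℝ)
      (fun w hw => (hJ' w hw).differentiableAt.differentiableWithinAt) (fun w hw => ?_)
      (by rwa [Metric.mem_ball, dist_comm]) (by rwa [Metric.mem_ball, dist_comm])
    exact (hJ' w hw).hasFDerivWithinAt.fderivWithin (Metric.isOpen_ball.uniqueDiffWithinAt hw)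
  have hz0 : J z = 0 := by
    rw [hJ]
    refine setIntegral_eq_zero_of_forall_eq_zero fun x hx => ?_
    by_contra hne
    have : z - x ∈ Function.support b := hne
    rw [b.support_eq, mem_ball_zero_iff] at this
    refine hb2 (a := x) ?_ (subset_closure hx)
    rw [Metric.mem_ball, dist_comm, dist_eq_norm]
    have : ‖z - x‖ < δ := this
    linarith
  have hy0 : J y = ∫ x, b x ∂μ := by
    rw [hJ, ← integral_sub_left_eq_self b μ y]
    refine setIntegral_eq_integral_of_forall_compl_eq_zero fun x hx => ?_
    by_contra hne
    have : y - x ∈ Function.support b := hne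
    rw [b.support_eq, mem_ball_zero_iff] at this
    refine hx (hb1 ?_)
    rw [Metric.mem_ball, dist_comm, dist_eq_norm]
    have : ‖y - x‖ < δ := this
    linarith
  have := b.integral_pos (μ := μ)
  linarith

/-- If the divergence theorem on `D` holds without boundary term for all the fields `φ a`, the
normal component of `a` vanishes on the boundary. -/
lemma normal_component_eq_zero (cρ : ContDiff ℝ ∞ ρ) (hD : D = {x | 0 < ρ x})
    (hext : frontier D ⊆ closure (closure D)ᶜ) {ι : Type*} [Fintype ι]
    (P : ι → E × E) {a : ι → E → ℂ} (ca : ∀ i, ContDiff ℝ ∞ (a i))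
    (h : ∀ φ : E → ℂ, ContDiff ℝ ∞ φ → HasCompactSupport φ →
      ∫ x in D, ∑ i, cderiv (P i) (fun x => a i x * φ x) x ∂μ = 0) :
    ∀ x ∈ frontier D, ∑ i, a i x * cderiv (P i) (fun x => (ρ x : ℂ)) x = 0 := by
  intro x₀ hx₀
  by_contra hne
  have hDo : IsOpen D := by rw [hD]; exact isOpen_lt continuous_const cρ.continuous
  have cρ' : ContDiff ℝ ∞ (fun x => (ρ x : ℂ)) := Complex.ofRealCLM.contDiff.comp cρ
  let α : E → ℂ := fun x => ∑ i, a i x * cderiv (P i) (fun x => (ρ x : ℂ)) x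
  have cα : ContDiff ℝ ∞ α := ContDiff.sum fun i _ => (ca i).mul (contDiff_cderiv cρ')
  obtain ⟨R, hR, hball⟩ := Metric.isOpen_iff.1 (isOpen_ne_fun cα.continuous continuous_const)
    x₀ hne
  obtain ⟨φ, v, cφ, hφ, hφs, hφ0⟩ := exists_setIntegral_fderiv_ne_zero μ hDo
    (frontier_subset_closure hx₀) (hext hx₀) hR
  have cφ' : ContDiff ℝ ∞ (fun x => (φ x : ℂ)) := Complex.ofRealCLM.contDiff.comp cφ
  have hφ' : HasCompactSupport (fun x => (φ x : ℂ)) :=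
    hφ.mono fun x hx hx' => hx (by simp [hx'])
  -- with this `ψ`, the field `φ ∂_v - ψ ∑ a_i P_i` is tangential to the boundary
  let ψ : E → ℂ := fun x => φ x * ((fderiv ℝ ρ x v : ℂ) * (α x)⁻¹)
  have hψ : HasCompactSupport ψ := hφ'.mul_right
  have cψ : ContDiff ℝ ∞ ψ := by
    rw [contDiff_iff_contDiffAt]
    intro x
    by_cases hx : x ∈ tsupport φ
    · have : α x ≠ 0 := hball (hφs hx)
      exact cφ'.contDiffAt.mul (((Complex.ofRealCLM.contDiff.comp
        (contDiff_fderiv_apply cρ (contDiff_const (c := v)))).contDiffAt).mul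
          (cα.contDiffAt.inv this))
    · refine (contDiffAt_const (c := (0 : ℂ))).congr_of_eventuallyEq ?_
      filter_upwards [(isClosed_tsupport φ).isOpen_compl.mem_nhds hx] with y hy
      simp [ψ, image_eq_zero_of_notMem_tsupport hy]
  let P' : Option ι → E × E := fun o => o.elim (v, 0) P
  let X : Option ι → E → ℂ := fun o => o.elim (fun x => (φ x : ℂ)) (fun i x => -(a i x * ψ x))
  have cX : ∀ o, ContDiff ℝ ∞ (X o) := by
    rintro (_ | i)
    · exact cφ'
    · exact ((ca i).mul cψ).neg
  have hX : ∀ o, HasCompactSupport (X o) := by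
    rintro (_ | i)
    · exact hφ'
    · exact (HasCompactSupport.mul_left hψ).neg
  have hz := integral_divergence_eq_zero μ cρ P' cX hX (b := fun _ => 0) (by simp) (fun x => by
    rw [Fintype.sum_option]
    simp only [P', X, Option.elim, mul_zero]
    have e1 : ∑ i, -(a i x * ψ x) * cderiv (P i) (fun x => (ρ x : ℂ)) x = - (ψ x * α x) := by
      simp only [α, Finset.mul_sum, ← Finset.sum_neg_distrib]
      exact Finset.sum_congr rfl fun i _ => by ring
    have e2 : ψ x * α x = φ x * (fderiv ℝ ρ x v : ℂ) := by
      by_cases hx : x ∈ tsupport φ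
      · have : α x ≠ 0 := hball (hφs hx)
        simp only [ψ]; field_simp
      · simp [ψ, image_eq_zero_of_notMem_tsupport hx]
    rw [e1, e2, cderiv, fderiv_ofReal cρ]
    simp)
  rw [← hD] at hz
  have hint : ∀ i, Integrable (cderiv (P i) (fun x => a i x * ψ x)) (μ.restrict D) := fun i =>
    (integrable_of_smooth μ (contDiff_cderiv ((ca i).mul cψ))
      (hasCompactSupport_cderiv hψ.mul_left)).integrableOn
  have hneg : ∀ i x, cderiv (P i) (X (some i)) x = - cderiv (P i) (fun x => a i x * ψ x) x :=
    fun i x => cderiv_neg ((ca i).mul cψ) x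
  simp only [Fintype.sum_option, P', Option.elim, hneg, Finset.sum_neg_distrib] at hz
  rw [integral_add, integral_neg, h ψ cψ hψ, neg_zero, add_zero] at hz
  · simp only [X, Option.elim, cderiv, fderiv_ofReal cφ] at hz
    simp only [map_zero, Complex.ofReal_zero, mul_zero, add_zero] at hz
    have hz' := (integral_ofReal (𝕜 := ℂ) (f := fun x => fderiv ℝ φ x v)
      (μ := μ.restrict D)).symm.trans hz
    exact hφ0 (Complex.ofReal_eq_zero.1 hz')
  · exact (integrable_of_smooth μ (contDiff_cderiv cφ')
      (hasCompactSupport_cderiv hφ')).integrableOn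
  · exact (integrable_finsetSum _ fun i _ => hint i).neg

end Integration

/-! ### The Newton kernel of ℝ⁴ -/

section Newton

/-- The space of one quaternionic variable. -/
abbrev QSpace : Type := EuclideanSpace ℝ (Fin 4)

/-- The Laplacian in the four variables given by a linear map from `ℝ⁴`. -/
noncomputable def blockLaplacian {E : Type*} [NormedAddCommGroup E] [NormedSpace ℝ E]
    (T : QSpace →ₗᵢ[ℝ] E) (f : E → ℂ) (x : E) : ℂ :=
  ∑ j, fderiv ℝ (fun y => fderiv ℝ f y (T (EuclideanSpace.single j 1))) x
    (T (EuclideanSpace.single j 1))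

lemma contDiff_blockLaplacian {E : Type*} [NormedAddCommGroup E] [NormedSpace ℝ E]
    (T : QSpace →ₗᵢ[ℝ] E) {f : E → ℂ} (cf : ContDiff ℝ ∞ f) : ContDiff ℝ ∞ (blockLaplacian T f) :=
  ContDiff.sum fun _ _ => contDiff_fderiv_apply (contDiff_fderiv_apply cf contDiff_const)
    contDiff_const

lemma hasCompactSupport_fderiv_apply {E W : Type*} [NormedAddCommGroup E] [NormedSpace ℝ E]
    [NormedAddCommGroup W] [NormedSpace ℝ W] {f : E → W}
    (hf : HasCompactSupport f) (v : E) : HasCompactSupport (fun x => fderiv ℝ f x v) :=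
  (hf.fderiv ℝ).mono fun x hx hx' => hx (by simp [hx'])

lemma hasCompactSupport_blockLaplacian {E : Type*} [NormedAddCommGroup E] [NormedSpace ℝ E]
    (T : QSpace →ₗᵢ[ℝ] E) {f : E → ℂ} (hf : HasCompactSupport f) :
    HasCompactSupport (blockLaplacian T f) := by
  have : tsupport (blockLaplacian T f) ⊆ tsupport f := by
    refine closure_minimal (fun x hx => ?_) (isClosed_tsupport f)
    by_contra hxf
    refine hx (Finset.sum_eq_zero fun j _ => ?_)
    have : (fun y => fderiv ℝ f y (T (EuclideanSpace.single j 1))) =ᶠ[𝓝 x] fun _ => (0 : ℂ) := by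
      have h0 : f =ᶠ[𝓝 x] fun _ => (0 : ℂ) := by
        filter_upwards [(isClosed_tsupport f).isOpen_compl.mem_nhds hxf] with y hy
          using image_eq_zero_of_notMem_tsupport hy
      filter_upwards [h0.fderiv (𝕜 := ℝ)] with y hy
      rw [hy]; simp
    rw [this.fderiv_eq]; simp
  exact hf.of_isClosed_subset (isClosed_tsupport _) this

lemma integrable_smul_of_smooth {E W : Type*} [NormedAddCommGroup E] [NormedSpace ℝ E]
    [MeasurableSpace E] [BorelSpace E] (μ : Measure E) [IsFiniteMeasureOnCompacts μ]
    [NormedAddCommGroup W] [NormedSpace ℝ W] {a : E → ℝ} {h : E → W} (ca : ContDiff ℝ ∞ a)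
    (ch : ContDiff ℝ ∞ h) (hh : HasCompactSupport h) : Integrable (fun x => a x • h x) μ :=
  integrable_of_smooth μ (ca.smul ch) hh.smul_left

lemma integral_smul_fderiv {E : Type*} [NormedAddCommGroup E] [NormedSpace ℝ E]
    [FiniteDimensional ℝ E] [MeasurableSpace E] [BorelSpace E] (μ : Measure E)
    [μ.IsAddHaarMeasure] {a : E → ℝ} (ca : ContDiff ℝ ∞ a) {h : E → ℂ} (ch : ContDiff ℝ ∞ h)
    (hh : HasCompactSupport h) (v : E) :
    ∫ x, a x • fderiv ℝ h x v ∂μ = - ∫ x, fderiv ℝ a x v • h x ∂μ := by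
  refine integral_smul_fderiv_eq_neg_fderiv_smul_of_integrable ?_ ?_ ?_
    (fun x _ => differentiable_of_smooth ca x) (fun x _ => differentiable_of_smooth ch x)
  · exact integrable_of_smooth μ ((contDiff_fderiv_apply ca contDiff_const).smul ch) hh.smul_left
  · exact integrable_of_smooth μ (ca.smul (contDiff_fderiv_apply ch contDiff_const))
      (hasCompactSupport_fderiv_apply hh v).smul_left
  · exact integrable_of_smooth μ (ca.smul ch) hh.smul_left

lemma fderiv_norm_sq_single (p : QSpace) (j : Fin 4) (ε : ℝ) :
    HasFDerivAt (fun p : QSpace => ‖p‖ ^ 2 + ε ^ 2) ((2 : ℝ) • innerSL ℝ p) p ∧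
      ((2 : ℝ) • innerSL ℝ p) (EuclideanSpace.single j 1) = 2 * p j := by
  constructor
  · have := (hasStrictFDerivAt_norm_sq p).hasFDerivAt.add_const (ε ^ 2)
    exact this.congr_fderiv (by ext v; simp)
  · simp [EuclideanSpace.inner_single_right]

lemma fderiv_regularized_newton {ε : ℝ} (hε : 0 < ε) (p : QSpace) (j : Fin 4) :
    fderiv ℝ (fun p : QSpace => (‖p‖ ^ 2 + ε ^ 2)⁻¹) p (EuclideanSpace.single j 1)
      = -(2 * p j) * ((‖p‖ ^ 2 + ε ^ 2)⁻¹) ^ 2 := by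
  have hs : ‖p‖ ^ 2 + ε ^ 2 ≠ 0 := by positivity
  obtain ⟨e1, e2⟩ := fderiv_norm_sq_single p j ε
  have e3 : HasFDerivAt (fun p : QSpace => (‖p‖ ^ 2 + ε ^ 2)⁻¹)
      (-((‖p‖ ^ 2 + ε ^ 2) ^ 2)⁻¹ • ((2 : ℝ) • innerSL ℝ p)) p :=
    (hasDerivAt_inv hs).comp_hasFDerivAt p e1
  rw [e3.fderiv, _root_.smul_apply, e2, smul_eq_mul, inv_pow]
  ring

lemma fderiv_fderiv_regularized_newton {ε : ℝ} (hε : 0 < ε) (p : QSpace) (j : Fin 4) :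
    fderiv ℝ (fun p : QSpace => -(2 * p j) * ((‖p‖ ^ 2 + ε ^ 2)⁻¹) ^ 2) p
      (EuclideanSpace.single j 1) = -2 * ((‖p‖ ^ 2 + ε ^ 2)⁻¹) ^ 2
        + 8 * p j ^ 2 * ((‖p‖ ^ 2 + ε ^ 2)⁻¹) ^ 3 := by
  have hs : ‖p‖ ^ 2 + ε ^ 2 ≠ 0 := by positivity
  have e0 : DifferentiableAt ℝ (fun p : QSpace => (‖p‖ ^ 2 + ε ^ 2)⁻¹) p :=
    (fderiv_norm_sq_single p j ε).1.differentiableAt.fun_inv hs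
  have e1 : HasFDerivAt (fun p : QSpace => -(2 * p j))
      (-((2 : ℝ) • (EuclideanSpace.proj j : QSpace →L[ℝ] ℝ))) p :=
    ((EuclideanSpace.proj j : QSpace →L[ℝ] ℝ).hasFDerivAt.const_mul 2).neg
  rw [fderiv_fun_mul e1.differentiableAt (e0.fun_pow 2), fderiv_fun_pow 2 e0, e1.fderiv]
  simp only [_root_.add_apply, _root_.smul_apply, _root_.neg_apply, smul_eq_mul,
    fderiv_regularized_newton hε]
  have e2 : (EuclideanSpace.proj j : QSpace →L[ℝ] ℝ) (EuclideanSpace.single j 1) = 1 := by simp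
  rw [e2]
  generalize (‖p‖ ^ 2 + ε ^ 2)⁻¹ = t
  simp
  ring

lemma sum_regularized_newton {ε : ℝ} (hε : 0 < ε) (p : QSpace) :
    ∑ j : Fin 4, (-2 * ((‖p‖ ^ 2 + ε ^ 2)⁻¹) ^ 2 + 8 * p j ^ 2 * ((‖p‖ ^ 2 + ε ^ 2)⁻¹) ^ 3)
      = -(8 * ε ^ 2 * ((‖p‖ ^ 2 + ε ^ 2)⁻¹) ^ 3) := by
  have hs : ‖p‖ ^ 2 + ε ^ 2 ≠ 0 := by positivity
  have hn : ∑ j : Fin 4, p j ^ 2 = ‖p‖ ^ 2 := by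
    rw [EuclideanSpace.norm_sq_eq]; simp
  have ht : (‖p‖ ^ 2 + ε ^ 2) * (‖p‖ ^ 2 + ε ^ 2)⁻¹ = 1 := mul_inv_cancel₀ hs
  rw [Finset.sum_add_distrib, ← Finset.sum_mul, ← Finset.sum_mul,
    ← Finset.mul_sum, hn]
  generalize (‖p‖ ^ 2 + ε ^ 2)⁻¹ = t at *
  simp
  linear_combination 8 * t ^ 2 * ht

lemma integral_smul_blockLaplacian {a : QSpace → ℝ} {a₁ a₂ : Fin 4 → QSpace → ℝ}
    (ca : ContDiff ℝ ∞ a) (ca₁ : ∀ j, ContDiff ℝ ∞ (a₁ j)) (ca₂ : ∀ j, ContDiff ℝ ∞ (a₂ j))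
    (h₁ : ∀ j p, fderiv ℝ a p (EuclideanSpace.single j 1) = a₁ j p)
    (h₂ : ∀ j p, fderiv ℝ (a₁ j) p (EuclideanSpace.single j 1) = a₂ j p)
    {h : QSpace → ℂ} (ch : ContDiff ℝ ∞ h) (hh : HasCompactSupport h) :
    ∫ p : QSpace, a p • blockLaplacian LinearIsometry.id h p = ∫ p : QSpace, (∑ j, a₂ j p) • h p := by
  have cj : ∀ j, ContDiff ℝ ∞ (fun y => fderiv ℝ h y (EuclideanSpace.single j 1)) := fun j =>
    contDiff_fderiv_apply ch contDiff_const
  have hj : ∀ j, HasCompactSupport (fun y => fderiv ℝ h y (EuclideanSpace.single j 1)) := fun j =>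
    hasCompactSupport_fderiv_apply hh _
  have cjj : ∀ j, ContDiff ℝ ∞ (fun p => fderiv ℝ (fun y => fderiv ℝ h y
      (EuclideanSpace.single j 1)) p (EuclideanSpace.single j 1)) := fun j =>
    contDiff_fderiv_apply (cj j) contDiff_const
  have hjj : ∀ j, HasCompactSupport (fun p => fderiv ℝ (fun y => fderiv ℝ h y
      (EuclideanSpace.single j 1)) p (EuclideanSpace.single j 1)) := fun j =>
    hasCompactSupport_fderiv_apply (hj j) _
  have step : ∀ j, ∫ p : QSpace, a p •
      fderiv ℝ (fun y => fderiv ℝ h y (EuclideanSpace.single j 1)) p (EuclideanSpace.single j 1)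
      = ∫ p : QSpace, a₂ j p • h p := by
    intro j
    rw [integral_smul_fderiv _ ca (cj j) (hj j)]
    simp only [h₁]
    rw [integral_smul_fderiv _ (ca₁ j) ch hh, neg_neg]
    simp only [h₂]
  have i1 : ∀ j, Integrable (fun p : QSpace => a p •
      fderiv ℝ (fun y => fderiv ℝ h y (EuclideanSpace.single j 1)) p
        (EuclideanSpace.single j 1)) := fun j =>
    integrable_smul_of_smooth volume ca (cjj j) (hjj j)
  have i2 : ∀ j, Integrable (fun p : QSpace => a₂ j p • h p) := fun j =>
    integrable_smul_of_smooth volume (ca₂ j) ch hh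
  simp only [blockLaplacian, Finset.smul_sum, LinearIsometry.id_apply, Finset.sum_smul]
  rw [integral_finsetSum _ fun j _ => i1 j, integral_finsetSum _ fun j _ => i2 j]
  exact Finset.sum_congr rfl fun j _ => step j

/-- The regularization `1 / (|p|² + ε²)` of the Newton kernel of `ℝ⁴`: its Laplacian is
`-8 ε² / (|p|² + ε²)³`. -/
lemma integral_regularized_newton {ε : ℝ} (hε : 0 < ε) {h : QSpace → ℂ} (ch : ContDiff ℝ ∞ h)
    (hh : HasCompactSupport h) :
    ∫ p : QSpace, (‖p‖ ^ 2 + ε ^ 2)⁻¹ • blockLaplacian LinearIsometry.id h p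
      = - ∫ p : QSpace, (8 * ε ^ 2 * ((‖p‖ ^ 2 + ε ^ 2)⁻¹) ^ 3) • h p := by
  have cs : ContDiff ℝ ∞ (fun p : QSpace => ‖p‖ ^ 2 + ε ^ 2) :=
    (contDiff_norm_sq ℝ).add contDiff_const
  have ca : ContDiff ℝ ∞ (fun p : QSpace => (‖p‖ ^ 2 + ε ^ 2)⁻¹) :=
    cs.inv fun p => by positivity
  have cp : ∀ j, ContDiff ℝ ∞ (fun p : QSpace => p j) := fun j =>
    (EuclideanSpace.proj j : QSpace →L[ℝ] ℝ).contDiff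
  rw [integral_smul_blockLaplacian ca
    (fun j => (contDiff_const.mul (cp j)).neg.mul (ca.pow 2))
    (fun j => (contDiff_const.mul (ca.pow 2)).add ((contDiff_const.mul ((cp j).pow 2)).mul
      (ca.pow 3)))
    (fun j p => fderiv_regularized_newton hε p j)
    (fun j p => fderiv_fderiv_regularized_newton hε p j) ch hh, ← integral_neg]
  congr 1; ext1 p
  rw [← neg_smul]
  congr 1
  exact sum_regularized_newton hε p

/-- The constant `4 π²` of the Newton kernel of `ℝ⁴`, as an integral. -/
noncomputable def newtonConst : ℝ := ∫ p : QSpace, 8 * ((1 + ‖p‖ ^ 2)⁻¹) ^ 3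

lemma integrable_newtonConst : Integrable (fun p : QSpace => 8 * ((1 + ‖p‖ ^ 2)⁻¹) ^ 3) := by
  have := (integrable_rpow_neg_one_add_norm_sq (E := QSpace) (μ := volume) (r := 6)
    (by simp; norm_num)).const_mul 8
  convert this using 2 with p
  have h1 : (0 : ℝ) ≤ 1 + ‖p‖ ^ 2 := by positivity
  rw [show (-6 / 2 : ℝ) = -((3 : ℕ) : ℝ) by norm_num, Real.rpow_neg h1, Real.rpow_natCast, inv_pow]

lemma newtonConst_pos : 0 < newtonConst := by
  refine (integral_pos_iff_support_of_nonneg (fun p => by positivity) integrable_newtonConst).2 ?_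
  have : Function.support (fun p : QSpace => 8 * ((1 + ‖p‖ ^ 2)⁻¹) ^ 3) = Set.univ := by
    ext p; simp; positivity
  rw [this]; simp

lemma integrable_newton {W : Type*} [NormedAddCommGroup W] [NormedSpace ℝ W] {w : QSpace → W}
    (cw : Continuous w) (hw : HasCompactSupport w) :
    Integrable (fun p : QSpace => (‖p‖ ^ 2)⁻¹ • w p) := by
  obtain ⟨C, hC⟩ := hw.exists_bound_of_continuous cw
  obtain ⟨R, hR⟩ := hw.isBounded.subset_ball 0
  have h1 : IntegrableOn (fun p : QSpace => (‖p‖ ^ 2)⁻¹) (Metric.ball 0 R) := by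
    rw [integrableOn_fun_norm_addHaar (μ := volume) (E := QSpace) (f := fun y : ℝ => (y ^ 2)⁻¹)]
    refine ((continuous_id (X := ℝ)).integrableOn_Icc (a := 0) (b := R)).mono_set
      Set.Ioo_subset_Icc_self |>.congr_fun (fun y hy => ?_) measurableSet_Ioo
    have : y ≠ 0 := hy.1.ne'
    simp
    field_simp
  have h2 : IntegrableOn (fun p : QSpace => (‖p‖ ^ 2)⁻¹ • w p) (Metric.ball 0 R) := by
    refine (h1.norm.mul_const C).mono' ?_ (Eventually.of_forall fun p => ?_)
    · exact h1.aestronglyMeasurable.smul cw.aestronglyMeasurable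
    · rw [norm_smul]
      exact mul_le_mul_of_nonneg_left (hC p) (norm_nonneg _)
  refine (integrableOn_iff_integrable_of_support_subset fun p hp => ?_).1 h2
  exact hR (subset_tsupport _ fun h => hp (by simp [h]))

/-- `1 / |p|²` is a multiple of the fundamental solution of the Laplacian of `ℝ⁴`. -/
theorem integral_newton {h : QSpace → ℂ} (ch : ContDiff ℝ ∞ h) (hh : HasCompactSupport h) :
    ∫ p : QSpace, (‖p‖ ^ 2)⁻¹ • blockLaplacian LinearIsometry.id h p = -(newtonConst • h 0) := by
  have cL := contDiff_blockLaplacian LinearIsometry.id ch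
  have hL := hasCompactSupport_blockLaplacian LinearIsometry.id hh
  let ε : ℕ → ℝ := fun m => 1 / ((m : ℝ) + 1)
  have hε : ∀ m, 0 < ε m := fun m => Nat.one_div_pos_of_nat
  have hε0 : Tendsto ε atTop (𝓝 0) := tendsto_one_div_add_atTop_nhds_zero_nat
  have lim1 : Tendsto (fun m => ∫ p : QSpace, (‖p‖ ^ 2 + ε m ^ 2)⁻¹ •
      blockLaplacian LinearIsometry.id h p) atTop
      (𝓝 (∫ p : QSpace, (‖p‖ ^ 2)⁻¹ • blockLaplacian LinearIsometry.id h p)) := by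
    refine tendsto_integral_of_dominated_convergence
      (fun p => ‖(‖p‖ ^ 2)⁻¹ • blockLaplacian LinearIsometry.id h p‖) (fun m => ?_)
      (integrable_newton cL.continuous hL).norm (fun m => ?_) ?_
    · have hs : ∀ p : QSpace, ‖p‖ ^ 2 + ε m ^ 2 ≠ 0 := fun p => by
        have := hε m
        positivity
      exact (((by fun_prop : Continuous fun p : QSpace => ‖p‖ ^ 2 + ε m ^ 2).inv₀ hs).smul
        cL.continuous).aestronglyMeasurable
    · filter_upwards [Measure.ae_ne volume (0 : QSpace)] with p hp
      rw [norm_smul, norm_smul]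
      have hp' : 0 < ‖p‖ := norm_pos_iff.2 hp
      refine mul_le_mul_of_nonneg_right ?_ (norm_nonneg _)
      rw [Real.norm_of_nonneg (by positivity), Real.norm_of_nonneg (by positivity)]
      exact inv_anti₀ (by positivity) (by nlinarith [sq_nonneg (ε m)])
    · filter_upwards [Measure.ae_ne volume (0 : QSpace)] with p hp
      have hp' : 0 < ‖p‖ := norm_pos_iff.2 hp
      have : Tendsto (fun m => ‖p‖ ^ 2 + ε m ^ 2) atTop (𝓝 (‖p‖ ^ 2 + 0 ^ 2)) :=
        tendsto_const_nhds.add (hε0.pow 2)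
      have h2 := this.inv₀ (by positivity)
      simp only [ne_eq, OfNat.ofNat_ne_zero, not_false_eq_true, zero_pow, add_zero] at h2
      exact h2.smul_const _
  have scale : ∀ m, ∫ p : QSpace, (8 * ε m ^ 2 * ((‖p‖ ^ 2 + ε m ^ 2)⁻¹) ^ 3) • h p
      = ∫ p : QSpace, (8 * ((1 + ‖p‖ ^ 2)⁻¹) ^ 3) • h (ε m • p) := by
    intro m
    have he := hε m
    have := Measure.integral_comp_smul_of_nonneg (volume : Measure QSpace)
      (fun p : QSpace => (8 * ε m ^ 2 * ((‖p‖ ^ 2 + ε m ^ 2)⁻¹) ^ 3) • h p) (ε m) (hR := he.le)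
    simp only [finrank_euclideanSpace, Fintype.card_fin] at this
    rw [eq_inv_smul_iff₀ (by positivity)] at this
    rw [← this, ← integral_smul]
    congr 1; ext1 p
    rw [smul_smul]
    congr 1
    rw [norm_smul, Real.norm_of_nonneg he.le]
    have : (1 + ‖p‖ ^ 2) ≠ 0 := by positivity
    have e : (ε m * ‖p‖) ^ 2 + ε m ^ 2 = ε m ^ 2 * (1 + ‖p‖ ^ 2) := by ring
    rw [e]
    field_simp
  have lim2 : Tendsto (fun m => ∫ p : QSpace, (8 * ((1 + ‖p‖ ^ 2)⁻¹) ^ 3) • h (ε m • p)) atTop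
      (𝓝 (∫ p : QSpace, (8 * ((1 + ‖p‖ ^ 2)⁻¹) ^ 3) • h 0)) := by
    obtain ⟨C, hC⟩ := hh.exists_bound_of_continuous ch.continuous
    refine tendsto_integral_of_dominated_convergence
      (fun p => (8 * ((1 + ‖p‖ ^ 2)⁻¹) ^ 3) * C) (fun m => ?_)
      (integrable_newtonConst.mul_const C) (fun m => Eventually.of_forall fun p => ?_)
      (Eventually.of_forall fun p => ?_)
    · exact integrable_newtonConst.aestronglyMeasurable.smul
        (ch.continuous.comp (continuous_const_smul (ε m))).aestronglyMeasurable
    · rw [norm_smul, Real.norm_of_nonneg (by positivity)]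
      exact mul_le_mul_of_nonneg_left (hC _) (by positivity)
    · refine Tendsto.const_smul ?_ _
      have : Tendsto (fun m => ε m • p) atTop (𝓝 ((0 : ℝ) • p)) := hε0.smul_const p
      rw [zero_smul] at this
      exact (ch.continuous.tendsto 0).comp this
  rw [integral_smul_const] at lim2
  refine tendsto_nhds_unique lim1 ?_
  simp only [integral_regularized_newton (hε _) ch hh, scale]
  exact lim2.neg

end Newton

/-! ### Newton potentials in one quaternionic variable -/

section Potential

variable {E : Type} [NormedAddCommGroup E] [NormedSpace ℝ E] (T : QSpace →ₗᵢ[ℝ] E)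

/-- The Newton potential of `f` in the four variables given by `T`. -/
noncomputable def blockPotential {W : Type} [NormedAddCommGroup W] [NormedSpace ℝ W]
    (f : E → W) (x : E) : W :=
  ∫ p : QSpace, (‖p‖ ^ 2)⁻¹ • f (x - T p)

lemma contDiff_comp_sub {W : Type} [NormedAddCommGroup W] [NormedSpace ℝ W] {f : E → W}
    (cf : ContDiff ℝ ∞ f) (x : E) : ContDiff ℝ ∞ (fun p : QSpace => f (x - T p)) :=
  cf.comp (contDiff_const.sub T.toContinuousLinearMap.contDiff)

lemma hasCompactSupport_comp_sub {W : Type} [NormedAddCommGroup W] [NormedSpace ℝ W] {f : E → W}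
    (hf : HasCompactSupport f) (x : E) : HasCompactSupport (fun p : QSpace => f (x - T p)) := by
  refine hf.comp_isClosedEmbedding (g := fun p => x - T p) ?_
  exact (Homeomorph.subLeft x).isClosedEmbedding.comp T.isometry.isClosedEmbedding

lemma hasFDerivAt_blockPotential {W : Type} [NormedAddCommGroup W] [NormedSpace ℝ W] {f : E → W}
    (cf : ContDiff ℝ ∞ f) (hf : HasCompactSupport f) (x₀ : E) :
    HasFDerivAt (blockPotential T f) (blockPotential T (fderiv ℝ f) x₀) x₀ := by
  obtain ⟨C, hC⟩ := (hf.fderiv ℝ).exists_bound_of_continuous (contDiff_fderiv cf).continuous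
  obtain ⟨M, hM⟩ := hf.isBounded.subset_closedBall 0
  let b : ContDiffBump (0 : QSpace) := ⟨|M| + ‖x₀‖ + 1, |M| + ‖x₀‖ + 2, by positivity, by linarith⟩
  have hmeas : AEStronglyMeasurable (fun p : QSpace => (‖p‖ ^ 2)⁻¹) volume :=
    (by fun_prop : Measurable fun p : QSpace => (‖p‖ ^ 2)⁻¹).aestronglyMeasurable
  refine hasFDerivAt_integral_of_dominated_of_fderiv_le (μ := volume)
    (F := fun x p => (‖p‖ ^ 2)⁻¹ • f (x - T p))
    (F' := fun x p => (‖p‖ ^ 2)⁻¹ • fderiv ℝ f (x - T p))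
    (bound := fun p => (‖p‖ ^ 2)⁻¹ • (b p * C)) (Metric.ball_mem_nhds x₀ one_pos)
    (Eventually.of_forall fun x => ?_) ?_ ?_ ?_ ?_ ?_
  · exact hmeas.smul (contDiff_comp_sub T cf x).continuous.aestronglyMeasurable
  · exact integrable_newton (contDiff_comp_sub T cf x₀).continuous
      (hasCompactSupport_comp_sub T hf x₀)
  · exact hmeas.smul
      (contDiff_comp_sub T (contDiff_fderiv cf) x₀).continuous.aestronglyMeasurable
  · refine Eventually.of_forall fun p x hx => ?_
    rw [norm_smul, Real.norm_of_nonneg (by positivity), smul_eq_mul]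
    refine mul_le_mul_of_nonneg_left ?_ (by positivity)
    by_cases h0 : fderiv ℝ f (x - T p) = 0
    · rw [h0, norm_zero]
      exact mul_nonneg b.nonneg ((norm_nonneg _).trans (hC 0))
    · have h1 : x - T p ∈ tsupport f := tsupport_fderiv_subset ℝ (subset_tsupport _ h0)
      have h2 := hM h1
      rw [mem_closedBall_zero_iff] at h2
      rw [Metric.mem_ball, dist_eq_norm] at hx
      have h3 : ‖p‖ ≤ |M| + ‖x₀‖ + 1 := by
        have e : T p = x₀ + (x - x₀) - (x - T p) := by abel
        rw [← T.norm_map p, e]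
        calc _ ≤ ‖x₀‖ + ‖x - x₀‖ + ‖x - T p‖ := (norm_sub_le _ _).trans (by gcongr; exact norm_add_le _ _)
          _ ≤ _ := by linarith [le_abs_self M]
      have hb : b p = 1 := b.one_of_mem_closedBall (mem_closedBall_zero_iff.2 h3)
      rw [hb, one_mul]
      exact hC _
  · exact integrable_newton (b.continuous.mul continuous_const) b.hasCompactSupport.mul_right
  · refine Eventually.of_forall fun p x _ => HasFDerivAt.const_smul ?_ _
    have : HasFDerivAt (fun x => f (x - T p)) _ x :=
      (differentiable_of_smooth cf (x - T p)).hasFDerivAt.comp x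
        ((hasFDerivAt_id x).sub_const (T p))
    simpa using this

lemma contDiff_blockPotential {W : Type} [NormedAddCommGroup W] [NormedSpace ℝ W] {f : E → W}
    (cf : ContDiff ℝ ∞ f) (hf : HasCompactSupport f) : ContDiff ℝ ∞ (blockPotential T f) := by
  rw [contDiff_infty]
  intro n
  induction n generalizing W with
  | zero =>
    exact contDiff_zero.2 (Differentiable.continuous (𝕜 := ℝ)
      fun x => (hasFDerivAt_blockPotential T cf hf x).differentiableAt)
  | succ n ih =>
    have : ((n + 1 : ℕ) : WithTop ℕ∞) = (n : WithTop ℕ∞) + 1 := by push_cast; rfl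
    rw [this, contDiff_succ_iff_fderiv]
    refine ⟨fun x => (hasFDerivAt_blockPotential T cf hf x).differentiableAt, by simp, ?_⟩
    have e : fderiv ℝ (blockPotential T f) = blockPotential T (fderiv ℝ f) :=
      funext fun x => (hasFDerivAt_blockPotential T cf hf x).fderiv
    rw [e]
    exact ih (contDiff_fderiv cf) (hf.fderiv ℝ)

lemma fderiv_blockPotential {W : Type} [NormedAddCommGroup W] [NormedSpace ℝ W] [CompleteSpace W]
    {f : E → W} (cf : ContDiff ℝ ∞ f) (hf : HasCompactSupport f) (x v : E) :
    fderiv ℝ (blockPotential T f) x v = blockPotential T (fun y => fderiv ℝ f y v) x := by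
  rw [(hasFDerivAt_blockPotential T cf hf x).fderiv, blockPotential,
    ContinuousLinearMap.integral_apply]
  · rfl
  · exact integrable_newton (contDiff_comp_sub T (contDiff_fderiv cf) x).continuous
      (hasCompactSupport_comp_sub T (hf.fderiv ℝ) x)

lemma integrable_blockPotential {f : E → ℂ} (cf : ContDiff ℝ ∞ f) (hf : HasCompactSupport f)
    (x : E) : Integrable (fun p : QSpace => (‖p‖ ^ 2)⁻¹ • f (x - T p)) :=
  integrable_newton (contDiff_comp_sub T cf x).continuous (hasCompactSupport_comp_sub T hf x)

lemma blockPotential_add {f g : E → ℂ} (cf : ContDiff ℝ ∞ f) (hf : HasCompactSupport f)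
    (cg : ContDiff ℝ ∞ g) (hg : HasCompactSupport g) (x : E) :
    blockPotential T (fun y => f y + g y) x = blockPotential T f x + blockPotential T g x := by
  simp only [blockPotential, smul_add]
  exact integral_add (integrable_blockPotential T cf hf x) (integrable_blockPotential T cg hg x)

lemma blockPotential_const_mul {f : E → ℂ} (c : ℂ) (x : E) :
    blockPotential T (fun y => c * f y) x = c * blockPotential T f x := by
  simp only [blockPotential, ← integral_const_mul]
  congr 1; ext p
  rw [mul_smul_comm]

lemma cderiv_blockPotential {f : E → ℂ} (cf : ContDiff ℝ ∞ f) (hf : HasCompactSupport f)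
    (P : E × E) (x : E) :
    cderiv P (blockPotential T f) x = blockPotential T (cderiv P f) x := by
  have c1 := contDiff_fderiv_apply cf (contDiff_const (c := P.1))
  have c2 := contDiff_fderiv_apply cf (contDiff_const (c := P.2))
  have h1 := hasCompactSupport_fderiv_apply hf P.1
  have h2 := hasCompactSupport_fderiv_apply hf P.2
  unfold cderiv
  rw [blockPotential_add T c1 h1 (contDiff_const.mul c2) h2.mul_left, blockPotential_const_mul,
    fderiv_blockPotential T cf hf, fderiv_blockPotential T cf hf]

lemma fderiv_comp_sub {W : Type} [NormedAddCommGroup W] [NormedSpace ℝ W] {f : E → W}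
    (cf : ContDiff ℝ ∞ f) (x : E) (p v : QSpace) :
    fderiv ℝ (fun p => f (x - T p)) p v = - fderiv ℝ f (x - T p) (T v) := by
  have h1 := (differentiable_of_smooth cf (x - T p)).hasFDerivAt.comp p
    ((hasFDerivAt_const x p).sub (T.toContinuousLinearMap.hasFDerivAt))
  have h2 : HasFDerivAt (fun p => f (x - T p)) _ p := h1
  rw [h2.fderiv]
  simp

lemma blockLaplacian_comp_sub {f : E → ℂ} (cf : ContDiff ℝ ∞ f) (x : E) (p : QSpace) :
    blockLaplacian LinearIsometry.id (fun p => f (x - T p)) p = blockLaplacian T f (x - T p) := by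
  simp only [blockLaplacian, LinearIsometry.id_apply, fderiv_comp_sub T cf]
  refine Finset.sum_congr rfl fun j _ => ?_
  have c := contDiff_fderiv_apply cf (contDiff_const (c := T (EuclideanSpace.single j 1)))
  rw [fderiv_fun_neg, _root_.neg_apply,
    fderiv_comp_sub T (f := fun y => fderiv ℝ f y (T (EuclideanSpace.single j 1))) c, neg_neg]

lemma blockPotential_blockLaplacian {f : E → ℂ} (cf : ContDiff ℝ ∞ f) (hf : HasCompactSupport f)
    (x : E) : blockPotential T (blockLaplacian T f) x = -(newtonConst * f x) := by
  have := integral_newton (contDiff_comp_sub T cf x) (hasCompactSupport_comp_sub T hf x)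
  simp only [blockLaplacian_comp_sub T cf] at this
  rw [blockPotential, this]
  simp

end Potential

/-! ### Unique continuation -/

section UniqueContinuation

/-- The polarized square of the norm of `p + τ b`, which is holomorphic in the parameter `τ`. -/
noncomputable def complexNormSq (p b : QSpace) (τ : ℂ) : ℂ := ∑ j, ((p j : ℂ) + τ * b j) ^ 2

lemma complexNormSq_ofReal (p b : QSpace) (t : ℝ) :
    complexNormSq p b t = ((‖p + t • b‖ ^ 2 : ℝ) : ℂ) := by
  rw [EuclideanSpace.norm_sq_eq, complexNormSq]
  simp

lemma re_complexNormSq (p b : QSpace) (τ : ℂ) :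
    (complexNormSq p b τ).re = ‖p + τ.re • b‖ ^ 2 - τ.im ^ 2 * ‖b‖ ^ 2 := by
  rw [EuclideanSpace.norm_sq_eq, EuclideanSpace.norm_sq_eq, complexNormSq, Complex.re_sum,
    Finset.mul_sum, ← Finset.sum_sub_distrib]
  refine Finset.sum_congr rfl fun j _ => ?_
  simp [pow_two]
  ring

lemma hasDerivAt_complexNormSq (p b : QSpace) (τ : ℂ) :
    HasDerivAt (complexNormSq p b) (∑ j, 2 * ((p j : ℂ) + τ * b j) * b j) τ := by
  unfold complexNormSq
  refine HasDerivAt.fun_sum fun j _ => ?_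
  have := (((hasDerivAt_id τ).mul_const (b j : ℂ)).const_add (p j : ℂ)).fun_pow 2
  simpa using this

lemma continuous_complexNormSq (z b : QSpace) (τ : ℂ) :
    Continuous fun p : QSpace => complexNormSq (z - p) b τ := by
  unfold complexNormSq
  have : ∀ j, Continuous fun p : QSpace => ((z - p) j : ℝ) := fun j => by
    simp only [PiLp.sub_apply]; fun_prop
  fun_prop

/-- The Newton potential of a density supported away from a segment extends holomorphically along
the line through this segment. -/
lemma analyticOnNhd_newton {w : QSpace → ℂ} (cw : Continuous w) (hw : HasCompactSupport w)
    {z b : QSpace} {d δ : ℝ} (hd : 0 < d) (hδ : δ * ‖b‖ ≤ d / 2)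
    (hwd : ∀ p, w p ≠ 0 → ∀ t ∈ Set.Ioo (-δ) (1 + δ), d ≤ ‖z - p + t • b‖) :
    AnalyticOnNhd ℂ (fun τ => ∫ p : QSpace, (complexNormSq (z - p) b τ)⁻¹ * w p)
      {τ | τ.re ∈ Set.Ioo (-δ) (1 + δ) ∧ τ.im ∈ Set.Ioo (-δ) δ} := by
  set Ω : Set ℂ := {τ | τ.re ∈ Set.Ioo (-δ) (1 + δ) ∧ τ.im ∈ Set.Ioo (-δ) δ}
  have hΩ : IsOpen Ω := (isOpen_Ioo.preimage Complex.continuous_re).inter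
    (isOpen_Ioo.preimage Complex.continuous_im)
  have low : ∀ p, w p ≠ 0 → ∀ τ ∈ Ω, d ^ 2 / 2 ≤ ‖complexNormSq (z - p) b τ‖ := by
    intro p hp τ hτ
    refine le_trans ?_ (Complex.re_le_norm _)
    rw [re_complexNormSq]
    have h1 := hwd p hp τ.re hτ.1
    have h2 : |τ.im| * ‖b‖ ≤ d / 2 :=
      (mul_le_mul_of_nonneg_right (abs_lt.2 hτ.2).le (norm_nonneg b)).trans hδ
    have h3 : τ.im ^ 2 * ‖b‖ ^ 2 ≤ (d / 2) ^ 2 := by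
      rw [← mul_pow, ← sq_abs, abs_mul, abs_norm]
      exact pow_le_pow_left₀ (by positivity) h2 2
    have h4 : d ^ 2 ≤ ‖z - p + τ.re • b‖ ^ 2 := pow_le_pow_left₀ hd.le h1 2
    nlinarith
  have meas : ∀ τ, AEStronglyMeasurable (fun p : QSpace => (complexNormSq (z - p) b τ)⁻¹ * w p) := by
    intro τ
    exact ((continuous_complexNormSq z b τ).measurable.inv.mul
      cw.measurable).aestronglyMeasurable
  refine DifferentiableOn.analyticOnNhd (fun τ hτ => ?_) hΩ
  refine DifferentiableAt.differentiableWithinAt ?_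
  obtain ⟨r, hr, hball⟩ := Metric.isOpen_iff.1 hΩ τ hτ
  let B : QSpace → ℝ := fun p => ∑ j, 2 * (|(z - p) j| + (‖τ‖ + r) * |b j|) * |b j|
  have hB : Continuous B := by
    have : ∀ j, Continuous fun p : QSpace => |(z - p) j| := fun j => by
      simp only [PiLp.sub_apply]; fun_prop
    simp only [B]; fun_prop
  refine (hasDerivAt_integral_of_dominated_loc_of_deriv_le (μ := volume)
    (F := fun τ (p : QSpace) => (complexNormSq (z - p) b τ)⁻¹ * w p)
    (F' := fun τ p => -(∑ j, 2 * (((z - p) j : ℝ) + τ * b j) * b j) / complexNormSq (z - p) b τ ^ 2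
      * w p) (bound := fun p => B p * ((d ^ 2 / 2) ^ 2)⁻¹ * ‖w p‖)
    (Metric.ball_mem_nhds τ hr) (Eventually.of_forall fun σ => meas σ) ?_ ?_ ?_ ?_ ?_).2.differentiableAt
  · refine Integrable.mono' (g := fun p => (d ^ 2 / 2)⁻¹ * ‖w p‖)
      ((cw.integrable_of_hasCompactSupport hw).norm.const_mul _) (meas τ)
      (Eventually.of_forall fun p => ?_)
    rw [norm_mul, norm_inv]
    by_cases hp : w p = 0
    · simp [hp]
    · gcongr
      exact low p hp τ hτ
  · have h1 : Continuous fun p : QSpace => -(∑ j, 2 * ((((z - p) j : ℝ) : ℂ) + τ * b j) * b j) := by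
      have : ∀ j, Continuous fun p : QSpace => ((z - p) j : ℝ) := fun j => by
        simp only [PiLp.sub_apply]; fun_prop
      fun_prop
    exact ((h1.measurable.div ((continuous_complexNormSq z b τ).measurable.pow_const 2)).mul
      cw.measurable).aestronglyMeasurable
  · refine Eventually.of_forall fun p σ hσ => ?_
    by_cases hp : w p = 0
    · simp [hp]
    rw [norm_mul, norm_div, norm_neg, norm_pow, div_eq_mul_inv]
    have hB1 : ‖∑ j, 2 * ((((z - p) j : ℝ) : ℂ) + σ * b j) * b j‖ ≤ B p := by
      refine (norm_sum_le _ _).trans (Finset.sum_le_sum fun j _ => ?_)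
      have hσ' : ‖σ‖ ≤ ‖τ‖ + r := by
        have : ‖σ - τ‖ < r := by rwa [Metric.mem_ball, dist_eq_norm] at hσ
        have h2 := norm_add_le (σ - τ) τ
        rw [sub_add_cancel] at h2
        linarith
      rw [norm_mul, norm_mul, Complex.norm_real, Complex.norm_two, Real.norm_eq_abs]
      gcongr
      refine (norm_add_le _ _).trans ?_
      rw [norm_mul, Complex.norm_real, Complex.norm_real, Real.norm_eq_abs, Real.norm_eq_abs]
      gcongr
    have := low p hp σ (hball hσ)
    gcongr
  · refine ((hB.mul continuous_const).mul cw.norm).integrable_of_hasCompactSupport ?_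
    exact hw.norm.mul_left
  · refine Eventually.of_forall fun p σ hσ => ?_
    by_cases hp : w p = 0
    · simpa [hp] using hasDerivAt_const σ (0 : ℂ)
    have hne : complexNormSq (z - p) b σ ≠ 0 := fun h => by
      have := low p hp σ (hball hσ)
      rw [h, norm_zero] at this
      have : 0 < d ^ 2 / 2 := by positivity
      linarith
    exact ((hasDerivAt_complexNormSq (z - p) b σ).fun_inv hne).mul_const (w p)

/-- Unique continuation for harmonic functions on a ball of `ℝ⁴`. -/
lemma eq_zero_of_harmonic {h : QSpace → ℂ} (ch : ContDiff ℝ ∞ h) {c : QSpace} {R : ℝ}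
    (hL : ∀ p ∈ Metric.ball c R, blockLaplacian LinearIsometry.id h p = 0)
    {z : QSpace} (hz : z ∈ Metric.ball c R) (hz0 : h =ᶠ[𝓝 z] fun _ => 0) :
    ∀ y ∈ Metric.ball c R, h y = 0 := by
  intro y hy
  rw [Metric.mem_ball] at hz hy
  obtain ⟨R₁, h1, h1'⟩ := exists_between (max_lt hz hy)
  obtain ⟨R₂, h2, h2'⟩ := exists_between h1'
  have hzR : dist z c < R₁ := (le_max_left _ _).trans_lt h1
  have hyR : dist y c < R₁ := (le_max_right _ _).trans_lt h1
  obtain ⟨η, cη, hη, hηs, hη1, -⟩ := exists_cutoff (isCompact_closedBall c R₂) Metric.isOpen_ball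
    (Metric.closedBall_subset_ball h2')
  let v : QSpace → ℂ := fun p => (η p : ℂ) * h p
  have cη' : ContDiff ℝ ∞ (fun p => (η p : ℂ)) := Complex.ofRealCLM.contDiff.comp cη
  have hη' : HasCompactSupport (fun p => (η p : ℂ)) :=
    hη.mono fun x hx hx' => hx (by simp [hx'])
  have cv : ContDiff ℝ ∞ v := cη'.mul ch
  have hv : HasCompactSupport v := hη'.mul_right
  set w := blockLaplacian LinearIsometry.id v
  have cw : ContDiff ℝ ∞ w := contDiff_blockLaplacian _ cv
  have hw : HasCompactSupport w := hasCompactSupport_blockLaplacian _ hv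
  have hvh : ∀ p ∈ Metric.closedBall c R₂, v =ᶠ[𝓝 p] h := by
    intro p hp
    filter_upwards [hη1 p hp] with q hq
    simp [v, hq]
  have hw0 : ∀ p, w p ≠ 0 → R₂ < dist p c := by
    intro p hp
    by_contra hle
    have hp' : p ∈ Metric.closedBall c R₂ := not_lt.1 hle
    refine hp ?_
    rw [← hL p (Metric.closedBall_subset_ball h2' hp')]
    refine Finset.sum_congr rfl fun j _ => ?_
    have : (fun y => fderiv ℝ v y (LinearIsometry.id (R := ℝ) (EuclideanSpace.single j 1)))
        =ᶠ[𝓝 p] fun y => fderiv ℝ h y (LinearIsometry.id (R := ℝ) (EuclideanSpace.single j 1)) := by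
      filter_upwards [(hvh p hp').fderiv (𝕜 := ℝ)] with q hq
      rw [hq]
    rw [this.fderiv_eq]
  -- the representation of `h` by the Newton potential of `w`, which is supported outside of the ball
  -- of radius `R₂`; it extends holomorphically along complexified lines through the smaller ball
  have hrep : ∀ x, dist x c < R₁ →
      ∫ p : QSpace, (((‖x - p‖ ^ 2 : ℝ) : ℂ))⁻¹ * w p = -(newtonConst * h x) := by
    intro x hx
    have e := blockPotential_blockLaplacian LinearIsometry.id cv hv x
    have hx' : x ∈ Metric.closedBall c R₂ := (hx.trans h2).le
    rw [(hvh x hx').eq_of_nhds] at e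
    rw [← e, blockPotential, ← integral_sub_left_eq_self _ volume x]
    congr 1; ext p
    simp
    left
    rfl
  set b := y - z
  have hd : 0 < (R₂ - R₁) / 2 := by linarith
  set d := (R₂ - R₁) / 2
  set δ := d / 2 / (‖b‖ + 1)
  have hb1 : 0 < ‖b‖ + 1 := by positivity
  have hδ0 : 0 < δ := by positivity
  have hδb : δ * ‖b‖ ≤ d / 2 := by
    simp only [δ]
    rw [div_mul_eq_mul_div, div_le_iff₀ hb1]
    nlinarith [norm_nonneg b]
  have hseg : ∀ t : ℝ, t ∈ Set.Icc (0 : ℝ) 1 → dist (z + t • b) c < R₁ := by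
    intro t ht
    have : z + t • b ∈ Metric.ball c R₁ := by
      refine (convex_ball c R₁).add_smul_mem (y := b) (Metric.mem_ball.2 hzR) ?_ ht
      simpa [b] using hyR
    exact this
  have hfar : ∀ p, w p ≠ 0 → ∀ t ∈ Set.Ioo (-δ) (1 + δ), d ≤ ‖z - p + t • b‖ := by
    intro p hp t ht
    have hp2 := hw0 p hp
    obtain ⟨s, hs, hst⟩ : ∃ s ∈ Set.Icc (0 : ℝ) 1, |t - s| ≤ δ := by
      refine ⟨max 0 (min t 1), ⟨le_max_left _ _, max_le zero_le_one (min_le_right _ _)⟩, ?_⟩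
      rw [abs_le]
      rcases le_total t 1 with h | h
      · rw [min_eq_left h]
        rcases le_total 0 t with h' | h'
        · rw [max_eq_right h']; constructor <;> linarith
        · rw [max_eq_left h']; constructor <;> linarith [ht.1]
      · rw [min_eq_right h, max_eq_right zero_le_one]; constructor <;> linarith [ht.2]
    have h3 := hseg s hs
    have h4 : ‖(t - s) • b‖ ≤ d / 2 := by
      rw [norm_smul, Real.norm_eq_abs]
      exact (mul_le_mul_of_nonneg_right hst (norm_nonneg b)).trans hδb
    have e : p - c = (z + s • b - c) + (t - s) • b - (z - p + t • b) := by
      rw [sub_smul]; abel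
    have h5 : dist p c ≤ dist (z + s • b) c + d / 2 + ‖z - p + t • b‖ := by
      rw [dist_eq_norm, dist_eq_norm, e]
      exact (norm_sub_le _ _).trans (by gcongr; exact (norm_add_le _ _).trans (by gcongr))
    have : R₂ - R₁ = 2 * d := by simp only [d]; ring
    linarith
  have han := analyticOnNhd_newton cw.continuous hw hd hδb hfar
  set H : ℂ → ℂ := fun τ => ∫ p : QSpace, (complexNormSq (z - p) b τ)⁻¹ * w p
  have hH : ∀ t : ℝ, t ∈ Set.Icc (0 : ℝ) 1 → H t = -(newtonConst * h (z + t • b)) := by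
    intro t ht
    rw [← hrep _ (hseg t ht)]
    simp only [H, complexNormSq_ofReal]
    congr 1; ext p
    rw [sub_add_eq_add_sub]
  have hpre : IsPreconnected {τ : ℂ | τ.re ∈ Set.Ioo (-δ) (1 + δ) ∧ τ.im ∈ Set.Ioo (-δ) δ} := by
    refine Convex.isPreconnected ?_
    exact ((convex_Ioo _ _).linear_preimage Complex.reLm).inter
      ((convex_Ioo _ _).linear_preimage Complex.imLm)
  have hfreq : ∃ᶠ τ in 𝓝[≠] (0 : ℂ), H τ = 0 := by
    have ht : Tendsto (fun t : ℝ => (t : ℂ)) (𝓝[>] 0) (𝓝[≠] 0) := by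
      refine tendsto_nhdsWithin_iff.2 ⟨?_, ?_⟩
      · have := (Complex.continuous_ofReal.tendsto 0)
        rw [Complex.ofReal_zero] at this
        exact this.mono_left nhdsWithin_le_nhds
      · filter_upwards [self_mem_nhdsWithin] with t ht
        have : (0 : ℝ) < t := ht
        simpa using this.ne'
    refine ht.frequently (Eventually.frequently ?_)
    have hc : Tendsto (fun t : ℝ => z + t • b) (𝓝[>] 0) (𝓝 z) := by
      have : Continuous fun t : ℝ => z + t • b := by fun_prop
      have := this.tendsto 0
      rw [zero_smul, add_zero] at this
      exact this.mono_left nhdsWithin_le_nhds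
    filter_upwards [hc.eventually hz0, Ioo_mem_nhdsGT (zero_lt_one' ℝ)] with t ht ht'
    rw [hH t ⟨ht'.1.le, ht'.2.le⟩, ht]
    simp
  have h0 : (0 : ℂ) ∈ {τ : ℂ | τ.re ∈ Set.Ioo (-δ) (1 + δ) ∧ τ.im ∈ Set.Ioo (-δ) δ} := by
    refine ⟨⟨?_, ?_⟩, ⟨?_, ?_⟩⟩ <;> simp <;> linarith
  have h1 : (1 : ℂ) ∈ {τ : ℂ | τ.re ∈ Set.Ioo (-δ) (1 + δ) ∧ τ.im ∈ Set.Ioo (-δ) δ} := by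
    refine ⟨⟨?_, ?_⟩, ⟨?_, ?_⟩⟩ <;> simp <;> linarith
  have := han.eqOn_zero_of_preconnected_of_frequently_eq_zero hpre h0 hfreq h1
  have e1 := hH 1 ⟨zero_le_one, le_rfl⟩
  rw [Complex.ofReal_one, this] at e1
  have hc : (newtonConst : ℂ) ≠ 0 := by exact_mod_cast newtonConst_pos.ne'
  have e2 : z + (1 : ℝ) • b = y := by simp [b]
  rw [e2] at e1
  simpa [hc] using e1

variable {n : ℕ}

/-- The inclusion of the `l`-th quaternionic line. -/
noncomputable def blockMap (l : Fin (n + 1)) : QSpace →ₗᵢ[ℝ] HSpace n where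
  toFun p := WithLp.toLp 2 fun i => if i.1 = l then p i.2 else 0
  map_add' p q := by
    ext i
    by_cases h : i.1 = l <;> simp [h]
  map_smul' c p := by
    ext i
    by_cases h : i.1 = l <;> simp [h]
  norm_map' p := by
    rw [← sq_eq_sq₀ (norm_nonneg _) (norm_nonneg _), EuclideanSpace.norm_sq_eq,
      EuclideanSpace.norm_sq_eq, Fintype.sum_prod_type]
    rw [Finset.sum_eq_single l]
    · simp
    · intro b _ hb; simp [hb]
    · simp

lemma blockMap_apply (l : Fin (n + 1)) (p : QSpace) (i : Fin (n + 1) × Fin 4) :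
    blockMap l p i = if i.1 = l then p i.2 else 0 := rfl

lemma blockMap_single (l : Fin (n + 1)) (j : Fin 4) :
    blockMap l (EuclideanSpace.single j 1) = EuclideanSpace.single (l, j) 1 := by
  ext ⟨l', j'⟩
  rw [blockMap_apply]
  by_cases h : l' = l <;> by_cases h' : j' = j <;> simp [h, h']

/-- The `l`-th quaternionic coordinate. -/
noncomputable def blockCoord (l : Fin (n + 1)) (x : HSpace n) : QSpace :=
  WithLp.toLp 2 fun j => x (l, j)

lemma blockCoord_sub (l : Fin (n + 1)) (x y : HSpace n) :
    blockCoord l (x - y) = blockCoord l x - blockCoord l y := by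
  ext j; simp [blockCoord]

lemma blockCoord_blockMap (l l' : Fin (n + 1)) (p : QSpace) :
    blockCoord l (blockMap l' p) = if l = l' then p else 0 := by
  ext j
  simp only [blockCoord, blockMap_apply]
  split_ifs <;> simp

lemma continuous_blockCoord (l : Fin (n + 1)) : Continuous (blockCoord (n := n) l) := by
  unfold blockCoord
  fun_prop

lemma norm_le_sum_blockCoord (x : HSpace n) : ‖x‖ ≤ ∑ l, ‖blockCoord l x‖ := by
  have : x = ∑ l, blockMap l (blockCoord l x) := by
    ext ⟨l, j⟩
    simp [blockCoord, blockMap_apply]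
  conv_lhs => rw [this]
  refine (norm_sum_le _ _).trans (Finset.sum_le_sum fun l _ => ?_)
  rw [LinearIsometry.norm_map]

/-- Unique continuation on a product of balls for functions that are harmonic in each quaternionic
variable. -/
lemma eq_zero_of_block_harmonic_polydisc {f : HSpace n → ℂ} (cf : ContDiff ℝ ∞ f) {x₀ : HSpace n}
    {r : ℝ} (hL : ∀ x, (∀ l, ‖blockCoord l (x - x₀)‖ < r) → ∀ l, blockLaplacian (blockMap l) f x = 0)
    {z : HSpace n} (hz : ∀ l, ‖blockCoord l (z - x₀)‖ < r) {s : ℝ} (hs : 0 < s)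
    (hzs : ∀ x, (∀ l, ‖blockCoord l (x - z)‖ < s) → f x = 0) :
    ∀ x, (∀ l, ‖blockCoord l (x - x₀)‖ < r) → f x = 0 := by
  -- the quaternionic variables in `L` are moved one after the other
  have main : ∀ (L : Finset (Fin (n + 1))) (x : HSpace n), (∀ l, ‖blockCoord l (x - x₀)‖ < r) →
      (∀ l ∉ L, ‖blockCoord l (x - z)‖ < s) → f x = 0 := by
    intro L
    induction L using Finset.induction_on with
    | empty => exact fun x _ h => hzs x fun l => h l (by simp)
    | insert a L ha ih =>
      intro x hx hxz
      have hmove : ∀ (y : HSpace n) (p : QSpace) (l : Fin (n + 1)),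
          blockCoord l (x - blockMap a p - y)
            = if l = a then blockCoord a (x - y) - p else blockCoord l (x - y) := by
        intro y p l
        rw [sub_right_comm, blockCoord_sub, blockCoord_blockMap]
        split_ifs with h
        · rw [h]
        · simp
      have hin : ∀ p ∈ Metric.ball (blockCoord a (x - x₀)) r, ∀ l,
          ‖blockCoord l (x - blockMap a p - x₀)‖ < r := by
        intro p hp l
        rw [hmove]
        split_ifs
        · rwa [Metric.mem_ball, dist_comm, dist_eq_norm] at hp
        · exact hx l
      have hzc : blockCoord a (x - z) ∈ Metric.ball (blockCoord a (x - x₀)) r := by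
        rw [Metric.mem_ball, dist_comm, dist_eq_norm, ← blockCoord_sub, sub_sub_sub_cancel_left]
        exact hz a
      have := eq_zero_of_harmonic (contDiff_comp_sub (blockMap a) cf x)
        (c := blockCoord a (x - x₀)) (R := r) (fun p hp => by
          rw [blockLaplacian_comp_sub (blockMap a) cf]
          exact hL _ (hin p hp) a) hzc (by
          filter_upwards [Metric.isOpen_ball.mem_nhds hzc,
            Metric.ball_mem_nhds (blockCoord a (x - z)) hs] with p hp hps
          refine ih _ (hin p hp) fun l hl => ?_
          rw [hmove]
          split_ifs with h
          · rwa [Metric.mem_ball, dist_comm, dist_eq_norm] at hps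
          · exact hxz l (by simp [h, hl])) 0 (by
          rw [Metric.mem_ball, dist_comm, dist_zero_right]; exact hx a)
      simpa using this
  exact fun x hx => main Finset.univ x hx fun l hl => absurd (Finset.mem_univ l) hl

/-- Unique continuation for functions that are harmonic in each quaternionic variable. -/
theorem eq_zero_of_block_harmonic {f : HSpace n → ℂ} (cf : ContDiff ℝ ∞ f) {U : Set (HSpace n)}
    (hU : IsOpen U) (hU' : IsPreconnected U)
    (hL : ∀ x ∈ U, ∀ l, blockLaplacian (blockMap l) f x = 0)
    {V : Set (HSpace n)} (hV : IsOpen V) (hVU : (U ∩ V).Nonempty) (hV0 : ∀ x ∈ V, f x = 0) :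
    ∀ x ∈ U, f x = 0 := by
  let A : Set (HSpace n) := {x | f =ᶠ[𝓝 x] fun _ => 0}
  have hA : IsOpen A := isOpen_setOfPred_eventually_nhds
  have hsub : U ⊆ A := by
    refine hU'.subset_of_closure_inter_subset hA ?_ ?_
    · obtain ⟨x, hxU, hxV⟩ := hVU
      refine ⟨x, hxU, ?_⟩
      filter_upwards [hV.mem_nhds hxV] with y hy using hV0 y hy
    · rintro x₀ ⟨hx₀, hxU⟩
      obtain ⟨ε, hε, hball⟩ := Metric.isOpen_iff.1 hU x₀ hxU
      have poly : ∀ (ε : ℝ) (x y : HSpace n), (∀ l, ‖blockCoord l (x - y)‖ < ε / (n + 1)) →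
          ‖x - y‖ < ε := by
        intro ε x y h
        refine (norm_le_sum_blockCoord _).trans_lt ?_
        refine (Finset.sum_lt_sum_of_nonempty Finset.univ_nonempty fun l _ => h l).trans_eq ?_
        have : (n + 1 : ℝ) ≠ 0 := by positivity
        simp
        field_simp
      set r := ε / (n + 1)
      have hr : 0 < r := by positivity
      have hopen : IsOpen {x : HSpace n | ∀ l, ‖blockCoord l (x - x₀)‖ < r} := by
        simp only [Set.ofPred_forall]
        exact isOpen_iInter_of_finite fun l => isOpen_lt
          ((continuous_blockCoord l).comp (continuous_id.sub continuous_const)).norm continuous_const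
      have hmem : x₀ ∈ {x : HSpace n | ∀ l, ‖blockCoord l (x - x₀)‖ < r} := by
        intro l
        have : blockCoord l (x₀ - x₀) = 0 := by ext j; simp [blockCoord]
        rw [this, norm_zero]; exact hr
      obtain ⟨z, hz, hzA⟩ := mem_closure_iff.1 hx₀ _ hopen hmem
      obtain ⟨s, hs, hzs⟩ := Metric.eventually_nhds_iff.1 hzA
      have := eq_zero_of_block_harmonic_polydisc cf (x₀ := x₀) (r := r)
        (fun x hx l => hL x (hball (by
          rw [Metric.mem_ball, dist_eq_norm]; exact poly ε x x₀ hx)) l) hz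
        (s := s / (n + 1)) (by positivity) (fun x hx => hzs (by
          rw [dist_eq_norm]; exact poly s x z hx))
      filter_upwards [hopen.mem_nhds hmem] with x hx using this x hx
  intro x hx
  exact (hsub hx).eq_of_nhds

end UniqueContinuation

/-! ### Domains with smooth boundary -/

section Domain

variable {E : Type*} [NormedAddCommGroup E] [NormedSpace ℝ E]

lemma exists_pos_apply {L : E →L[ℝ] ℝ} (h : L ≠ 0) : ∃ v, 0 < L v := by
  obtain ⟨v, hv⟩ := DFunLike.ne_iff.1 h
  rcases lt_or_gt_of_ne hv with h' | h'
  · exact ⟨-v, by simpa using h'⟩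
  · exact ⟨v, by simpa using h'⟩

/-- From a zero of `ρ` at which `ρ` has positive slope in the direction `v`, the set `{ρ > 0}` is
reached along the ray in the direction `v`. -/
lemma mem_closure_pos {ρ : E → ℝ} (cρ : ContDiff ℝ ∞ ρ) {x v : E} (h0 : ρ x = 0)
    (hv : 0 < fderiv ℝ ρ x v) : x ∈ closure {y | 0 < ρ y} := by
  have hd : HasDerivAt (fun t : ℝ => ρ (x + t • v)) (fderiv ℝ ρ x v) 0 := by
    have h1 : HasFDerivAt ρ (fderiv ℝ ρ x) (x + (0 : ℝ) • v) := by
      simpa using (differentiable_of_smooth cρ x).hasFDerivAt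
    have h2 : HasDerivAt (fun t : ℝ => x + t • v) v 0 := by
      simpa using ((hasDerivAt_id (0 : ℝ)).smul_const v).const_add x
    exact h1.comp_hasDerivAt (0 : ℝ) h2
  have hpos : ∀ᶠ t in 𝓝[>] (0 : ℝ), 0 < ρ (x + t • v) := by
    have := (hasDerivAt_iff_tendsto_slope.1 hd).eventually (lt_mem_nhds hv)
    have h3 : 𝓝[>] (0 : ℝ) ≤ 𝓝[≠] 0 := nhdsWithin_mono _ fun t ht => ne_of_gt ht
    filter_upwards [h3 this, self_mem_nhdsWithin] with t ht ht0
    have ht0' : (0 : ℝ) < t := ht0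
    simp only [slope_def_field, zero_smul, add_zero, h0, sub_zero] at ht
    exact (div_pos_iff_of_pos_right ht0').1 ht
  have hlim : Tendsto (fun t : ℝ => x + t • v) (𝓝[>] 0) (𝓝 x) := by
    have : Continuous fun t : ℝ => x + t • v := by fun_prop
    simpa using (this.tendsto 0).mono_left nhdsWithin_le_nhds
  exact mem_closure_of_tendsto hlim hpos

lemma nonneg_of_mem_closure_pos {E : Type*} [TopologicalSpace E] {ρ : E → ℝ} (cρ : Continuous ρ) {x : E}
    (h : x ∈ closure {y | 0 < ρ y}) : 0 ≤ ρ x :=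
  closure_minimal (fun _ hy => le_of_lt hy) (isClosed_le continuous_const cρ) h

/-- Near a point of the boundary of `{ρ > 0}` at which `dρ ≠ 0`, the zero set of `ρ` lies in the
boundary. -/
lemma eventually_mem_frontier {ρ : E → ℝ} (cρ : ContDiff ℝ ∞ ρ) {x : E}
    (h1 : fderiv ℝ ρ x ≠ 0) :
    ∀ᶠ y in 𝓝 x, ρ y = 0 → y ∈ frontier {y | 0 < ρ y} := by
  obtain ⟨v, hv⟩ := exists_pos_apply h1
  have hc : Continuous fun y => fderiv ℝ ρ y v :=
    (contDiff_fderiv_apply cρ (contDiff_const (c := v))).continuous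
  filter_upwards [hc.continuousAt.eventually (lt_mem_nhds hv)] with y hy h0
  rw [(isOpen_lt continuous_const cρ.continuous).frontier_eq]
  exact ⟨mem_closure_pos cρ h0 hy, by simp [h0]⟩

lemma eq_zero_of_mem_frontier {ρ : E → ℝ} (cρ : ContDiff ℝ ∞ ρ) {x : E}
    (h0 : x ∈ frontier {y | 0 < ρ y}) : ρ x = 0 := by
  rw [(isOpen_lt continuous_const cρ.continuous).frontier_eq] at h0
  exact le_antisymm (not_lt.1 h0.2) (nonneg_of_mem_closure_pos cρ.continuous h0.1)

/-- The Lagrange multiplier rule: a real function vanishing on the boundary of `{ρ > 0}` has a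
differential proportional to `dρ` there. -/
lemma fderiv_apply_eq_zero_of_frontier [CompleteSpace E] {ρ : E → ℝ} (cρ : ContDiff ℝ ∞ ρ)
    {x : E} (h0 : x ∈ frontier {y | 0 < ρ y}) (h1 : fderiv ℝ ρ x ≠ 0) {f : E → ℝ}
    (cf : ContDiff ℝ ∞ f) (hf : ∀ y ∈ frontier {y | 0 < ρ y}, f y = 0) {v : E}
    (hv : fderiv ℝ ρ x v = 0) : fderiv ℝ f x v = 0 := by
  have hx := eq_zero_of_mem_frontier cρ h0
  have hext : IsLocalExtrOn f {y | ρ y = ρ x} x := by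
    left
    filter_upwards [mem_nhdsWithin_of_mem_nhds (eventually_mem_frontier cρ h1),
      self_mem_nhdsWithin] with y hy hy'
    rw [hf x h0, hf y (hy (by rw [hx] at hy'; exact hy'))]
  obtain ⟨a, b, hab, h⟩ := hext.exists_multipliers_of_hasStrictFDerivAt_1d
    (cρ.contDiffAt.hasStrictFDerivAt (by simp)) (cf.contDiffAt.hasStrictFDerivAt (by simp))
  have hb : b ≠ 0 := by
    rintro rfl
    have ha : a ≠ 0 := by rintro rfl; exact hab rfl
    simp only [zero_smul, add_zero, smul_eq_zero] at h
    exact h.elim ha h1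
  have := DFunLike.congr_fun h v
  simp only [_root_.add_apply, _root_.smul_apply, hv, smul_eq_mul, mul_zero, zero_add,
    _root_.zero_apply] at this
  exact (mul_eq_zero.1 this).resolve_left hb

end Domain

/-- The square of the length of the differential of `ρ`. -/
noncomputable def gradSq {n : ℕ} (ρ : HSpace n → ℝ) (x : HSpace n) : ℝ :=
  ∑ i, fderiv ℝ ρ x (EuclideanSpace.single i 1) ^ 2

lemma gradSq_ne_zero {n : ℕ} {ρ : HSpace n → ℝ} {x : HSpace n} (h : fderiv ℝ ρ x ≠ 0) :
    gradSq ρ x ≠ 0 := by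
  contrapose! h
  have h' : ∀ i, fderiv ℝ ρ x (EuclideanSpace.single i 1) = 0 := fun i => by
    simpa using (Finset.sum_eq_zero_iff_of_nonneg fun i _ => sq_nonneg _).1 h i
      (Finset.mem_univ i)
  apply ContinuousLinearMap.coe_injective
  refine (EuclideanSpace.basisFun _ ℝ).toBasis.ext fun i => ?_
  simpa using h' i

/-- The data attached to a bounded domain with smooth boundary: a defining function `ρ` with a
normal field `N`, and a cutoff `θ` of `|dρ|⁻²`. -/
lemma IsSmoothBoundedDomain.exists_isDefining {n : ℕ} {D : Set (HSpace n)}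
    (hD : IsSmoothBoundedDomain D) : ∃ (ρ θ : HSpace n → ℝ) (N : HSpace n → HSpace n),
      IsDefining (frontier D) ρ N ∧ D = {x | 0 < ρ x} ∧ ContDiff ℝ ∞ θ ∧ HasCompactSupport θ ∧
      (∀ x ∈ frontier D, θ x * gradSq ρ x = 1) ∧ frontier D ⊆ closure (closure D)ᶜ := by
  obtain ⟨ρ, cρ, hρ, hd⟩ := hD.exists_defining
  have hK : IsCompact (frontier D) :=
    Metric.isCompact_of_isClosed_isBounded isClosed_frontier
      (hD.isBounded.closure.subset frontier_subset_closure)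
  have cd : ∀ i, ContDiff ℝ ∞ fun x => fderiv ℝ ρ x (EuclideanSpace.single i 1) := fun i =>
    contDiff_fderiv_apply cρ contDiff_const
  have cg : ContDiff ℝ ∞ (gradSq ρ) := ContDiff.sum fun i _ => (cd i).pow 2
  have hU : IsOpen {x | gradSq ρ x ≠ 0} := isOpen_ne_fun cg.continuous continuous_const
  obtain ⟨η, cη, hη, hηU, hη1, -⟩ := exists_cutoff hK hU fun x hx => gradSq_ne_zero (hd x hx)
  set θ : HSpace n → ℝ := fun x => η x / gradSq ρ x with hθ
  have cθ : ContDiff ℝ ∞ θ := by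
    rw [contDiff_iff_contDiffAt]
    intro x
    by_cases hx : x ∈ tsupport η
    · exact cη.contDiffAt.div cg.contDiffAt (hηU hx)
    · have : θ =ᶠ[𝓝 x] fun _ => 0 := by
        filter_upwards [notMem_tsupport_iff_eventuallyEq.1 hx] with y hy
        simp [hθ, hy]
      exact contDiffAt_const.congr_of_eventuallyEq this
  have hθ1 : ∀ x ∈ frontier D, θ x * gradSq ρ x = 1 := fun x hx => by
    simp only [hθ, (hη1 x hx).self_of_nhds]
    field_simp [gradSq_ne_zero (hd x hx)]
  refine ⟨ρ, θ, fun x => ∑ i, (θ x * fderiv ℝ ρ x (EuclideanSpace.single i 1)) •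
    EuclideanSpace.single i (1 : ℝ), ?_, hρ, cθ, ?_, hθ1, ?_⟩
  · refine ⟨cρ, ContDiff.sum fun i _ => (cθ.mul (cd i)).smul contDiff_const, ?_, ?_, ?_⟩
    · intro x hx
      exact eq_zero_of_mem_frontier cρ (hρ ▸ hx)
    · intro x hx
      refine Eq.trans ?_ (hθ1 x hx)
      rw [map_sum, gradSq, Finset.mul_sum]
      refine Finset.sum_congr rfl fun i _ => ?_
      rw [map_smul, smul_eq_mul]; ring
    · intro f cf hf x hx v hv
      have key : ∀ L : ℂ →L[ℝ] ℝ, L (fderiv ℝ f x v) = 0 := fun L => by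
        have h1 := fderiv_apply_eq_zero_of_frontier cρ (hρ ▸ hx) (hd x hx)
          (f := fun y => L (f y)) (L.contDiff.comp cf)
          (fun y hy => by rw [hf y (hρ ▸ hy), map_zero]) hv
        have h2 : HasFDerivAt (fun y => L (f y)) (L.comp (fderiv ℝ f x)) x :=
          L.hasFDerivAt.comp x (differentiable_of_smooth cf x).hasFDerivAt
        rw [h2.fderiv] at h1
        exact h1
      exact Complex.ext (key Complex.reCLM) (key Complex.imCLM)
  · refine hη.mono fun x hx => ?_
    simp only [Function.mem_support, hθ] at hx ⊢
    exact fun h => hx (by simp [h])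
  · intro x hx
    obtain ⟨v, hv⟩ := exists_pos_apply (hd x hx)
    have h0 : ρ x = 0 := eq_zero_of_mem_frontier cρ (hρ ▸ hx)
    have hneg : x ∈ closure {y | 0 < (fun y => -ρ y) y} :=
      mem_closure_pos cρ.neg (by simp [h0]) (v := -v) (by simpa [fderiv_fun_neg] using hv)
    refine closure_mono (fun y hy hy' => ?_) hneg
    rw [hρ] at hy'
    have := nonneg_of_mem_closure_pos cρ.continuous hy'
    simp only [Set.mem_ofPred_eq] at hy
    linarith

/-! ### The vector fields of the complex and their symbols -/

section Fields

variable {n : ℕ}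

/-- The index `A = 2l + r` of the row `r` in the block `l`. -/
def blockIdx (l : Fin (n + 1)) (r : Fin 2) : Idx n := finProdFinEquiv (l, r)

lemma divNat_blockIdx (l : Fin (n + 1)) (r : Fin 2) : (blockIdx l r).divNat = l :=
  congrArg Prod.fst (finProdFinEquiv.symm_apply_apply (l, r))

lemma modNat_blockIdx (l : Fin (n + 1)) (r : Fin 2) : (blockIdx l r).modNat = r :=
  congrArg Prod.snd (finProdFinEquiv.symm_apply_apply (l, r))

/-- The real and the imaginary part of the constant complex vector field `∇_A^{A'}`. -/
noncomputable def field (A : Idx n) (a : Fin 2) : HSpace n × HSpace n :=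
  (∑ j, (raisedCoeff A.modNat a j).re • EuclideanSpace.single (A.divNat, j) 1,
   ∑ j, (raisedCoeff A.modNat a j).im • EuclideanSpace.single (A.divNat, j) 1)

lemma nabla_eq_cderiv (A : Idx n) (a : Fin 2) (f : HSpace n → ℂ) :
    nabla A a f = cderiv (field A a) f := by
  funext x
  simp only [nabla, cderiv, field, partialDeriv, map_sum, map_smul, Finset.mul_sum,
    ← Finset.sum_add_distrib, Complex.real_smul]
  refine Finset.sum_congr rfl fun j _ => ?_
  conv_lhs => rw [← Complex.re_add_im (raisedCoeff A.modNat a j)]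
  ring

/-- The second order operator `Δ_{AB} = ∇_A^{0'} ∇_B^{1'} - ∇_B^{0'} ∇_A^{1'}`. -/
noncomputable def boxOp (A B : Idx n) (f : HSpace n → ℂ) (x : HSpace n) : ℂ :=
  cderiv (field A 0) (cderiv (field B 1) f) x - cderiv (field B 0) (cderiv (field A 1) f) x

variable {f : HSpace n → ℂ}

lemma contDiff_partialDeriv (cf : ContDiff ℝ ∞ f) (l : Fin (n + 1)) (j : Fin 4) :
    ContDiff ℝ ∞ (partialDeriv l j f) := contDiff_fderiv_apply cf contDiff_const

lemma partialDeriv_comm (cf : ContDiff ℝ ∞ f) (l l' : Fin (n + 1)) (i j : Fin 4)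
    (x : HSpace n) :
    partialDeriv l i (partialDeriv l' j f) x = partialDeriv l' j (partialDeriv l i f) x := by
  have h := fderiv_fderiv_apply cf (contDiff_const (c := EuclideanSpace.single (l', j) (1 : ℝ)))
    x (EuclideanSpace.single (l, i) 1)
  simp only [fderiv_fun_const, Pi.zero_apply, _root_.zero_apply, map_zero, add_zero] at h
  exact h

lemma cderiv_field_blockIdx (l : Fin (n + 1)) (r a : Fin 2) (f : HSpace n → ℂ) :
    cderiv (field (blockIdx l r) a) f =
      fun x => ∑ j, raisedCoeff r a j * partialDeriv l j f x := by
  rw [← nabla_eq_cderiv]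
  funext x
  simp only [nabla, divNat_blockIdx, modNat_blockIdx]

lemma partialDeriv_sum_mul {F : Fin 4 → HSpace n → ℂ} (cF : ∀ j, ContDiff ℝ ∞ (F j))
    (c : Fin 4 → ℂ) (l : Fin (n + 1)) (i : Fin 4) (x : HSpace n) :
    partialDeriv l i (fun y => ∑ j, c j * F j y) x = ∑ j, c j * partialDeriv l i (F j) x := by
  have hd : ∀ j, DifferentiableAt ℝ (F j) x := fun j => differentiable_of_smooth (cF j) x
  have := HasFDerivAt.fun_sum (u := Finset.univ) fun j _ => ((hd j).hasFDerivAt.const_mul (c j))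
  rw [partialDeriv, this.fderiv]
  simp [partialDeriv]

/-- `Δ_{2l,2l+1}` is the Laplacian in the quaternionic variable `q_{l+1}`. -/
lemma boxOp_blockIdx (cf : ContDiff ℝ ∞ f) (l : Fin (n + 1)) (x : HSpace n) :
    boxOp (blockIdx l 0) (blockIdx l 1) f x = blockLaplacian (blockMap l) f x := by
  have c := contDiff_partialDeriv cf l
  have e : blockLaplacian (blockMap l) f x = ∑ j, partialDeriv l j (partialDeriv l j f) x := by
    simp only [blockLaplacian, blockMap_single]
    rfl
  rw [boxOp, cderiv_field_blockIdx, cderiv_field_blockIdx, cderiv_field_blockIdx,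
    cderiv_field_blockIdx, e]
  simp only [partialDeriv_sum_mul c]
  simp only [raisedCoeff, lowerCoeff, Fin.sum_univ_four, Matrix.cons_val, Pi.neg_apply]
  rw [partialDeriv_comm cf l l 1 0, partialDeriv_comm cf l l 3 2]
  linear_combination (partialDeriv l 3 (partialDeriv l 3 f) x +
    partialDeriv l 1 (partialDeriv l 1 f) x) * (-Complex.I_sq)

/-- The symbol of `∇_A^{A'}` in the direction `dρ`. -/
noncomputable def symb (ρ : HSpace n → ℝ) (A : Idx n) (a : Fin 2) (x : HSpace n) : ℂ :=
  cderiv (field A a) (fun y => (ρ y : ℂ)) x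

/-- The symbols of the operators `Δ_{2l,2l+1}` add up to `|dρ|²`. -/
lemma sum_symb_eq_gradSq {ρ : HSpace n → ℝ} (cρ : ContDiff ℝ ∞ ρ) (x : HSpace n) :
    ∑ l, (symb ρ (blockIdx l 0) 0 x * symb ρ (blockIdx l 1) 1 x
      - symb ρ (blockIdx l 1) 0 x * symb ρ (blockIdx l 0) 1 x) = (gradSq ρ x : ℂ) := by
  rw [gradSq, Fintype.sum_prod_type]
  push_cast
  refine Finset.sum_congr rfl fun l _ => ?_
  have h : ∀ j, partialDeriv l j (fun y => (ρ y : ℂ)) x =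
      (fderiv ℝ ρ x (EuclideanSpace.single (l, j) 1) : ℂ) := fun j => fderiv_ofReal cρ _ _
  simp only [symb, cderiv_field_blockIdx, h]
  simp only [raisedCoeff, lowerCoeff, Fin.sum_univ_four, Matrix.cons_val, Pi.neg_apply]
  linear_combination ((fderiv ℝ ρ x (EuclideanSpace.single (l, 3) 1) : ℂ) ^ 2 +
    (fderiv ℝ ρ x (EuclideanSpace.single (l, 1) 1) : ℂ) ^ 2) * (-Complex.I_sq)

lemma contDiff_boxOp (cf : ContDiff ℝ ∞ f) (A B : Idx n) : ContDiff ℝ ∞ (boxOp A B f) :=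
  (contDiff_cderiv (contDiff_cderiv cf)).sub (contDiff_cderiv (contDiff_cderiv cf))

lemma contDiff_symb {ρ : HSpace n → ℝ} (cρ : ContDiff ℝ ∞ ρ) (A : Idx n) (a : Fin 2) :
    ContDiff ℝ ∞ (symb ρ A a) := contDiff_cderiv (Complex.ofRealCLM.contDiff.comp cρ)

end Fields

/-! ### Leading coefficients -/

section Leading

variable {E : Type*} [NormedAddCommGroup E] [NormedSpace ℝ E] {S : Set E} {ρ : E → ℝ} {N : E → E}

/-- Differentiation lowers the order of vanishing by one, and multiplies the leading coefficient
by the symbol. -/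
lemma IsDefining.cderiv_leading (h : IsDefining S ρ N) (P : E × E) {m : ℕ} {u c : E → ℂ}
    (cu : ContDiff ℝ ∞ u) (cc : ContDiff ℝ ∞ c)
    (hl : VanishesOn S (m + 2) (fun x => u x - (ρ x : ℂ) ^ (m + 1) * c x)) :
    VanishesOn S (m + 1) (fun x => cderiv P u x - (ρ x : ℂ) ^ m *
      ((m + 1) * (cderiv P (fun y => (ρ y : ℂ)) x * c x))) := by
  have cρ := h.contDiff_ofReal
  have cp : ContDiff ℝ ∞ fun x => (ρ x : ℂ) ^ (m + 1) := cρ.pow _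
  have cpc : ContDiff ℝ ∞ fun x => (ρ x : ℂ) ^ (m + 1) * c x := cp.mul cc
  have h1 : VanishesOn S (m + 1) _ := (VanishesOn.cderiv (P := P) hl (cu.sub cpc))
  have h2 : VanishesOn S (m + 1) (fun x => (ρ x : ℂ) ^ (m + 1) * cderiv P c x) :=
    (h.vanishesOn_pow (m + 1)).mul_right cp (contDiff_cderiv cc)
  have h3 := h1.add h2 (contDiff_cderiv (cu.sub cpc)) (cp.mul (contDiff_cderiv cc))
  convert h3 using 2 with x
  rw [cderiv_sub cu cpc, cderiv_mul cp cc, cderiv_pow cρ, Nat.add_sub_cancel]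
  push_cast
  ring

lemma IsDefining.cderiv_cderiv_leading (h : IsDefining S ρ N) (P Q : E × E) {m : ℕ}
    {u c : E → ℂ} (cu : ContDiff ℝ ∞ u) (cc : ContDiff ℝ ∞ c)
    (hl : VanishesOn S (m + 3) (fun x => u x - (ρ x : ℂ) ^ (m + 2) * c x)) :
    VanishesOn S (m + 1) (fun x => cderiv P (cderiv Q u) x - (ρ x : ℂ) ^ m *
      ((m + 2) * (m + 1) * (cderiv P (fun y => (ρ y : ℂ)) x *
        (cderiv Q (fun y => (ρ y : ℂ)) x * c x)))) := by
  have c1 : ContDiff ℝ ∞ fun x => cderiv Q (fun y => (ρ y : ℂ)) x * c x :=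
    (contDiff_cderiv h.contDiff_ofReal).mul cc
  have h1 := h.cderiv_leading Q (m := m + 1) cu cc hl
  have h2 := h.cderiv_leading P (m := m) (contDiff_cderiv cu)
    (c := fun x => (((m + 1 : ℕ) : ℂ) + 1) * (cderiv Q (fun y => (ρ y : ℂ)) x * c x))
    (contDiff_const.mul c1) h1
  convert h2 using 2 with x
  push_cast
  ring

end Leading

/-! ### Symbol relations on the boundary -/

section Symbol

variable {E : Type} [NormedAddCommGroup E] [InnerProductSpace ℝ E] [FiniteDimensional ℝ E]
  [MeasurableSpace E] [BorelSpace E] {μ : Measure E} [μ.IsAddHaarMeasure]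
  {D : Set E} {ρ : E → ℝ} {N : E → E} {ι : Type} [Fintype ι]

/-- A first order equation `∑ P_i u_i = 0` that holds without boundary term on `D` passes to the
leading coefficients of the `u_i` along the boundary. The integral condition is needed only when
the `u_i` do not vanish on the boundary. -/
lemma symbol_relation (hρ : IsDefining (frontier D) ρ N) (hD : D = {x | 0 < ρ x})
    (hext : frontier D ⊆ closure (closure D)ᶜ) {m : ℕ} (P : ι → E × E) {u c : ι → E → ℂ}
    (cu : ∀ i, ContDiff ℝ ∞ (u i)) (cc : ∀ i, ContDiff ℝ ∞ (c i))
    (hl : ∀ i, VanishesOn (frontier D) (m + 1) (fun x => u i x - (ρ x : ℂ) ^ m * c i x))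
    (hrel : ∀ x, ∑ i, cderiv (P i) (u i) x = 0)
    (hweak : m = 0 → ∀ φ : E → ℂ, ContDiff ℝ ∞ φ → HasCompactSupport φ →
      ∫ x in D, ∑ i, u i x * cderiv (P i) φ x ∂μ = 0) :
    ∀ x ∈ frontier D, ∑ i, c i x * cderiv (P i) (fun y => (ρ y : ℂ)) x = 0 := by
  rcases m with _ | m
  · intro x hx
    have h := normal_component_eq_zero μ hρ.smooth hD hext P cu (fun φ cφ hφ => by
      rw [← hweak rfl φ cφ hφ]
      congr 1 with x
      simp only [cderiv_mul (cu _) cφ, Finset.sum_add_distrib, ← Finset.mul_sum, hrel]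
      ring) x hx
    rw [← h]
    refine Finset.sum_congr rfl fun i _ => ?_
    have := (hl i).eq_zero (by simp) hx
    simp only [pow_zero, one_mul] at this
    rw [sub_eq_zero.1 this]
  · have cP : ∀ i, ContDiff ℝ ∞ (cderiv (P i) fun y => (ρ y : ℂ)) := fun i =>
      contDiff_cderiv hρ.contDiff_ofReal
    have cs : ContDiff ℝ ∞ fun x => ∑ i, cderiv (P i) (fun y => (ρ y : ℂ)) x * c i x :=
      ContDiff.sum fun i _ => (cP i).mul (cc i)
    have cl : ∀ i, ContDiff ℝ ∞ (fun x => cderiv (P i) (u i) x - (ρ x : ℂ) ^ m *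
      ((m + 1) * (cderiv (P i) (fun y => (ρ y : ℂ)) x * c i x))) := fun i =>
      (contDiff_cderiv (cu i)).sub ((hρ.contDiff_ofReal.pow m).mul
        (contDiff_const.mul ((cP i).mul (cc i))))
    have h1 := (VanishesOn.sum (s := Finset.univ)
      (fun i _ => hρ.cderiv_leading (P i) (cu i) (cc i) (hl i)) (fun i _ => cl i)).neg
        (ContDiff.sum fun i _ => cl i)
    intro x hx
    have h2 := hρ.eq_zero_of_pow_mul (m := m)
      (b := fun x => (m + 1) * ∑ i, cderiv (P i) (fun y => (ρ y : ℂ)) x * c i x)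
      (contDiff_const.mul cs) (by
        convert h1 using 2 with x
        rw [Finset.sum_sub_distrib, hrel, Finset.mul_sum, Finset.mul_sum]
        simp) x hx
    have h3 : ((m : ℂ) + 1) ≠ 0 := Nat.cast_add_one_ne_zero m
    rw [← (mul_eq_zero.1 h2).resolve_left h3]
    exact Finset.sum_congr rfl fun i _ => mul_comm _ _

/-- The analogue of `symbol_relation` for a second order equation `∑ P_i Q_i u_i = 0`. The
integral condition is needed only when the `u_i` vanish to order less than two on the boundary. -/
lemma symbol_relation_second_order (hρ : IsDefining (frontier D) ρ N) (hD : D = {x | 0 < ρ x})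
    (hext : frontier D ⊆ closure (closure D)ᶜ) {m : ℕ} (P Q : ι → E × E) {u c : ι → E → ℂ}
    (cu : ∀ i, ContDiff ℝ ∞ (u i)) (cc : ∀ i, ContDiff ℝ ∞ (c i))
    (hl : ∀ i, VanishesOn (frontier D) (m + 1) (fun x => u i x - (ρ x : ℂ) ^ m * c i x))
    (hrel : ∀ x, ∑ i, cderiv (P i) (cderiv (Q i) (u i)) x = 0)
    (hweak : m ≤ 1 → ∀ φ : E → ℂ, ContDiff ℝ ∞ φ → HasCompactSupport φ →
      ∫ x in D, ∑ i, u i x * cderiv (P i) (cderiv (Q i) φ) x ∂μ = 0) :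
    ∀ x ∈ frontier D, ∑ i, c i x * (cderiv (P i) (fun y => (ρ y : ℂ)) x *
      cderiv (Q i) (fun y => (ρ y : ℂ)) x) = 0 := by
  have cR := hρ.contDiff_ofReal
  have cP : ∀ i, ContDiff ℝ ∞ (cderiv (P i) fun y => (ρ y : ℂ)) := fun i => contDiff_cderiv cR
  have cQ : ∀ i, ContDiff ℝ ∞ (cderiv (Q i) fun y => (ρ y : ℂ)) := fun i => contDiff_cderiv cR
  have cPu : ∀ i, ContDiff ℝ ∞ (cderiv (P i) (u i)) := fun i => contDiff_cderiv (cu i)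
  -- integration by parts without boundary contribution of the products vanishing on the boundary
  have parts : ∀ Ψ : E → ℂ, ContDiff ℝ ∞ Ψ → ∀ x,
      ∑ i, u i x * cderiv (P i) (cderiv (Q i) Ψ) x =
      ∑ i, cderiv (P i) (fun y => u i y * cderiv (Q i) Ψ y) x -
      ∑ i, cderiv (Q i) (fun y => cderiv (P i) (u i) y * Ψ y) x := by
    intro Ψ cΨ x
    have h0 : ∑ i, cderiv (Q i) (cderiv (P i) (u i)) x = 0 := by
      rw [← hrel x]
      exact Finset.sum_congr rfl fun i _ => cderiv_comm (cu i) x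
    simp only [cderiv_mul (cPu _) cΨ, cderiv_mul (cu _) (contDiff_cderiv cΨ),
      Finset.sum_add_distrib, ← Finset.mul_sum, h0]
    simp only [mul_comm (cderiv (Q _) Ψ x)]
    ring
  have int : ∀ (P : E × E) {w : E → ℂ}, ContDiff ℝ ∞ w → HasCompactSupport w →
      Integrable (cderiv P w) (μ.restrict D) := fun P w cw hw =>
    (integrable_of_smooth μ (contDiff_cderiv cw) (hasCompactSupport_cderiv hw)).restrict
  have ints : ∀ (P : ι → E × E) {w : ι → E → ℂ}, (∀ i, ContDiff ℝ ∞ (w i)) →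
      (∀ i, HasCompactSupport (w i)) →
      Integrable (fun x => ∑ i, cderiv (P i) (w i) x) (μ.restrict D) := fun P w cw hw =>
    integrable_finsetSum _ fun i _ => int (P i) (cw i) (hw i)
  have zero : ∀ (P : ι → E × E) {w : ι → E → ℂ}, (∀ i, ContDiff ℝ ∞ (w i)) →
      (∀ i, HasCompactSupport (w i)) → (∀ i, ∀ x ∈ frontier D, w i x = 0) →
      ∫ x in D, ∑ i, cderiv (P i) (w i) x ∂μ = 0 := fun P w cw hw h0 => by
    rw [integral_finsetSum _ (fun i _ => int (P i) (cw i) (hw i))]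
    exact Finset.sum_eq_zero fun i _ =>
      setIntegral_cderiv_eq_zero μ hρ hD (cw i) (hw i) (h0 i) (P i)
  rcases m with _ | _ | m
  · intro x hx
    have h := normal_component_eq_zero μ hρ.smooth hD hext P
      (a := fun i x => u i x * cderiv (Q i) (fun y => (ρ y : ℂ)) x)
      (fun i => (cu i).mul (cQ i)) (fun φ cφ hφ => by
        have cρφ : ContDiff ℝ ∞ fun x => (ρ x : ℂ) * φ x := cR.mul cφ
        have h1 := hweak (by simp) (fun x => (ρ x : ℂ) * φ x) cρφ hφ.mul_left
        simp only [parts _ cρφ] at h1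
        have c1 : ∀ i, ContDiff ℝ ∞ fun y => cderiv (P i) (u i) y * ((ρ y : ℂ) * φ y) :=
          fun i => (cPu i).mul cρφ
        have s1 : ∀ i, HasCompactSupport fun y => cderiv (P i) (u i) y * ((ρ y : ℂ) * φ y) :=
          fun i => (hφ.mul_left).mul_left
        have c2 : ∀ i, ContDiff ℝ ∞ fun y => u i y * (ρ y * cderiv (Q i) φ y) :=
          fun i => (cu i).mul (cR.mul (contDiff_cderiv cφ))
        have s2 : ∀ i, HasCompactSupport fun y => u i y * (ρ y * cderiv (Q i) φ y) :=
          fun i => ((hasCompactSupport_cderiv hφ).mul_left).mul_left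
        have c3 : ∀ i, ContDiff ℝ ∞
            fun y => u i y * cderiv (Q i) (fun y => (ρ y : ℂ)) y * φ y :=
          fun i => ((cu i).mul (cQ i)).mul cφ
        have s3 : ∀ i, HasCompactSupport
            fun y => u i y * cderiv (Q i) (fun y => (ρ y : ℂ)) y * φ y := fun i => hφ.mul_left
        have e : ∀ x, ∑ i, cderiv (P i) (fun y => u i y * cderiv (Q i)
            (fun y => (ρ y : ℂ) * φ y) y) x =
            ∑ i, cderiv (P i) (fun y => u i y * (ρ y * cderiv (Q i) φ y)) x +
            ∑ i, cderiv (P i) (fun y => u i y * cderiv (Q i) (fun y => (ρ y : ℂ)) y * φ y) x := by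
          intro x
          rw [← Finset.sum_add_distrib]
          refine Finset.sum_congr rfl fun i _ => ?_
          rw [← cderiv_add (c2 i) (c3 i)]
          congr 1
          funext y
          rw [cderiv_mul cR cφ]
          ring
        have c4 : ∀ i, ContDiff ℝ ∞ fun y => u i y * cderiv (Q i) (fun y => (ρ y : ℂ) * φ y) y :=
          fun i => (cu i).mul (contDiff_cderiv cρφ)
        have s4 : ∀ i, HasCompactSupport
            fun y => u i y * cderiv (Q i) (fun y => (ρ y : ℂ) * φ y) y :=
          fun i => (hasCompactSupport_cderiv hφ.mul_left).mul_left
        rw [integral_sub (ints P c4 s4) (ints Q c1 s1)] at h1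
        simp only [e] at h1
        rw [integral_add (ints P c2 s2) (ints P c3 s3), zero P c2 s2 fun i x hx => by simp [hρ.eq_zero x hx],
          zero Q c1 s1 fun i x hx => by simp [hρ.eq_zero x hx]] at h1
        simpa using h1) x hx
    rw [← h]
    refine Finset.sum_congr rfl fun i _ => ?_
    have := (hl i).eq_zero (by simp) hx
    simp only [pow_zero, one_mul] at this
    rw [sub_eq_zero.1 this]
    ring
  · have hu : ∀ i, ∀ x ∈ frontier D, u i x = 0 := fun i x hx => by
      have := (hl i).eq_zero (by simp) hx
      simpa [hρ.eq_zero x hx] using this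
    intro x hx
    have h := normal_component_eq_zero μ hρ.smooth hD hext Q (a := fun i => cderiv (P i) (u i))
      cPu (fun φ cφ hφ => by
        have h1 := hweak (by simp) φ cφ hφ
        simp only [parts _ cφ] at h1
        have c1 : ∀ i, ContDiff ℝ ∞ fun y => cderiv (P i) (u i) y * φ y :=
          fun i => (cPu i).mul cφ
        have s1 : ∀ i, HasCompactSupport fun y => cderiv (P i) (u i) y * φ y :=
          fun i => hφ.mul_left
        have c2 : ∀ i, ContDiff ℝ ∞ fun y => u i y * cderiv (Q i) φ y :=
          fun i => (cu i).mul (contDiff_cderiv cφ)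
        have s2 : ∀ i, HasCompactSupport fun y => u i y * cderiv (Q i) φ y :=
          fun i => (hasCompactSupport_cderiv hφ).mul_left
        rw [integral_sub (ints P c2 s2) (ints Q c1 s1),
          zero P c2 s2 fun i x hx => by simp [hu i x hx]] at h1
        simpa using h1) x hx
    rw [← h]
    refine Finset.sum_congr rfl fun i _ => ?_
    have := (hρ.cderiv_leading (P i) (m := 0) (cu i) (cc i) (hl i)).eq_zero (by simp) hx
    simp only [pow_zero, one_mul, Nat.cast_zero, zero_add] at this
    rw [sub_eq_zero.1 this]
    ring
  · have cPQ : ∀ i, ContDiff ℝ ∞ fun x => cderiv (P i) (fun y => (ρ y : ℂ)) x *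
        (cderiv (Q i) (fun y => (ρ y : ℂ)) x * c i x) := fun i =>
      (cP i).mul ((cQ i).mul (cc i))
    have cs : ContDiff ℝ ∞ fun x => ∑ i, cderiv (P i) (fun y => (ρ y : ℂ)) x *
        (cderiv (Q i) (fun y => (ρ y : ℂ)) x * c i x) := ContDiff.sum fun i _ => cPQ i
    have cl : ∀ i, ContDiff ℝ ∞ (fun x => cderiv (P i) (cderiv (Q i) (u i)) x - (ρ x : ℂ) ^ m *
      ((m + 2) * (m + 1) * (cderiv (P i) (fun y => (ρ y : ℂ)) x *
        (cderiv (Q i) (fun y => (ρ y : ℂ)) x * c i x)))) := fun i =>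
      (contDiff_cderiv (contDiff_cderiv (cu i))).sub ((cR.pow m).mul
        (contDiff_const.mul (cPQ i)))
    have h1 := (VanishesOn.sum (s := Finset.univ)
      (fun i _ => hρ.cderiv_cderiv_leading (P i) (Q i) (cu i) (cc i) (hl i))
        (fun i _ => cl i)).neg (ContDiff.sum fun i _ => cl i)
    intro x hx
    have h2 := hρ.eq_zero_of_pow_mul (m := m)
      (b := fun x => (m + 2) * (m + 1) * ∑ i, cderiv (P i) (fun y => (ρ y : ℂ)) x *
        (cderiv (Q i) (fun y => (ρ y : ℂ)) x * c i x))
      (contDiff_const.mul cs) (by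
        convert h1 using 2 with x
        rw [Finset.sum_sub_distrib, hrel, Finset.mul_sum, Finset.mul_sum]
        simp) x hx
    have h3 : ((m : ℂ) + 2) * ((m : ℂ) + 1) ≠ 0 := by norm_cast
    rw [← (mul_eq_zero.1 h2).resolve_left h3]
    exact Finset.sum_congr rfl fun i _ => by ring

end Symbol

/-! ### Inversion of the symbol -/

section SymbolInverse

variable {n κ : ℕ}

/-- The symbol of `Δ_{AB}`, as a function of the symbols `ν A a` of the fields `∇_A^{a}`. -/
def symbBox (ν : Idx n → Fin 2 → ℂ) (A B : Idx n) : ℂ := ν A 0 * ν B 1 - ν B 0 * ν A 1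

/-- A solution `h` of `ν_A^{0'} h_b + ν_A^{1'} h_{b+1} = (∑_l δ_{2l,2l+1}) c_{b,A}`, where `δ` is
the symbol of `Δ`. All entries but the last one are determined by `ν^{1'}`, the last one by
`ν^{0'}`. -/
def symbolInverse (ν : Idx n → Fin 2 → ℂ) (c : Fin (κ + 1) → Idx n → ℂ) : Fin (κ + 2) → ℂ :=
  Fin.snoc (α := fun _ => ℂ)
    (fun b => ∑ l, (ν (blockIdx l 1) 1 * c b (blockIdx l 0)
      - ν (blockIdx l 0) 1 * c b (blockIdx l 1)))
    (∑ l, (ν (blockIdx l 0) 0 * c (Fin.last κ) (blockIdx l 1)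
      - ν (blockIdx l 1) 0 * c (Fin.last κ) (blockIdx l 0)))

lemma symbolInverse_spec {ν : Idx n → Fin 2 → ℂ} {c : Fin (κ + 1) → Idx n → ℂ}
    (h1 : ∀ b A B C, c b C * symbBox ν A B + c b A * symbBox ν B C + c b B * symbBox ν C A = 0)
    (h2 : ∀ (b : Fin κ) A B, c b.castSucc B * ν A 0 - c b.castSucc A * ν B 0
      + c b.succ B * ν A 1 - c b.succ A * ν B 1 = 0) (b : Fin (κ + 1)) (A : Idx n) :
    ν A 0 * symbolInverse ν c b.castSucc + ν A 1 * symbolInverse ν c b.succ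
      = (∑ l, symbBox ν (blockIdx l 0) (blockIdx l 1)) * c b A := by
  have hs : symbolInverse ν c b.succ = ∑ l, (ν (blockIdx l 0) 0 * c b (blockIdx l 1)
      - ν (blockIdx l 1) 0 * c b (blockIdx l 0)) := by
    induction b using Fin.lastCases with
    | last => rw [Fin.succ_last, symbolInverse, Fin.snoc_last]
    | cast b =>
      rw [Fin.succ_castSucc, symbolInverse, Fin.snoc_castSucc]
      refine Finset.sum_congr rfl fun l _ => ?_
      linear_combination -h2 b (blockIdx l 0) (blockIdx l 1)
  rw [hs, symbolInverse, Fin.snoc_castSucc, Finset.mul_sum, Finset.mul_sum, Finset.sum_mul,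
    ← Finset.sum_add_distrib]
  refine Finset.sum_congr rfl fun l _ => ?_
  have := h1 b (blockIdx l 0) (blockIdx l 1) A
  simp only [symbBox] at this ⊢
  linear_combination -this

/-- Wedging the first order relation with `ν^{0'}` or `ν^{1'}` gives the second order one. -/
lemma symbBox_relation {ν : Idx n → Fin 2 → ℂ} {c : Fin (κ + 2) → Idx n → ℂ}
    (h2 : ∀ (b : Fin (κ + 1)) A B, c b.castSucc B * ν A 0 - c b.castSucc A * ν B 0
      + c b.succ B * ν A 1 - c b.succ A * ν B 1 = 0) (b : Fin (κ + 2)) (A B C : Idx n) :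
    c b C * symbBox ν A B + c b A * symbBox ν B C + c b B * symbBox ν C A = 0 := by
  simp only [symbBox]
  induction b using Fin.cases with
  | zero =>
    have e := h2 0
    rw [Fin.castSucc_zero] at e
    linear_combination ν C 1 * e B A + ν A 1 * e C B + ν B 1 * e A C
  | succ b =>
    linear_combination ν C 0 * h2 b A B + ν A 0 * h2 b B C + ν B 0 * h2 b C A

end SymbolInverse

/-! ### The operators in scalar form -/

section Correction

variable {n κ : ℕ}

/-- The components of `∂_{A'} d^{A'} g` for a `⊙^{κ+1} ℂ²`-valued function `g`. -/
noncomputable def cauchyFueter (g : HSpace n → Fin (κ + 2) → ℂ) (b : Fin (κ + 1)) (A : Idx n)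
    (x : HSpace n) : ℂ :=
  cderiv (field A 0) (fun y => g y b.castSucc) x + cderiv (field A 1) (fun y => g y b.succ) x

lemma contDiff_cauchyFueter {g : HSpace n → Fin (κ + 2) → ℂ} (cg : ContDiff ℝ ∞ g)
    (b : Fin (κ + 1)) (A : Idx n) : ContDiff ℝ ∞ (cauchyFueter g b A) :=
  (contDiff_cderiv (contDiff_pi.1 cg _)).add (contDiff_cderiv (contDiff_pi.1 cg _))

lemma cauchyFueter_sub {f g : HSpace n → Fin (κ + 2) → ℂ} (cf : ContDiff ℝ ∞ f)
    (cg : ContDiff ℝ ∞ g) (b : Fin (κ + 1)) (A : Idx n) (x : HSpace n) :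
    cauchyFueter (fun y => f y - g y) b A x = cauchyFueter f b A x - cauchyFueter g b A x := by
  simp only [cauchyFueter, Pi.sub_apply]
  rw [cderiv_sub (contDiff_pi.1 cf _) (contDiff_pi.1 cg _),
    cderiv_sub (contDiff_pi.1 cf _) (contDiff_pi.1 cg _)]
  ring

lemma VanishesOn.component {ι : Type*} [Fintype ι] {S : Set (HSpace n)} {m : ℕ}
    {f : HSpace n → ι → ℂ} (h : VanishesOn S m f) (cf : ContDiff ℝ ∞ f) (b : ι) :
    VanishesOn S m (fun x => f x b) :=
  h.clm_comp (ContinuousLinearMap.proj (R := ℝ) (φ := fun _ : ι => ℂ) b) cf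

lemma VanishesOn.cauchyFueter {S : Set (HSpace n)} {m : ℕ} {g : HSpace n → Fin (κ + 2) → ℂ}
    (h : VanishesOn S (m + 1) g) (cg : ContDiff ℝ ∞ g) (b : Fin (κ + 1)) (A : Idx n) :
    VanishesOn S m (cauchyFueter g b A) :=
  ((h.component cg _).cderiv (contDiff_pi.1 cg _)).add
    ((h.component cg _).cderiv (contDiff_pi.1 cg _))
    (contDiff_cderiv (contDiff_pi.1 cg _)) (contDiff_cderiv (contDiff_pi.1 cg _))

/-- The compatibility conditions `𝒟_1 𝒟_0 = 0` of first order. -/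
lemma cauchyFueter_compat {g : HSpace n → Fin (κ + 3) → ℂ} (cg : ContDiff ℝ ∞ g)
    (b : Fin (κ + 1)) (A B : Idx n) (x : HSpace n) :
    cderiv (field A 0) (cauchyFueter g b.castSucc B) x
      - cderiv (field B 0) (cauchyFueter g b.castSucc A) x
      + cderiv (field A 1) (cauchyFueter g b.succ B) x
      - cderiv (field B 1) (cauchyFueter g b.succ A) x = 0 := by
  have c := contDiff_pi.1 cg
  have e : ∀ (P : HSpace n × HSpace n) (b : Fin (κ + 2)) C, cderiv P (cauchyFueter g b C) x =
      cderiv P (cderiv (field C 0) fun y => g y b.castSucc) x +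
      cderiv P (cderiv (field C 1) fun y => g y b.succ) x := fun P b C =>
    cderiv_add (contDiff_cderiv (c _)) (contDiff_cderiv (c _)) x
  simp only [e]
  rw [cderiv_comm (P := field A 0) (Q := field B 0) (c _),
    cderiv_comm (P := field A 0) (Q := field B 1) (c _),
    cderiv_comm (P := field A 1) (Q := field B 0) (c _),
    cderiv_comm (P := field A 1) (Q := field B 1) (c _), Fin.succ_castSucc]
  ring

lemma boxOp_add {f g : HSpace n → ℂ} (cf : ContDiff ℝ ∞ f) (cg : ContDiff ℝ ∞ g)
    (A B : Idx n) (x : HSpace n) :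
    boxOp A B (fun y => f y + g y) x = boxOp A B f x + boxOp A B g x := by
  have e : ∀ P : HSpace n × HSpace n, cderiv P (fun y => f y + g y) =
      fun y => cderiv P f y + cderiv P g y := fun P => funext fun y => cderiv_add cf cg y
  simp only [boxOp, e, cderiv_add (contDiff_cderiv cf) (contDiff_cderiv cg)]
  ring

lemma boxOp_cderiv_comm {f : HSpace n → ℂ} (cf : ContDiff ℝ ∞ f) (P : HSpace n × HSpace n)
    (A B : Idx n) (x : HSpace n) : boxOp A B (cderiv P f) x = cderiv P (boxOp A B f) x := by
  have e : ∀ Q R : HSpace n × HSpace n, cderiv Q (cderiv R (cderiv P f)) x =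
      cderiv P (cderiv Q (cderiv R f)) x := fun Q R => by
    rw [show cderiv R (cderiv P f) = cderiv P (cderiv R f) from funext (cderiv_comm cf),
      cderiv_comm (contDiff_cderiv cf)]
  simp only [boxOp, e]
  exact (cderiv_sub (contDiff_cderiv (contDiff_cderiv cf))
    (contDiff_cderiv (contDiff_cderiv cf)) x).symm

/-- `d^{a} d^{0'} d^{1'} = 0`. -/
lemma cderiv_boxOp_cyclic {f : HSpace n → ℂ} (cf : ContDiff ℝ ∞ f) (a : Fin 2)
    (A B C : Idx n) (x : HSpace n) :
    cderiv (field C a) (boxOp A B f) x + cderiv (field A a) (boxOp B C f) x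
      + cderiv (field B a) (boxOp C A f) x = 0 := by
  have c2 : ∀ P Q : HSpace n × HSpace n, ContDiff ℝ ∞ (cderiv P (cderiv Q f)) := fun P Q =>
    contDiff_cderiv (contDiff_cderiv cf)
  have e : ∀ P A B, cderiv P (boxOp A B f) x =
      cderiv P (cderiv (field A 0) (cderiv (field B 1) f)) x -
      cderiv P (cderiv (field B 0) (cderiv (field A 1) f)) x := fun P A B =>
    cderiv_sub (c2 _ _) (c2 _ _) x
  have sw : ∀ P Q R : HSpace n × HSpace n, cderiv P (cderiv Q (cderiv R f)) x =
      cderiv Q (cderiv P (cderiv R f)) x := fun P Q R => cderiv_comm (contDiff_cderiv cf) x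
  have sw' : ∀ P Q R : HSpace n × HSpace n, cderiv P (cderiv Q (cderiv R f)) x =
      cderiv P (cderiv R (cderiv Q f)) x := fun P Q R => by
    rw [show cderiv Q (cderiv R f) = cderiv R (cderiv Q f) from funext (cderiv_comm cf)]
  simp only [e]
  fin_cases a
  · simp only [Fin.zero_eta]
    rw [sw (field C 0) (field A 0), sw (field A 0) (field B 0), sw (field B 0) (field C 0)]
    ring
  · simp only [Fin.mk_one]
    rw [sw' (field C 1) (field A 0), sw (field C 1) (field B 1), sw' (field B 1) (field C 1),
      sw' (field A 1) (field B 0), sw (field A 1) (field C 1), sw' (field C 1) (field A 1),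
      sw' (field B 1) (field C 0), sw (field B 1) (field A 1), sw' (field A 1) (field B 1)]
    ring

/-- The compatibility conditions `𝒟_1 𝒟_0 = 0` of second order. -/
lemma boxOp_cauchyFueter {g : HSpace n → Fin (κ + 2) → ℂ} (cg : ContDiff ℝ ∞ g)
    (b : Fin (κ + 1)) (A B C : Idx n) (x : HSpace n) :
    boxOp A B (cauchyFueter g b C) x + boxOp B C (cauchyFueter g b A) x
      + boxOp C A (cauchyFueter g b B) x = 0 := by
  have c := contDiff_pi.1 cg
  have e : ∀ A B C, boxOp A B (cauchyFueter g b C) x =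
      cderiv (field C 0) (boxOp A B fun y => g y b.castSucc) x +
      cderiv (field C 1) (boxOp A B fun y => g y b.succ) x := fun A B C => by
    rw [← boxOp_cderiv_comm (c _), ← boxOp_cderiv_comm (c _)]
    exact boxOp_add (contDiff_cderiv (c _)) (contDiff_cderiv (c _)) A B x
  simp only [e]
  linear_combination cderiv_boxOp_cyclic (c b.castSucc) 0 A B C x +
    cderiv_boxOp_cyclic (c b.succ) 1 A B C x

variable {S : Set (HSpace n)} {ρ θ : HSpace n → ℝ} {N : HSpace n → HSpace n}

/-- One step of the formal solution along the boundary: if the leading coefficients of `𝒟_0 g`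
satisfy the symbol relations, a correction of `g` improves the order of vanishing of `𝒟_0 g`. -/
lemma exists_correction (hρ : IsDefining S ρ N) (cθ : ContDiff ℝ ∞ θ) (hθ : HasCompactSupport θ)
    (hθ1 : ∀ x ∈ S, θ x * gradSq ρ x = 1) {m : ℕ} {g : HSpace n → Fin (κ + 2) → ℂ}
    (cg : ContDiff ℝ ∞ g) {c : Fin (κ + 1) → Idx n → HSpace n → ℂ}
    (cc : ∀ b A, ContDiff ℝ ∞ (c b A))
    (hl : ∀ b A, VanishesOn S (m + 1) (fun x => cauchyFueter g b A x - (ρ x : ℂ) ^ m * c b A x))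
    (h1 : ∀ x ∈ S, ∀ b A B C, c b C x * symbBox (fun A a => symb ρ A a x) A B
      + c b A x * symbBox (fun A a => symb ρ A a x) B C
      + c b B x * symbBox (fun A a => symb ρ A a x) C A = 0)
    (h2 : ∀ x ∈ S, ∀ (b : Fin κ) A B, c b.castSucc B x * symb ρ A 0 x
      - c b.castSucc A x * symb ρ B 0 x + c b.succ B x * symb ρ A 1 x
      - c b.succ A x * symb ρ B 1 x = 0) :
    ∃ h : HSpace n → Fin (κ + 2) → ℂ, ContDiff ℝ ∞ h ∧ HasCompactSupport h ∧
      ∀ b A, VanishesOn S (m + 1)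
        (cauchyFueter (fun x => g x - ρ x ^ (m + 1) • h x) b A) := by
  have cR := hρ.contDiff_ofReal
  have cΘ : ContDiff ℝ ∞ (fun x => (θ x : ℂ)) := Complex.ofRealCLM.contDiff.comp cθ
  have cS : ∀ A a, ContDiff ℝ ∞ (symb ρ A a) := contDiff_symb hρ.smooth
  set I : HSpace n → Fin (κ + 2) → ℂ := fun x =>
    symbolInverse (fun A a => symb ρ A a x) (fun b A => c b A x) with hI
  have cI : ∀ b, ContDiff ℝ ∞ fun x => I x b := by
    intro b
    induction b using Fin.lastCases with
    | last =>
      simp only [hI, symbolInverse, Fin.snoc_last]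
      exact ContDiff.sum fun l _ => ((cS _ _).mul (cc _ _)).sub ((cS _ _).mul (cc _ _))
    | cast b =>
      simp only [hI, symbolInverse, Fin.snoc_castSucc]
      exact ContDiff.sum fun l _ => ((cS _ _).mul (cc _ _)).sub ((cS _ _).mul (cc _ _))
  have hm : ((m : ℂ) + 1) ≠ 0 := Nat.cast_add_one_ne_zero m
  set h : HSpace n → Fin (κ + 2) → ℂ := fun x b => ((m : ℂ) + 1)⁻¹ * (θ x * I x b) with hh
  have chb : ∀ b, ContDiff ℝ ∞ fun x => h x b := fun b => contDiff_const.mul (cΘ.mul (cI b))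
  have ch : ContDiff ℝ ∞ h := contDiff_pi.2 chb
  refine ⟨h, ch, ?_, fun b A => ?_⟩
  · refine hθ.mono fun x hx => ?_
    simp only [Function.mem_support] at hx ⊢
    exact fun h0 => hx (funext fun b => by simp [hh, h0])
  have cp : ∀ b, ContDiff ℝ ∞ fun x => (ρ x : ℂ) ^ (m + 1) * h x b := fun b =>
    (cR.pow _).mul (chb b)
  have lead : ∀ a b, VanishesOn S (m + 1) fun x =>
      cderiv (field A a) (fun x => (ρ x : ℂ) ^ (m + 1) * h x b) x -
      (ρ x : ℂ) ^ m * ((m + 1) * (symb ρ A a x * h x b)) := fun a b =>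
    hρ.cderiv_leading (field A a) (cp b) (chb b) (by simpa using vanishesOn_zero)
  have clead : ∀ a b, ContDiff ℝ ∞ fun x =>
      cderiv (field A a) (fun x => (ρ x : ℂ) ^ (m + 1) * h x b) x -
      (ρ x : ℂ) ^ m * ((m + 1) * (symb ρ A a x * h x b)) := fun a b =>
    (contDiff_cderiv (cp b)).sub
      ((cR.pow m).mul (contDiff_const.mul ((cS A a).mul (chb b))))
  have cmid : ContDiff ℝ ∞ fun x => c b A x - (m + 1) * (symb ρ A 0 x * h x b.castSucc +
      symb ρ A 1 x * h x b.succ) :=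
    (cc b A).sub (contDiff_const.mul (((cS A 0).mul (chb _)).add ((cS A 1).mul (chb _))))
  -- the leading term of the correction cancels `ρ ^ m c`, as `θ |dρ|² = 1` on `S`
  have mid : VanishesOn S (m + 1) fun x => (ρ x : ℂ) ^ m * (c b A x - (m + 1) *
      (symb ρ A 0 x * h x b.castSucc + symb ρ A 1 x * h x b.succ)) := by
    refine (hρ.vanishesOn_pow m).mul (vanishesOn_one fun x hx => ?_) (cR.pow m) cmid
    have e := symbolInverse_spec (h1 x hx) (h2 x hx) b A
    have e2 : (∑ l, symbBox (fun A a => symb ρ A a x) (blockIdx l 0) (blockIdx l 1))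
      = (gradSq ρ x : ℂ) := sum_symb_eq_gradSq hρ.smooth x
    have e3 : (θ x : ℂ) * gradSq ρ x = 1 := by exact_mod_cast hθ1 x hx
    rw [e2] at e
    simp only [hh]
    have e4 : ((m : ℂ) + 1) * ((m : ℂ) + 1)⁻¹ = 1 := mul_inv_cancel₀ hm
    change symb ρ A 0 x * I x b.castSucc + symb ρ A 1 x * I x b.succ = _ * c b A x at e
    linear_combination (-((m : ℂ) + 1) * ((m : ℂ) + 1)⁻¹ * θ x) * e
      - ((m : ℂ) + 1) * ((m : ℂ) + 1)⁻¹ * c b A x * e3 - c b A x * e4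
  have cl : ContDiff ℝ ∞ fun x => cauchyFueter g b A x - (ρ x : ℂ) ^ m * c b A x :=
    (contDiff_cauchyFueter cg b A).sub ((cR.pow m).mul (cc b A))
  have t1 := (hl b A).add mid cl ((cR.pow m).mul cmid)
  have t2 := (lead 0 b.castSucc).add (lead 1 b.succ) (clead _ _) (clead _ _)
  have t3 := t1.sub t2 (cl.add ((cR.pow m).mul cmid)) ((clead _ _).add (clead _ _))
  have ce : ContDiff ℝ ∞ fun x => ρ x ^ (m + 1) • h x := (hρ.smooth.pow _).smul ch
  have e : cauchyFueter (fun x => g x - ρ x ^ (m + 1) • h x) b A = fun x =>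
      cauchyFueter g b A x - (cderiv (field A 0)
        (fun x => (ρ x : ℂ) ^ (m + 1) * h x b.castSucc) x + cderiv (field A 1)
        (fun x => (ρ x : ℂ) ^ (m + 1) * h x b.succ) x) := by
    funext x
    rw [cauchyFueter_sub cg ce]
    simp only [cauchyFueter, Pi.smul_apply, Complex.real_smul, Complex.ofReal_pow]
  rw [e]
  convert t3 using 2 with x
  ring

end Correction

/-! ### Formal solutions along the boundary -/

section FormalSolution

variable {n κ : ℕ} {D : Set (HSpace n)} {ρ θ : HSpace n → ℝ} {N : HSpace n → HSpace n}

/-- Stokes' formula without boundary term for `𝒟_0 g` and the first order operator `𝒟_1`, tested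
with functions that have a single component. -/
def WeakFirstOrder (D : Set (HSpace n)) (g : HSpace n → Fin (κ + 3) → ℂ) : Prop :=
  ∀ (b : Fin (κ + 1)) (A B : Idx n) (φ : HSpace n → ℂ), ContDiff ℝ ∞ φ → HasCompactSupport φ →
    ∫ x in D, (cauchyFueter g b.castSucc B x * cderiv (field A 0) φ x
      - cauchyFueter g b.castSucc A x * cderiv (field B 0) φ x
      + cauchyFueter g b.succ B x * cderiv (field A 1) φ x
      - cauchyFueter g b.succ A x * cderiv (field B 1) φ x) = 0

/-- Stokes' formula without boundary term for `𝒟_0 g` and the second order operator `𝒟_1`, tested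
with functions that have a single component. -/
def WeakSecondOrder (D : Set (HSpace n)) (g : HSpace n → Fin 2 → ℂ) : Prop :=
  ∀ (A B C : Idx n) (φ : HSpace n → ℂ), ContDiff ℝ ∞ φ → HasCompactSupport φ →
    ∫ x in D, (cauchyFueter g 0 C x * boxOp A B φ x + cauchyFueter g 0 A x * boxOp B C φ x
      + cauchyFueter g 0 B x * boxOp C A φ x) = 0

lemma vanishesOn_cauchyFueter_of_approx {S : Set (HSpace n)} {G : HSpace n → Fin (κ + 2) → ℂ}
    (cG : ContDiff ℝ ∞ G) {m : ℕ} {f : HSpace n → Fin (κ + 2) → ℂ} (cf : ContDiff ℝ ∞ f)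
    (hf : ∀ b A, VanishesOn S m (cauchyFueter f b A))
    (hGf : VanishesOn S (m + 1) (fun x => G x - f x)) (b : Fin (κ + 1)) (A : Idx n) :
    VanishesOn S m (cauchyFueter G b A) := by
  have h := (hf b A).add (hGf.cauchyFueter (cG.sub cf) b A) (contDiff_cauchyFueter cf b A)
    (contDiff_cauchyFueter (cG.sub cf) b A)
  convert h using 2 with x
  rw [cauchyFueter_sub cG cf]
  ring

/-- For `k ≥ 2`, a function representing a `k`-CF class may be changed off the boundary so that
`𝒟_0` of it vanishes to infinite order on the boundary. -/
lemma exists_formal_solution_first_order (hρ : IsDefining (frontier D) ρ N)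
    (hD : D = {x | 0 < ρ x}) (hext : frontier D ⊆ closure (closure D)ᶜ) (cθ : ContDiff ℝ ∞ θ)
    (hθ : HasCompactSupport θ) (hθ1 : ∀ x ∈ frontier D, θ x * gradSq ρ x = 1)
    {g : HSpace n → Fin (κ + 3) → ℂ} (cg : ContDiff ℝ ∞ g) (hg : WeakFirstOrder D g) :
    ∃ G : HSpace n → Fin (κ + 3) → ℂ, ContDiff ℝ ∞ G ∧
      VanishesOn (frontier D) 1 (fun x => G x - g x) ∧
      ∀ b A m, VanishesOn (frontier D) m (cauchyFueter G b A) := by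
  obtain ⟨G, cG, hGg, hG⟩ := exists_limit_of_corrections hρ.smooth hρ.eq_zero le_rfl
    (fun m f => (∀ b A, VanishesOn (frontier D) m (cauchyFueter f b A)) ∧
      (m = 0 → WeakFirstOrder D f)) cg ⟨fun _ _ => VanishesOn.zero_order, fun _ => hg⟩ (by
    intro m f cf ⟨hf, hw⟩
    have cu := contDiff_cauchyFueter cf
    choose c cc hl using fun b A => hρ.exists_leading (cu b A) (hf b A)
    have h2 : ∀ x ∈ frontier D, ∀ (b : Fin (κ + 1)) A B, c b.castSucc B x * symb ρ A 0 x
      - c b.castSucc A x * symb ρ B 0 x + c b.succ B x * symb ρ A 1 x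
      - c b.succ A x * symb ρ B 1 x = 0 := by
      intro x hx b A B
      have := symbol_relation (μ := volume) hρ hD hext (m := m)
        ![field A 0, field B 0, field A 1, field B 1]
        (u := ![cauchyFueter f b.castSucc B, fun x => -cauchyFueter f b.castSucc A x,
          cauchyFueter f b.succ B, fun x => -cauchyFueter f b.succ A x])
        (c := ![c b.castSucc B, fun x => -c b.castSucc A x, c b.succ B, fun x => -c b.succ A x])
        (by
          intro i
          fin_cases i
          exacts [cu _ _, (cu _ _).neg, cu _ _, (cu _ _).neg])
        (by
          intro i
          fin_cases i
          exacts [cc _ _, (cc _ _).neg, cc _ _, (cc _ _).neg])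
        (by
          have cl : ∀ b A, ContDiff ℝ ∞ fun x => cauchyFueter f b A x - (ρ x : ℂ) ^ m * c b A x :=
            fun b A => (cu b A).sub ((hρ.contDiff_ofReal.pow m).mul (cc b A))
          have hn : ∀ b A, VanishesOn (frontier D) (m + 1) fun x =>
              -cauchyFueter f b A x - (ρ x : ℂ) ^ m * -c b A x := fun b A => by
            convert (hl b A).neg (cl b A) using 2 with x
            ring
          intro i
          fin_cases i
          exacts [hl _ _, hn _ _, hl _ _, hn _ _])
        (by
          intro x
          rw [← cauchyFueter_compat cf b A B x]
          simp only [Fin.sum_univ_four, Matrix.cons_val, cderiv_neg (cu _ _)]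
          ring)
        (by
          intro hm φ cφ hφ
          rw [← hw hm b A B φ cφ hφ]
          congr 1 with x
          simp only [Fin.sum_univ_four, Matrix.cons_val]
          ring) x hx
      rw [← this]
      simp only [Fin.sum_univ_four, Matrix.cons_val, symb]
      ring
    obtain ⟨h, ch, hh, hQ⟩ := exists_correction hρ cθ hθ hθ1 cf cc hl
      (fun x hx b A B C => symbBox_relation (c := fun b A => c b A x)
        (ν := fun A a => symb ρ A a x) (h2 x hx) b A B C) h2
    exact ⟨h, ch, hh, hQ, fun h => absurd h (Nat.succ_ne_zero m)⟩)
  refine ⟨G, cG, hGg, fun b A m => ?_⟩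
  obtain ⟨f, cf, ⟨hf, -⟩, hGf⟩ := hG m
  exact vanishesOn_cauchyFueter_of_approx cG cf hf hGf b A

/-- The weak second order equation is not affected by a change of `g` that does not alter the
boundary values. -/
lemma WeakSecondOrder.congr (hρ : IsDefining (frontier D) ρ N) (hD : D = {x | 0 < ρ x})
    {g f : HSpace n → Fin 2 → ℂ} (cg : ContDiff ℝ ∞ g) (cf : ContDiff ℝ ∞ f)
    (hg : WeakSecondOrder D g) (hfg : ∀ x ∈ frontier D, f x = g x) : WeakSecondOrder D f := by
  intro A B C φ cφ hφ
  set w : HSpace n → Fin 2 → ℂ := fun x => f x - g x with hw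
  have cw : ContDiff ℝ ∞ w := cf.sub cg
  have cwa : ∀ a, ContDiff ℝ ∞ fun x => w x a := contDiff_pi.1 cw
  have cb : ∀ A B, ContDiff ℝ ∞ (boxOp A B φ) := contDiff_boxOp cφ
  have sb : ∀ A B, HasCompactSupport (boxOp A B φ) := fun A B =>
    (hasCompactSupport_cderiv (hasCompactSupport_cderiv hφ)).sub
      (hasCompactSupport_cderiv (hasCompactSupport_cderiv hφ))
  have cu := fun A => contDiff_cauchyFueter cg 0 A
  let P : Fin 3 × Fin 2 → HSpace n × HSpace n := fun i => ![field C i.2, field A i.2, field B i.2] i.1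
  let Φ : Fin 3 → HSpace n → ℂ := ![boxOp A B φ, boxOp B C φ, boxOp C A φ]
  have cΦ : ∀ i, ContDiff ℝ ∞ (Φ i) := by
    intro i
    fin_cases i
    exacts [cb _ _, cb _ _, cb _ _]
  have sΦ : ∀ i, HasCompactSupport (Φ i) := by
    intro i
    fin_cases i
    exacts [sb _ _, sb _ _, sb _ _]
  have cwΦ : ∀ i : Fin 3 × Fin 2, ContDiff ℝ ∞ fun x => w x i.2 * Φ i.1 x := fun i =>
    (cwa _).mul (cΦ _)
  have swΦ : ∀ i : Fin 3 × Fin 2, HasCompactSupport fun x => w x i.2 * Φ i.1 x := fun i =>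
    (sΦ i.1).mul_left
  have iwΦ : ∀ i : Fin 3 × Fin 2, Integrable (cderiv (P i) fun x => w x i.2 * Φ i.1 x)
      (volume.restrict D) := fun i =>
    (integrable_of_smooth volume (contDiff_cderiv (cwΦ i))
      (hasCompactSupport_cderiv (swΦ i))).restrict
  have e : ∀ x, cauchyFueter f 0 C x * boxOp A B φ x + cauchyFueter f 0 A x * boxOp B C φ x
      + cauchyFueter f 0 B x * boxOp C A φ x =
      (cauchyFueter g 0 C x * boxOp A B φ x + cauchyFueter g 0 A x * boxOp B C φ x
      + cauchyFueter g 0 B x * boxOp C A φ x) +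
      ∑ i, cderiv (P i) (fun x => w x i.2 * Φ i.1 x) x := by
    intro x
    have e1 : ∀ A, cauchyFueter f 0 A x = cauchyFueter g 0 A x + cauchyFueter w 0 A x := fun A => by
      rw [hw, cauchyFueter_sub cf cg]
      ring
    have z0 := cderiv_boxOp_cyclic cφ 0 A B C x
    have z1 := cderiv_boxOp_cyclic cφ 1 A B C x
    simp only [Fintype.sum_prod_type, Fin.sum_univ_three, Fin.sum_univ_two, P, Φ, Matrix.cons_val,
      cderiv_mul (cwa _) (cb _ _), e1]
    simp only [cauchyFueter, Fin.castSucc_zero, Fin.succ_zero_eq_one]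
    linear_combination -w x 0 * z0 - w x 1 * z1
  simp only [e]
  have i1 : Integrable (fun x => cauchyFueter g 0 C x * boxOp A B φ x +
      cauchyFueter g 0 A x * boxOp B C φ x + cauchyFueter g 0 B x * boxOp C A φ x)
      (volume.restrict D) := by
    refine (integrable_of_smooth volume ((((cu C).mul (cb A B)).add ((cu A).mul (cb B C))).add
      ((cu B).mul (cb C A))) ?_).restrict
    exact (((sb A B).mul_left).add ((sb B C).mul_left)).add ((sb C A).mul_left)
  rw [integral_add i1 (integrable_finsetSum _ fun i _ => iwΦ i), hg A B C φ cφ hφ,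
    integral_finsetSum _ (fun i _ => iwΦ i), zero_add]
  exact Finset.sum_eq_zero fun i _ => setIntegral_cderiv_eq_zero volume hρ hD (cwΦ i) (swΦ i)
    (fun x hx => by simp [hw, hfg x hx]) (P i)

/-- The analogue of `exists_formal_solution_first_order` for `k = 1`. -/
lemma exists_formal_solution_second_order (hρ : IsDefining (frontier D) ρ N)
    (hD : D = {x | 0 < ρ x}) (hext : frontier D ⊆ closure (closure D)ᶜ) (cθ : ContDiff ℝ ∞ θ)
    (hθ : HasCompactSupport θ) (hθ1 : ∀ x ∈ frontier D, θ x * gradSq ρ x = 1)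
    {g : HSpace n → Fin 2 → ℂ} (cg : ContDiff ℝ ∞ g) (hg : WeakSecondOrder D g) :
    ∃ G : HSpace n → Fin 2 → ℂ, ContDiff ℝ ∞ G ∧
      VanishesOn (frontier D) 1 (fun x => G x - g x) ∧
      ∀ b A m, VanishesOn (frontier D) m (cauchyFueter G b A) := by
  obtain ⟨G, cG, hGg, hG⟩ := exists_limit_of_corrections hρ.smooth hρ.eq_zero le_rfl
    (fun m f => (∀ b A, VanishesOn (frontier D) m (cauchyFueter f b A)) ∧
      WeakSecondOrder D f) cg ⟨fun _ _ => VanishesOn.zero_order, hg⟩ (by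
    intro m f cf ⟨hf, hw⟩
    have cu := contDiff_cauchyFueter cf
    choose c cc hl using fun b A => hρ.exists_leading (cu b A) (hf b A)
    have h1 : ∀ x ∈ frontier D, ∀ b A B C, c b C x * symbBox (fun A a => symb ρ A a x) A B
      + c b A x * symbBox (fun A a => symb ρ A a x) B C
      + c b B x * symbBox (fun A a => symb ρ A a x) C A = 0 := by
      intro x hx b A B C
      obtain rfl : b = 0 := Fin.fin_one_eq_zero b
      have cl : ∀ A, ContDiff ℝ ∞ fun x => cauchyFueter f 0 A x - (ρ x : ℂ) ^ m * c 0 A x :=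
        fun A => (cu 0 A).sub ((hρ.contDiff_ofReal.pow m).mul (cc 0 A))
      have hn : ∀ A, VanishesOn (frontier D) (m + 1) fun x =>
          -cauchyFueter f 0 A x - (ρ x : ℂ) ^ m * -c 0 A x := fun A => by
        convert (hl 0 A).neg (cl A) using 2 with x
        ring
      have := symbol_relation_second_order (μ := volume) hρ hD hext (m := m)
        ![field A 0, field B 0, field B 0, field C 0, field C 0, field A 0]
        ![field B 1, field A 1, field C 1, field B 1, field A 1, field C 1]
        (u := ![cauchyFueter f 0 C, fun x => -cauchyFueter f 0 C x,
          cauchyFueter f 0 A, fun x => -cauchyFueter f 0 A x,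
          cauchyFueter f 0 B, fun x => -cauchyFueter f 0 B x])
        (c := ![c 0 C, fun x => -c 0 C x, c 0 A, fun x => -c 0 A x, c 0 B, fun x => -c 0 B x])
        (by
          intro i
          fin_cases i
          exacts [cu _ _, (cu _ _).neg, cu _ _, (cu _ _).neg, cu _ _, (cu _ _).neg])
        (by
          intro i
          fin_cases i
          exacts [cc _ _, (cc _ _).neg, cc _ _, (cc _ _).neg, cc _ _, (cc _ _).neg])
        (by
          intro i
          fin_cases i
          exacts [hl _ _, hn _, hl _ _, hn _, hl _ _, hn _])
        (by
          intro x
          rw [← boxOp_cauchyFueter cf 0 A B C x]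
          have e : ∀ A, ∀ Q : HSpace n × HSpace n, cderiv Q (fun x => -cauchyFueter f 0 A x) =
            fun x => -cderiv Q (cauchyFueter f 0 A) x := fun A Q => funext (cderiv_neg (cu 0 A))
          simp only [Fin.sum_univ_six, Matrix.cons_val, boxOp, e,
            cderiv_neg (contDiff_cderiv (cu 0 _))]
          ring)
        (by
          intro hm φ cφ hφ
          rw [← hw A B C φ cφ hφ]
          congr 1 with x
          simp only [Fin.sum_univ_six, Matrix.cons_val, boxOp]
          ring) x hx
      rw [← this]
      simp only [Fin.sum_univ_six, Matrix.cons_val, symb, symbBox]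
      ring
    obtain ⟨h, ch, hh, hQ⟩ := exists_correction hρ cθ hθ hθ1 cf cc hl h1
      (fun _ _ b => b.elim0)
    refine ⟨h, ch, hh, hQ, hw.congr hρ hD cf (cf.sub ((hρ.smooth.pow _).smul ch)) ?_⟩
    intro x hx
    simp [hρ.eq_zero x hx])
  refine ⟨G, cG, hGg, fun b A m => ?_⟩
  obtain ⟨f, cf, ⟨hf, -⟩, hGf⟩ := hG m
  exact vanishesOn_cauchyFueter_of_approx cG cf hf hGf b A

/-- Stokes' formula without boundary term for `d^{0'} d^{1'} g` and the operators `d^{a}`, tested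
with functions that have a single component. -/
def WeakExterior (D : Set (HSpace n)) (g : HSpace n → ℂ) : Prop :=
  ∀ (a : Fin 2) (A B C : Idx n) (φ : HSpace n → ℂ), ContDiff ℝ ∞ φ → HasCompactSupport φ →
    ∫ x in D, (boxOp B C g x * cderiv (field A a) φ x + boxOp C A g x * cderiv (field B a) φ x
      + boxOp A B g x * cderiv (field C a) φ x) = 0

lemma boxOp_sub {f g : HSpace n → ℂ} (cf : ContDiff ℝ ∞ f) (cg : ContDiff ℝ ∞ g)
    (A B : Idx n) (x : HSpace n) :
    boxOp A B (fun y => f y - g y) x = boxOp A B f x - boxOp A B g x := by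
  have e : ∀ P : HSpace n × HSpace n, cderiv P (fun y => f y - g y) =
      fun y => cderiv P f y - cderiv P g y := fun P => funext fun y => cderiv_sub cf cg y
  simp only [boxOp, e, cderiv_sub (contDiff_cderiv cf) (contDiff_cderiv cg)]
  ring

lemma VanishesOn.boxOp {S : Set (HSpace n)} {m : ℕ} {f : HSpace n → ℂ}
    (h : VanishesOn S (m + 2) f) (cf : ContDiff ℝ ∞ f) (A B : Idx n) :
    VanishesOn S m (boxOp A B f) :=
  ((h.cderiv cf).cderiv (contDiff_cderiv cf)).sub ((h.cderiv cf).cderiv (contDiff_cderiv cf))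
    (contDiff_cderiv (contDiff_cderiv cf)) (contDiff_cderiv (contDiff_cderiv cf))

/-- An alternating form `c` with `ν^{0'} ∧ c = ν^{1'} ∧ c = 0` is proportional to the form
`ν^{0'} ∧ ν^{1'}`. -/
lemma symbBox_mul_comm {ν : Idx n → Fin 2 → ℂ} {c : Idx n → Idx n → ℂ}
    (hc : ∀ A B, c A B = -c B A)
    (h : ∀ a A B C, c B C * ν A a + c C A * ν B a + c A B * ν C a = 0) (A B C E : Idx n) :
    symbBox ν A B * c C E = symbBox ν C E * c A B := by
  simp only [symbBox]
  linear_combination ν A 0 * h 1 B C E - ν C 1 * h 0 A E B - ν E 1 * h 0 A B C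
    - ν B 0 * h 1 A C E + (ν C 1 * ν E 0) * hc A B + (ν C 1 * ν B 0) * hc A E
    + (ν E 1 * ν B 0) * hc C A

/-- The analogue of `exists_formal_solution_first_order` for `k = 0`. Here the first derivatives on
the boundary are kept as well. -/
lemma exists_formal_solution_exterior (hρ : IsDefining (frontier D) ρ N)
    (hD : D = {x | 0 < ρ x}) (hext : frontier D ⊆ closure (closure D)ᶜ) (cθ : ContDiff ℝ ∞ θ)
    (hθ : HasCompactSupport θ) (hθ1 : ∀ x ∈ frontier D, θ x * gradSq ρ x = 1)
    {g : HSpace n → ℂ} (cg : ContDiff ℝ ∞ g) (hg : WeakExterior D g) :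
    ∃ G : HSpace n → ℂ, ContDiff ℝ ∞ G ∧
      VanishesOn (frontier D) 2 (fun x => G x - g x) ∧
      ∀ A B m, VanishesOn (frontier D) m (boxOp A B G) := by
  have cR := hρ.contDiff_ofReal
  have cΘ : ContDiff ℝ ∞ (fun x => (θ x : ℂ)) := Complex.ofRealCLM.contDiff.comp cθ
  have cS : ∀ A a, ContDiff ℝ ∞ (symb ρ A a) := contDiff_symb hρ.smooth
  obtain ⟨G, cG, hGg, hG⟩ := exists_limit_of_corrections hρ.smooth hρ.eq_zero one_le_two
    (fun m f => (∀ A B, VanishesOn (frontier D) m (boxOp A B f)) ∧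
      (m = 0 → WeakExterior D f)) cg ⟨fun _ _ => VanishesOn.zero_order, fun _ => hg⟩ (by
    intro m f cf ⟨hf, hw⟩
    have cu := contDiff_boxOp cf
    choose c cc hl using fun A B => hρ.exists_leading (cu A B) (hf A B)
    have cl : ∀ A B, ContDiff ℝ ∞ fun x => boxOp A B f x - (ρ x : ℂ) ^ m * c A B x :=
      fun A B => (cu A B).sub ((cR.pow m).mul (cc A B))
    have hc : ∀ x ∈ frontier D, ∀ A B, c A B x = -c B A x := by
      intro x hx A B
      have := hρ.eq_zero_of_pow_mul (m := m) (b := fun x => c A B x + c B A x)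
        ((cc A B).add (cc B A)) (by
          convert ((hl A B).add (hl B A) (cl A B) (cl B A)).neg ((cl A B).add (cl B A))
            using 2 with x
          simp only [boxOp]
          ring) x hx
      exact eq_neg_of_add_eq_zero_left this
    have hs : ∀ x ∈ frontier D, ∀ a A B C, c B C x * symb ρ A a x + c C A x * symb ρ B a x
        + c A B x * symb ρ C a x = 0 := by
      intro x hx a A B C
      have := symbol_relation (μ := volume) hρ hD hext (m := m)
        ![field A a, field B a, field C a]
        (u := ![boxOp B C f, boxOp C A f, boxOp A B f])
        (c := ![c B C, c C A, c A B])
        (by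
          intro i
          fin_cases i
          exacts [cu _ _, cu _ _, cu _ _])
        (by
          intro i
          fin_cases i
          exacts [cc _ _, cc _ _, cc _ _])
        (by
          intro i
          fin_cases i
          exacts [hl _ _, hl _ _, hl _ _])
        (by
          intro x
          rw [← cderiv_boxOp_cyclic cf a A B C x]
          simp only [Fin.sum_univ_three, Matrix.cons_val]
          ring)
        (by
          intro hm φ cφ hφ
          rw [← hw hm a A B C φ cφ hφ]
          congr 1 with x
          simp only [Fin.sum_univ_three, Matrix.cons_val]) x hx
      rw [← this]
      simp only [Fin.sum_univ_three, Matrix.cons_val, symb]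
    have hm : ((m : ℂ) + 2) * ((m : ℂ) + 1) ≠ 0 := by norm_cast
    set h : HSpace n → ℂ := fun x => (((m : ℂ) + 2) * ((m : ℂ) + 1))⁻¹ *
      (θ x * ∑ l, c (blockIdx l 0) (blockIdx l 1) x) with hh
    have ch : ContDiff ℝ ∞ h :=
      contDiff_const.mul (cΘ.mul (ContDiff.sum fun l _ => cc _ _))
    refine ⟨h, ch, ?_, fun A B => ?_, fun h => absurd h (Nat.succ_ne_zero m)⟩
    · refine hθ.mono fun x hx => ?_
      simp only [Function.mem_support] at hx ⊢
      exact fun h0 => hx (by simp [hh, h0])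
    have cp : ContDiff ℝ ∞ fun x => (ρ x : ℂ) ^ (m + 2) * h x := (cR.pow _).mul ch
    have lead : ∀ A B, VanishesOn (frontier D) (m + 1) fun x =>
        cderiv (field A 0) (cderiv (field B 1) fun x => (ρ x : ℂ) ^ (m + 2) * h x) x -
        (ρ x : ℂ) ^ m * ((m + 2) * (m + 1) * (symb ρ A 0 x * (symb ρ B 1 x * h x))) :=
      fun A B => hρ.cderiv_cderiv_leading (field A 0) (field B 1) cp ch
        (by simpa using vanishesOn_zero)
    have clead : ∀ A B, ContDiff ℝ ∞ fun x =>
        cderiv (field A 0) (cderiv (field B 1) fun x => (ρ x : ℂ) ^ (m + 2) * h x) x -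
        (ρ x : ℂ) ^ m * ((m + 2) * (m + 1) * (symb ρ A 0 x * (symb ρ B 1 x * h x))) :=
      fun A B => (contDiff_cderiv (contDiff_cderiv cp)).sub
        ((cR.pow m).mul (contDiff_const.mul ((cS A 0).mul ((cS B 1).mul ch))))
    have cmid : ContDiff ℝ ∞ fun x => c A B x - (m + 2) * (m + 1) *
        ((symb ρ A 0 x * symb ρ B 1 x - symb ρ B 0 x * symb ρ A 1 x) * h x) :=
      (cc A B).sub (contDiff_const.mul ((((cS A 0).mul (cS B 1)).sub
        ((cS B 0).mul (cS A 1))).mul ch))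
    have mid : VanishesOn (frontier D) (m + 1) fun x => (ρ x : ℂ) ^ m * (c A B x -
        (m + 2) * (m + 1) *
        ((symb ρ A 0 x * symb ρ B 1 x - symb ρ B 0 x * symb ρ A 1 x) * h x)) := by
      refine (hρ.vanishesOn_pow m).mul (vanishesOn_one fun x hx => ?_) (cR.pow m) cmid
      have e : (symb ρ A 0 x * symb ρ B 1 x - symb ρ B 0 x * symb ρ A 1 x) *
          ∑ l, c (blockIdx l 0) (blockIdx l 1) x = gradSq ρ x * c A B x := by
        rw [← sum_symb_eq_gradSq hρ.smooth x, Finset.mul_sum, Finset.sum_mul]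
        exact Finset.sum_congr rfl fun l _ => symbBox_mul_comm (ν := fun A a => symb ρ A a x)
          (c := fun A B => c A B x) (hc x hx) (hs x hx) A B _ _
      have e3 : (θ x : ℂ) * gradSq ρ x = 1 := by exact_mod_cast hθ1 x hx
      have e4 := mul_inv_cancel₀ hm
      simp only [hh]
      linear_combination (-((m : ℂ) + 2) * ((m : ℂ) + 1) *
        (((m : ℂ) + 2) * ((m : ℂ) + 1))⁻¹ * θ x) * e
        - ((m : ℂ) + 2) * ((m : ℂ) + 1) * (((m : ℂ) + 2) * ((m : ℂ) + 1))⁻¹ * c A B x * e3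
        - c A B x * e4
    have t1 := (hl A B).add mid (cl A B) ((cR.pow m).mul cmid)
    have t2 := (lead A B).sub (lead B A) (clead _ _) (clead _ _)
    have t3 := t1.sub t2 ((cl A B).add ((cR.pow m).mul cmid)) ((clead _ _).sub (clead _ _))
    have e : boxOp A B (fun x => f x - ρ x ^ (m + 2) • h x) = fun x => boxOp A B f x -
        boxOp A B (fun x => (ρ x : ℂ) ^ (m + 2) * h x) x := by
      funext x
      rw [← boxOp_sub cf cp]
      simp only [Complex.real_smul, Complex.ofReal_pow]
    rw [e]
    convert t3 using 2 with x
    simp only [boxOp]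
    ring)
  refine ⟨G, cG, hGg, fun A B m => ?_⟩
  obtain ⟨f, cf, ⟨hf, -⟩, hGf⟩ := hG m
  have h := (hf A B).add (hGf.boxOp (cG.sub cf) A B) (contDiff_boxOp cf A B)
    (contDiff_boxOp (cG.sub cf) A B)
  convert h using 2 with x
  rw [boxOp_sub cG cf]
  ring

end FormalSolution

/-! ### Cutting off the components -/

section Cutoff

variable {n : ℕ} {D : Set (HSpace n)} {f : HSpace n → ℂ}

lemma cderiv_indicator (hD : IsOpen D) (cf : ContDiff ℝ ∞ f) (hf : VanishesOn (frontier D) 2 f)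
    (P : HSpace n × HSpace n) : cderiv P (D.indicator f) = D.indicator (cderiv P f) := by
  funext x
  by_cases hx : x ∈ D <;> simp [cderiv, fderiv_indicator hD cf hf, hx]

lemma boxOp_indicator (hD : IsOpen D) (cf : ContDiff ℝ ∞ f)
    (hf : ∀ m, VanishesOn (frontier D) m f) (A B : Idx n) :
    boxOp A B (D.indicator f) = D.indicator (boxOp A B f) := by
  funext x
  simp only [boxOp, cderiv_indicator hD cf (hf 2),
    cderiv_indicator hD (contDiff_cderiv cf) ((hf 3).cderiv cf)]
  by_cases hx : x ∈ D <;> simp [boxOp, hx]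

lemma hasCompactSupport_indicator (hD : Bornology.IsBounded D) :
    HasCompactSupport (D.indicator f) :=
  HasCompactSupport.of_support_subset_isCompact hD.isCompact_closure
    ((Set.support_indicator_subset).trans subset_closure)

end Cutoff

/-! ### The Green operator -/

section Green

variable {n : ℕ} {f g : HSpace n → ℂ}

/-- The inverse of the Laplacian in the first quaternionic variable, on functions of compact
support. -/
noncomputable def greenOp (f : HSpace n → ℂ) (x : HSpace n) : ℂ :=
  -(newtonConst : ℂ)⁻¹ * blockPotential (blockMap 0) f x

lemma contDiff_greenOp (cf : ContDiff ℝ ∞ f) (hf : HasCompactSupport f) :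
    ContDiff ℝ ∞ (greenOp f) :=
  contDiff_const.mul (contDiff_blockPotential (blockMap 0) cf hf)

lemma cderiv_greenOp (cf : ContDiff ℝ ∞ f) (hf : HasCompactSupport f)
    (P : HSpace n × HSpace n) : cderiv P (greenOp f) = greenOp (cderiv P f) := by
  funext x
  rw [greenOp, ← cderiv_blockPotential (blockMap 0) cf hf]
  exact cderiv_const_mul _ (contDiff_blockPotential (blockMap 0) cf hf) x

lemma greenOp_add (cf : ContDiff ℝ ∞ f) (hf : HasCompactSupport f) (cg : ContDiff ℝ ∞ g)
    (hg : HasCompactSupport g) (x : HSpace n) :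
    greenOp (fun y => f y + g y) x = greenOp f x + greenOp g x := by
  rw [greenOp, blockPotential_add (blockMap 0) cf hf cg hg, mul_add, greenOp, greenOp]

lemma greenOp_neg (f : HSpace n → ℂ) (x : HSpace n) :
    greenOp (fun y => -f y) x = -greenOp f x := by
  have := blockPotential_const_mul (f := f) (blockMap 0) (-1) x
  simp only [neg_one_mul] at this
  rw [greenOp, this, greenOp]
  ring

lemma greenOp_boxOp (cf : ContDiff ℝ ∞ f) (hf : HasCompactSupport f) (x : HSpace n) :
    greenOp (boxOp (blockIdx 0 0) (blockIdx 0 1) f) x = f x := by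
  have : (newtonConst : ℂ) ≠ 0 := Complex.ofReal_ne_zero.2 newtonConst_pos.ne'
  rw [greenOp, show boxOp (blockIdx 0 0) (blockIdx 0 1) f = blockLaplacian (blockMap 0) f from
    funext (boxOp_blockIdx cf 0), blockPotential_blockLaplacian (blockMap 0) cf hf]
  field_simp

/-- The potential of `f` vanishes where the other quaternionic variables lie outside of the
support of `f`. -/
lemma greenOp_eq_zero (hn : 1 ≤ n) {r : ℝ} (hr : ∀ x, r < x (Fin.last n, 0) → f x = 0)
    {x : HSpace n} (hx : r < x (Fin.last n, 0)) : greenOp f x = 0 := by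
  have h0 : Fin.last n ≠ 0 := fun h => by
    have := congrArg Fin.val h
    simp at this
    omega
  have : ∀ p, f (x - blockMap 0 p) = 0 := fun p => hr _ (by
    rw [PiLp.sub_apply, blockMap_apply, if_neg h0, sub_zero]
    exact hx)
  simp [greenOp, blockPotential, this]

lemma boxOp_greenOp (cf : ContDiff ℝ ∞ f) (hf : HasCompactSupport f) (A B : Idx n)
    (x : HSpace n) : boxOp A B (greenOp f) x = greenOp (boxOp A B f) x := by
  have c1 := fun P : HSpace n × HSpace n => contDiff_cderiv (P := P) cf
  have s1 := fun P : HSpace n × HSpace n => hasCompactSupport_cderiv (P := P) hf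
  have c2 := fun P Q : HSpace n × HSpace n => contDiff_cderiv (P := P) (c1 Q)
  have s2 := fun P Q : HSpace n × HSpace n => hasCompactSupport_cderiv (P := P) (s1 Q)
  have e : boxOp A B f = fun x => cderiv (field A 0) (cderiv (field B 1) f) x +
      -cderiv (field B 0) (cderiv (field A 1) f) x := funext fun x => sub_eq_add_neg _ _
  rw [e, greenOp_add (c2 _ _) (s2 _ _) (c2 _ _).neg (s2 _ _).neg, greenOp_neg, boxOp,
    cderiv_greenOp cf hf, cderiv_greenOp cf hf, cderiv_greenOp (c1 _) (s1 _),
    cderiv_greenOp (c1 _) (s1 _)]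
  ring

end Green

/-! ### The extension into the domain -/

section Extension

variable {n κ : ℕ} {D : Set (HSpace n)}

lemma eq_zero_of_mem_closure {E W : Type*} [NormedAddCommGroup E] [NormedSpace ℝ E]
    [NormedAddCommGroup W] [NormedSpace ℝ W] {f : E → W} (cf : ContDiff ℝ ∞ f) {U : Set E}
    (hU : IsOpen U) (h : ∀ x ∈ U, f x = 0) {x : E} (hx : x ∈ closure U) :
    f x = 0 ∧ fderiv ℝ f x = 0 := by
  have h' : ∀ x ∈ U, fderiv ℝ f x = 0 := fun x hx => by
    have : f =ᶠ[𝓝 x] fun _ => 0 := by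
      filter_upwards [hU.mem_nhds hx] with y hy using h y hy
    rw [this.fderiv_eq]
    simp
  exact ⟨closure_minimal h (isClosed_eq cf.continuous continuous_const) hx,
    closure_minimal h' (isClosed_eq (contDiff_fderiv cf).continuous continuous_const) hx⟩

lemma cderiv_eq_zero_of_isOpen {E : Type*} [NormedAddCommGroup E] [NormedSpace ℝ E] {f : E → ℂ}
    {U : Set E} (hU : IsOpen U) (h : ∀ x ∈ U, f x = 0) (P : E × E) : ∀ x ∈ U, cderiv P f x = 0 :=
  fun x hx => by
    have : f =ᶠ[𝓝 x] fun _ => 0 := by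
      filter_upwards [hU.mem_nhds hx] with y hy using h y hy
    rw [cderiv_congr this, cderiv_const]

/-- The components of a solution of the homogeneous equation `∂_{A'} d^{A'} v = 0` are annihilated
by the operators `Δ_{AB}`. -/
lemma boxOp_eq_zero_of_cauchyFueter {v : HSpace n → Fin (κ + 2) → ℂ} (cv : ContDiff ℝ ∞ v)
    {U : Set (HSpace n)} (hU : IsOpen U) (h : ∀ x ∈ U, ∀ b A, cauchyFueter v b A x = 0)
    (b : Fin (κ + 2)) (A B : Idx n) : ∀ x ∈ U, boxOp A B (fun y => v y b) x = 0 := by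
  intro x hx
  have c := contDiff_pi.1 cv
  have e : ∀ (P : HSpace n × HSpace n) (b : Fin (κ + 1)) C,
      cderiv P (cderiv (field C 0) fun y => v y b.castSucc) x
      + cderiv P (cderiv (field C 1) fun y => v y b.succ) x = 0 := fun P b C => by
    rw [← cderiv_add (contDiff_cderiv (c _)) (contDiff_cderiv (c _))]
    exact cderiv_eq_zero_of_isOpen hU (fun x hx => h x hx b C) P x hx
  have sw : ∀ b, ∀ P Q : HSpace n × HSpace n, cderiv P (cderiv Q fun y => v y b) x =
      cderiv Q (cderiv P fun y => v y b) x := fun b P Q => cderiv_comm (c b) x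
  rw [boxOp]
  induction b using Fin.lastCases with
  | last =>
    have e1 := e (field A 0) (Fin.last κ) B
    have e2 := e (field B 0) (Fin.last κ) A
    rw [sw _ (field A 0) (field B 0)] at e1
    rw [Fin.succ_last] at e1 e2
    linear_combination e1 - e2
  | cast b =>
    have e1 := e (field A 1) b B
    have e2 := e (field B 1) b A
    rw [sw _ (field A 1) (field B 0), sw _ (field A 1) (field B 1)] at e1
    rw [sw _ (field B 1) (field A 0)] at e2
    linear_combination e2 - e1

/-- A function whose quaternionic Laplacians vanish outside of `closure D` and which vanishes
for large values of the last quaternionic variable vanishes outside of `closure D`. -/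
lemma eq_zero_of_boxOp_eq_zero (hD : Bornology.IsBounded D) (hconn : IsConnected (closure D)ᶜ)
    {v : HSpace n → ℂ} (cv : ContDiff ℝ ∞ v)
    (hv : ∀ x ∈ (closure D)ᶜ, ∀ A B, boxOp A B v x = 0) {r : ℝ}
    (hr : ∀ x : HSpace n, r < x (Fin.last n, 0) → v x = 0) : ∀ x ∈ (closure D)ᶜ, v x = 0 := by
  obtain ⟨R, hR⟩ := hD.closure.subset_closedBall 0
  refine eq_zero_of_block_harmonic cv isClosed_closure.isOpen_compl hconn.isPreconnected
    (fun x hx l => by rw [← boxOp_blockIdx cv l]; exact hv x hx _ _)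
    (V := {x : HSpace n | r < x (Fin.last n, 0)}) ?_ ?_ hr
  · exact isOpen_lt continuous_const (by fun_prop)
  · set t : ℝ := |r| + |R| + 1
    have ht : 0 ≤ t := by positivity
    refine ⟨EuclideanSpace.single (Fin.last n, 0) t, fun h => ?_, ?_⟩
    · have := hR h
      rw [mem_closedBall_zero_iff, PiLp.norm_single, Real.norm_of_nonneg ht] at this
      linarith [le_abs_self R, abs_nonneg r]
    · have : r < t := by linarith [le_abs_self r, abs_nonneg R]
      simpa using this

/-- The last quaternionic variable is bounded on a bounded set. -/
lemma exists_bound_indicator (hD : Bornology.IsBounded D) : ∃ r : ℝ, ∀ (f : HSpace n → ℂ) x,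
    r < x (Fin.last n, 0) → D.indicator f x = 0 := by
  obtain ⟨R, hR⟩ := hD.subset_closedBall 0
  refine ⟨R, fun f x hx => Set.indicator_of_notMem (fun h => ?_) f⟩
  have h1 := mem_closedBall_zero_iff.1 (hR h)
  have h2 := (Real.norm_eq_abs _ ▸ PiLp.norm_apply_le x (Fin.last n, 0) :
    |x (Fin.last n, 0)| ≤ ‖x‖)
  linarith [le_abs_self (x (Fin.last n, 0))]

/-- The extension for `k ≥ 1`: if `𝒟_0 G` vanishes to infinite order on the boundary, its
restriction to `D` is `𝒟_0` of a function vanishing outside of `D`. -/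
lemma exists_extension (hn : 1 ≤ n) (hD : IsOpen D) (hb : Bornology.IsBounded D)
    (hext : frontier D ⊆ closure (closure D)ᶜ) (hconn : IsConnected (closure D)ᶜ)
    {G : HSpace n → Fin (κ + 2) → ℂ} (cG : ContDiff ℝ ∞ G)
    (hG : ∀ b A m, VanishesOn (frontier D) m (cauchyFueter G b A)) :
    ∃ F : HSpace n → Fin (κ + 2) → ℂ, ContDiff ℝ ∞ F ∧ (∀ x ∈ D, ∀ b A, cauchyFueter F b A x = 0) ∧
      ∀ x ∈ frontier D, F x = G x := by
  have cu := contDiff_cauchyFueter cG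
  set u : Fin (κ + 1) → Idx n → HSpace n → ℂ := fun b A => D.indicator (cauchyFueter G b A) with hu
  have cU : ∀ b A, ContDiff ℝ ∞ (u b A) := fun b A => contDiff_indicator hD (cu b A) (hG b A)
  have sU : ∀ b A, HasCompactSupport (u b A) := fun b A => hasCompactSupport_indicator hb
  have ind := fun b A => cderiv_indicator hD (cu b A) (hG b A 2)
  have cdU : ∀ P b A, ContDiff ℝ ∞ (cderiv P (u b A)) := fun P b A => contDiff_cderiv (cU b A)
  have sdU : ∀ P b A, HasCompactSupport (cderiv P (u b A)) := fun P b A =>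
    hasCompactSupport_cderiv (sU b A)
  -- the relations `𝒟_1 u = 0` on the whole space
  have rel2 : ∀ b A B C x, boxOp A B (u b C) x + boxOp B C (u b A) x + boxOp C A (u b B) x = 0 := by
    intro b A B C x
    simp only [hu, boxOp_indicator hD (cu _ _) (hG _ _)]
    by_cases hx : x ∈ D
    · simpa [hx] using boxOp_cauchyFueter cG b A B C x
    · simp [hx]
  set i₀ : Idx n := blockIdx 0 0
  set i₁ : Idx n := blockIdx 0 1
  -- the density whose potential solves `𝒟_0 v = u`: the analogue of `symbolInverse` with the
  -- operators `∇_A^{a}` of the first quaternionic variable in place of the symbols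
  set R : Fin (κ + 2) → HSpace n → ℂ := Fin.snoc (α := fun _ => HSpace n → ℂ)
    (fun b x => cderiv (field i₁ 1) (u b i₀) x - cderiv (field i₀ 1) (u b i₁) x)
    (fun x => cderiv (field i₀ 0) (u (Fin.last κ) i₁) x
      - cderiv (field i₁ 0) (u (Fin.last κ) i₀) x) with hR
  have R_cast : ∀ b : Fin (κ + 1), R b.castSucc = fun x =>
      cderiv (field i₁ 1) (u b i₀) x - cderiv (field i₀ 1) (u b i₁) x := fun b => by
    rw [hR, Fin.snoc_castSucc]
  have R_succ : ∀ b : Fin (κ + 1), R b.succ = fun x =>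
      cderiv (field i₀ 0) (u b i₁) x - cderiv (field i₁ 0) (u b i₀) x := fun b => by
    induction b using Fin.lastCases with
    | last => rw [Fin.succ_last, hR, Fin.snoc_last]
    | cast b =>
      rw [Fin.succ_castSucc, R_cast]
      funext x
      obtain _ | κ := κ
      · exact b.elim0
      simp only [hu, ind]
      by_cases hx : x ∈ D
      · simp only [hx, Set.indicator_of_mem]
        linear_combination -cauchyFueter_compat cG b i₀ i₁ x
      · simp [hx]
  have cR : ∀ b, ContDiff ℝ ∞ (R b) := fun b => by
    induction b using Fin.lastCases with
    | last => rw [← Fin.succ_last, R_succ]; exact (cdU _ _ _).sub (cdU _ _ _)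
    | cast b => rw [R_cast]; exact (cdU _ _ _).sub (cdU _ _ _)
  have sR : ∀ b, HasCompactSupport (R b) := fun b => by
    induction b using Fin.lastCases with
    | last => rw [← Fin.succ_last, R_succ]; exact (sdU _ _ _).sub (sdU _ _ _)
    | cast b => rw [R_cast]; exact (sdU _ _ _).sub (sdU _ _ _)
  set v : HSpace n → Fin (κ + 2) → ℂ := fun x b => greenOp (R b) x with hv
  have cvb : ∀ b, ContDiff ℝ ∞ fun x => v x b := fun b => contDiff_greenOp (cR b) (sR b)
  have cv : ContDiff ℝ ∞ v := contDiff_pi.2 cvb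
  have hvu : ∀ b A x, cauchyFueter v b A x = u b A x := by
    intro b A x
    have e1 : ∀ P b, cderiv P (fun y => v y b) = greenOp (cderiv P (R b)) := fun P b =>
      cderiv_greenOp (cR b) (sR b) P
    rw [cauchyFueter, e1, e1, ← greenOp_add (contDiff_cderiv (cR _))
      (hasCompactSupport_cderiv (sR _)) (contDiff_cderiv (cR _)) (hasCompactSupport_cderiv (sR _)),
      ← greenOp_boxOp (cU b A) (sU b A)]
    congr 1
    funext y
    rw [R_cast, R_succ, cderiv_sub (cdU _ _ _) (cdU _ _ _), cderiv_sub (cdU _ _ _) (cdU _ _ _)]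
    have := rel2 b i₀ i₁ A y
    simp only [boxOp] at this ⊢
    rw [cderiv_comm (P := field A 1) (Q := field i₀ 0) (cU _ _),
      cderiv_comm (P := field A 1) (Q := field i₁ 0) (cU _ _)]
    linear_combination -this
  obtain ⟨r, hr⟩ := exists_bound_indicator (n := n) hb
  have hRr : ∀ b x, r < x (Fin.last n, 0) → R b x = 0 := by
    have e0 : ∀ P b A x, r < x (Fin.last n, 0) → cderiv P (u b A) x = 0 := fun P b A x hx => by
      simp only [hu, ind, hr _ x hx]
    intro b x hx
    induction b using Fin.lastCases with
    | last => rw [← Fin.succ_last, R_succ]; simp [e0 _ _ _ x hx]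
    | cast b => rw [R_cast]; simp [e0 _ _ _ x hx]
  have hU : IsOpen (closure D)ᶜ := isClosed_closure.isOpen_compl
  have hv0 : ∀ x ∈ (closure D)ᶜ, ∀ b, v x b = 0 := fun x hx b =>
    eq_zero_of_boxOp_eq_zero hb hconn (cvb b)
      (fun x hx A B => boxOp_eq_zero_of_cauchyFueter cv hU (fun x hx b A => by
        rw [hvu]
        exact Set.indicator_of_notMem (fun h => hx (subset_closure h)) _) b A B x hx)
      (fun x hx => greenOp_eq_zero hn (hRr b) hx) x hx
  refine ⟨fun x => G x - v x, cG.sub cv, fun x hx b A => ?_, fun x hx => ?_⟩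
  · rw [cauchyFueter_sub cG cv, hvu]
    simp [hu, hx]
  · beta_reduce
    rw [(eq_zero_of_mem_closure cv hU (fun x hx => funext (hv0 x hx)) (hext hx)).1, sub_zero]

/-- The extension for `k = 0`. -/
lemma exists_extension_exterior (hn : 1 ≤ n) (hD : IsOpen D) (hb : Bornology.IsBounded D)
    (hext : frontier D ⊆ closure (closure D)ᶜ) (hconn : IsConnected (closure D)ᶜ)
    {G : HSpace n → ℂ} (cG : ContDiff ℝ ∞ G)
    (hG : ∀ A B m, VanishesOn (frontier D) m (boxOp A B G)) :
    ∃ F : HSpace n → ℂ, ContDiff ℝ ∞ F ∧ (∀ x ∈ D, ∀ A B, boxOp A B F x = 0) ∧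
      ∀ x ∈ frontier D, F x = G x ∧ fderiv ℝ F x = fderiv ℝ G x := by
  have cu := contDiff_boxOp cG
  set u : Idx n → Idx n → HSpace n → ℂ := fun A B => D.indicator (boxOp A B G) with hu
  have cU : ∀ A B, ContDiff ℝ ∞ (u A B) := fun A B => contDiff_indicator hD (cu A B) (hG A B)
  have sU : ∀ A B, HasCompactSupport (u A B) := fun A B => hasCompactSupport_indicator hb
  set i₀ : Idx n := blockIdx 0 0
  set i₁ : Idx n := blockIdx 0 1
  set v : HSpace n → ℂ := greenOp (u i₀ i₁) with hv
  have cv : ContDiff ℝ ∞ v := contDiff_greenOp (cU _ _) (sU _ _)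
  have hvu : ∀ A B x, boxOp A B v x = u A B x := by
    intro A B x
    rw [hv, boxOp_greenOp (cU _ _) (sU _ _), ← greenOp_boxOp (cU A B) (sU A B)]
    congr 1
    simp only [hu, boxOp_indicator hD (cu _ _) (hG _ _)]
    congr 1
    funext y
    -- operators with constant coefficients commute
    have e : ∀ P Q, boxOp A B (cderiv P (cderiv Q G)) y = cderiv P (cderiv Q (boxOp A B G)) y := by
      intro P Q
      rw [boxOp_cderiv_comm (contDiff_cderiv cG), show boxOp A B (cderiv Q G) =
        cderiv Q (boxOp A B G) from funext (boxOp_cderiv_comm cG Q A B)]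
    have c2 := fun P Q : HSpace n × HSpace n => contDiff_cderiv (P := P) (contDiff_cderiv (P := Q) cG)
    have e' : boxOp A B (boxOp i₀ i₁ G) y =
        boxOp A B (cderiv (field i₀ 0) (cderiv (field i₁ 1) G)) y -
        boxOp A B (cderiv (field i₁ 0) (cderiv (field i₀ 1) G)) y := boxOp_sub (c2 _ _) (c2 _ _) A B y
    rw [e', e, e, boxOp]
  obtain ⟨r, hr⟩ := exists_bound_indicator (n := n) hb
  have hU : IsOpen (closure D)ᶜ := isClosed_closure.isOpen_compl
  have hv0 : ∀ x ∈ (closure D)ᶜ, v x = 0 := eq_zero_of_boxOp_eq_zero hb hconn cv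
    (fun x hx A B => by
      rw [hvu]
      exact Set.indicator_of_notMem (fun h => hx (subset_closure h)) _)
    (fun x hx => greenOp_eq_zero hn (hr _) hx)
  refine ⟨fun x => G x - v x, cG.sub cv, fun x hx A B => ?_, fun x hx => ?_⟩
  · rw [boxOp_sub cG cv, hvu]
    simp [hu, hx]
  · have := eq_zero_of_mem_closure cv hU hv0 (hext hx)
    beta_reduce
    rw [fderiv_fun_sub (differentiable_of_smooth cG x) (differentiable_of_smooth cv x), this.1,
      this.2, sub_zero, sub_zero]
    exact ⟨rfl, rfl⟩

end Extension

/-! ### Exterior algebra in components -/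

section Exterior

variable {n τ : ℕ}

/-- The coefficient of `ω^T` in an element of `Λ^τ ℂ^{2n+2}`, for an arbitrary set `T` of indices;
it is zero if `T` does not have `τ` elements. -/
noncomputable def coeff (u : Ext n τ) (T : Finset (Idx n)) : ℂ :=
  if h : T.card = τ then u ⟨T, h⟩ else 0

lemma coeff_eq (u : Ext n τ) (T : Finset (Idx n)) (h : T.card = τ) : coeff u T = u ⟨T, h⟩ :=
  dif_pos h

lemma contDiff_coeff {F : HSpace n → Ext n τ} (cF : ContDiff ℝ ∞ F) (T : Finset (Idx n)) :
    ContDiff ℝ ∞ fun y => coeff (F y) T := by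
  by_cases h : T.card = τ
  · simp only [coeff_eq _ T h]
    exact contDiff_pi.1 cF _
  · simp only [coeff, h, dite_false]
    exact contDiff_const

lemma extD_eq (a : Fin 2) (F : HSpace n → Ext n τ) (x : HSpace n)
    (S : {S : Finset (Idx n) // S.card = τ + 1}) :
    extD a F x S = ∑ A ∈ S.1, sgn A S.1 *
      cderiv (field A a) (fun y => coeff (F y) (S.1.erase A)) x := by
  rw [Finset.sum_subtype S.1 (p := fun A => A ∈ S.1) (fun _ => Iff.rfl)]
  refine Finset.sum_congr rfl fun A _ => ?_
  rw [nabla_eq_cderiv]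
  congr 2
  funext y
  rw [coeff_eq]

lemma contDiff_extD (a : Fin 2) {F : HSpace n → Ext n τ} (cF : ContDiff ℝ ∞ F) :
    ContDiff ℝ ∞ (extD a F) := by
  refine contDiff_pi.2 fun S => ?_
  simp only [extD_eq]
  exact ContDiff.sum fun A _ => contDiff_const.mul (contDiff_cderiv (contDiff_coeff cF _))

lemma sgn_erase {S : Finset (Idx n)} {A B : Idx n} (hA : A ∈ S) :
    sgn B (S.erase A) = if A < B then -sgn B S else sgn B S := by
  have e : (S.erase A).filter (fun C => C < B) = (S.filter (fun C => C < B)).erase A :=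
    Finset.filter_erase _ _ _
  rw [sgn, sgn, e]
  split_ifs with h
  · have hm : A ∈ S.filter (fun C => C < B) := Finset.mem_filter.2 ⟨hA, h⟩
    rw [← Finset.card_erase_add_one hm, pow_succ]
    ring
  · rw [Finset.erase_eq_of_notMem (s := S.filter (fun C => C < B))
      fun hm => h (Finset.mem_filter.1 hm).2]

/-- `ω^A ∧ ω^B = - ω^B ∧ ω^A`. -/
lemma sgn_mul_sgn_erase {S : Finset (Idx n)} {A B : Idx n} (hA : A ∈ S) (hB : B ∈ S)
    (hAB : A ≠ B) : sgn A S * sgn B (S.erase A) = -(sgn B S * sgn A (S.erase B)) := by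
  rw [sgn_erase hA, sgn_erase hB]
  rcases lt_or_gt_of_ne hAB with h | h
  · rw [if_pos h, if_neg (not_lt.2 h.le)]; ring
  · rw [if_pos h, if_neg (not_lt.2 h.le)]; ring

lemma extD_extD (a b : Fin 2) {F : HSpace n → Ext n τ} (cF : ContDiff ℝ ∞ F) (x : HSpace n)
    (S : {S : Finset (Idx n) // S.card = τ + 1 + 1}) :
    extD a (extD b F) x S = ∑ A ∈ S.1, ∑ B ∈ S.1.erase A, sgn A S.1 * sgn B (S.1.erase A) *
      cderiv (field A a) (cderiv (field B b) fun y => coeff (F y) ((S.1.erase A).erase B)) x := by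
  rw [extD_eq]
  refine Finset.sum_congr rfl fun A hA => ?_
  have hc : (S.1.erase A).card = τ + 1 := by
    rw [Finset.card_erase_of_mem hA, S.2, Nat.add_sub_cancel]
  simp only [coeff_eq _ _ hc, extD_eq]
  rw [cderiv_sum _ fun B _ => contDiff_const.mul (contDiff_cderiv (contDiff_coeff cF _)),
    Finset.mul_sum]
  refine Finset.sum_congr rfl fun B _ => ?_
  rw [cderiv_const_mul _ (contDiff_cderiv (contDiff_coeff cF _)), mul_assoc]

lemma extD_anticomm (a b : Fin 2) {F : HSpace n → Ext n τ} (cF : ContDiff ℝ ∞ F) :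
    extD a (extD b F) = -extD b (extD a F) := by
  funext x S
  rw [Pi.neg_apply, Pi.neg_apply, extD_extD a b cF, extD_extD b a cF, ← Finset.sum_neg_distrib]
  simp only [← Finset.sum_neg_distrib]
  rw [Finset.sum_comm' (t' := S.1) (s' := fun B => S.1.erase B)]
  · refine Finset.sum_congr rfl fun B hB => Finset.sum_congr rfl fun A hA => ?_
    obtain ⟨hAB, hA⟩ := Finset.mem_erase.1 hA
    rw [sgn_mul_sgn_erase hA hB hAB, cderiv_comm (contDiff_coeff cF _), Finset.erase_right_comm]
    ring
  · intro A B
    simp only [Finset.mem_erase, ne_eq]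
    tauto

lemma extD_self (a : Fin 2) {F : HSpace n → Ext n τ} (cF : ContDiff ℝ ∞ F) :
    extD a (extD a F) = 0 := by
  funext x S
  have := congrFun (congrFun (extD_anticomm a a cF) x) S
  rw [Pi.neg_apply, Pi.neg_apply] at this
  exact self_eq_neg.1 this

lemma extD_add (a : Fin 2) {F G : HSpace n → Ext n τ} (cF : ContDiff ℝ ∞ F)
    (cG : ContDiff ℝ ∞ G) : extD a (fun y => F y + G y) = extD a F + extD a G := by
  funext x S
  have e : ∀ T y, coeff (F y + G y) T = coeff (F y) T + coeff (G y) T := fun T y => by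
    by_cases h : T.card = τ <;> simp [coeff, h]
  simp only [Pi.add_apply, extD_eq, ← Finset.sum_add_distrib, e, ← mul_add,
    cderiv_add (contDiff_coeff cF _) (contDiff_coeff cG _)]

lemma extD_zero (a : Fin 2) : extD a (0 : HSpace n → Ext n τ) = 0 := by
  funext x S
  have e : ∀ T, coeff (0 : Ext n τ) T = 0 := fun T => by
    by_cases h : T.card = τ <;> simp [coeff, h]
  simp [extD_eq, e, cderiv_const]

lemma extD_neg (a : Fin 2) {F : HSpace n → Ext n τ} (cF : ContDiff ℝ ∞ F) :
    extD a (-F) = -extD a F := by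
  have h := extD_add a cF cF.neg
  have h0 : (fun y => F y + -F y) = (0 : HSpace n → Ext n τ) := funext fun y => add_neg_cancel _
  rw [h0, extD_zero] at h
  exact (neg_eq_of_add_eq_zero_right h.symm).symm

end Exterior

/-! ### The complex -/

section Complex

variable {n σ τ : ℕ}

lemma partialD_partialD {f : HSpace n → V n (σ + 2) τ} (cf : ContDiff ℝ ∞ f) :
    partialD (partialD f) = 0 := by
  have c : ∀ b, ContDiff ℝ ∞ fun y => f y b := contDiff_pi.1 cf
  funext x b
  change extD 0 (fun y => extD 0 (fun y => f y b.castSucc.castSucc) y +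
      extD 1 (fun y => f y b.castSucc.succ) y) x + extD 1 (fun y =>
      extD 0 (fun y => f y b.succ.castSucc) y + extD 1 (fun y => f y b.succ.succ) y) x = 0
  rw [extD_add 0 (contDiff_extD 0 (c _)) (contDiff_extD 1 (c _)),
    extD_add 1 (contDiff_extD 0 (c _)) (contDiff_extD 1 (c _)), extD_self 0 (c _),
    extD_self 1 (c _), extD_anticomm 0 1 (c _), Fin.succ_castSucc]
  simp

lemma dd_partialD {f : HSpace n → V n 1 τ} (cf : ContDiff ℝ ∞ f) : dd (partialD f) = 0 := by
  have c : ∀ b, ContDiff ℝ ∞ fun y => f y b := contDiff_pi.1 cf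
  funext x b
  change extD 0 (extD 1 (fun y => extD 0 (fun y => f y 0) y + extD 1 (fun y => f y 1) y)) x = 0
  rw [extD_add 1 (contDiff_extD 0 (c 0)) (contDiff_extD 1 (c 1)), extD_self 1 (c 1), add_zero,
    extD_anticomm 1 0 (c 0), extD_neg 0 (contDiff_extD 0 (contDiff_extD 1 (c 0))),
    extD_self 0 (contDiff_extD 1 (c 0))]
  simp

lemma mulD_dd {f : HSpace n → V n 0 τ} (cf : ContDiff ℝ ∞ f) : mulD (dd f) = 0 := by
  have c : ContDiff ℝ ∞ fun y => f y 0 := contDiff_pi.1 cf 0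
  have h1 : extD 1 (extD 0 (extD 1 fun y => f y 0)) = 0 := by
    rw [extD_anticomm 1 0 (contDiff_extD 1 c), extD_self 1 c, extD_zero, neg_zero]
  have h0 := extD_self 0 (contDiff_extD 1 c)
  funext x b
  fin_cases b
  · exact congrFun h0 x
  · exact congrFun h1 x

end Complex

/-! ### Adjoints and test forms -/

section Adjoint

variable {n τ : ℕ}

/-- The form-valued function with the single component `conj φ`, at the place `S`. -/
noncomputable def testForm (S : {S : Finset (Idx n) // S.card = τ}) (φ : HSpace n → ℂ)
    (y : HSpace n) : Ext n τ := Pi.single S (star (φ y))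

lemma contDiff_testForm (S : {S : Finset (Idx n) // S.card = τ}) {φ : HSpace n → ℂ}
    (cφ : ContDiff ℝ ∞ φ) : ContDiff ℝ ∞ (testForm S φ) := by
  refine contDiff_pi.2 fun T => ?_
  by_cases h : T = S
  · subst h
    simp only [testForm, Pi.single_eq_same]
    exact Complex.conjCLE.contDiff.comp cφ
  · simp only [testForm, Pi.single_eq_of_ne h]
    exact contDiff_const

lemma hasCompactSupport_testForm (S : {S : Finset (Idx n) // S.card = τ}) {φ : HSpace n → ℂ}
    (hφ : HasCompactSupport φ) : HasCompactSupport (testForm S φ) := by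
  refine hφ.mono fun x hx => ?_
  simp only [Function.mem_support] at hx ⊢
  exact fun h => hx (by simp [testForm, h])

lemma sum_mul_star_testForm (u : Ext n τ) (S : {S : Finset (Idx n) // S.card = τ})
    (φ : HSpace n → ℂ) (x : HSpace n) : ∑ T, u T * star (testForm S φ x T) = u S * φ x := by
  rw [Finset.sum_eq_single S]
  · simp [testForm]
  · intro T _ h
    simp [testForm, Pi.single_eq_of_ne h]
  · simp

lemma nablaConj_star (A : Idx n) (a : Fin 2) {φ : HSpace n → ℂ} (cφ : ContDiff ℝ ∞ φ)
    (x : HSpace n) : nablaConj A a (fun y => star (φ y)) x = star (cderiv (field A a) φ x) := by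
  rw [← nabla_eq_cderiv, nabla, nablaConj, star_sum]
  refine Finset.sum_congr rfl fun j _ => ?_
  rw [star_mul']
  congr 1
  have h : HasFDerivAt (fun y => Complex.conjCLE (φ y))
      ((Complex.conjCLE : ℂ →L[ℝ] ℂ).comp (fderiv ℝ φ x)) x :=
    (Complex.conjCLE : ℂ →L[ℝ] ℂ).hasFDerivAt.comp x (differentiable_of_smooth cφ x).hasFDerivAt
  exact congrArg (fun L : HSpace n →L[ℝ] ℂ => L (EuclideanSpace.single (A.divNat, j) 1)) h.fderiv

lemma nablaConj_sum {ι : Type*} (s : Finset ι) (A : Idx n) (a : Fin 2) (c : ι → ℂ)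
    {F : ι → HSpace n → ℂ} (cF : ∀ i, ContDiff ℝ ∞ (F i)) (x : HSpace n) :
    nablaConj A a (fun y => ∑ i ∈ s, c i * F i y) x = ∑ i ∈ s, c i * nablaConj A a (F i) x := by
  have e : ∀ j, partialDeriv A.divNat j (fun y => ∑ i ∈ s, c i * F i y) x =
      ∑ i ∈ s, c i * partialDeriv A.divNat j (F i) x := fun j => by
    have hd : ∀ i, DifferentiableAt ℝ (F i) x := fun i => differentiable_of_smooth (cF i) x
    have := HasFDerivAt.fun_sum (u := s) fun i _ => ((hd i).hasFDerivAt.const_mul (c i))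
    rw [partialDeriv, this.fderiv]
    simp [partialDeriv]
  simp only [nablaConj, e, Finset.mul_sum]
  rw [Finset.sum_comm]
  exact Finset.sum_congr rfl fun i _ => Finset.sum_congr rfl fun j _ => by ring

lemma extDAdj_sum {ι : Type*} (s : Finset ι) (a : Fin 2) (c : ι → ℂ)
    {F : ι → HSpace n → Ext n (τ + 1)} (cF : ∀ i, ContDiff ℝ ∞ (F i)) (x : HSpace n) :
    extDAdj a (fun y S => ∑ i ∈ s, c i * F i y S) x =
      fun T => ∑ i ∈ s, c i * extDAdj a (F i) x T := by
  funext T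
  simp only [extDAdj]
  simp only [nablaConj_sum s _ _ c fun i => contDiff_pi.1 (cF i) _, mul_neg, Finset.mul_sum,
    Finset.sum_neg_distrib]
  rw [Finset.sum_comm]
  congr 1
  exact Finset.sum_congr rfl fun i _ => Finset.sum_congr rfl fun j _ => by ring

lemma extDAdj_zero (a : Fin 2) (x : HSpace n) :
    extDAdj a (fun _ => (0 : Ext n (τ + 1))) x = 0 := by
  funext T
  simp [extDAdj, nablaConj, partialDeriv]

lemma card_erase_eq (S : {S : Finset (Idx n) // S.card = τ + 1}) (A : {A // A ∈ S.1}) :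
    (S.1.erase A.1).card = τ := by
  rw [Finset.card_erase_of_mem A.2, S.2, Nat.add_sub_cancel]

/-- The formal adjoint of the exterior multiplication is the contraction. -/
lemma extDAdj_testForm (a : Fin 2) (S : {S : Finset (Idx n) // S.card = τ + 1})
    {φ : HSpace n → ℂ} (cφ : ContDiff ℝ ∞ φ) :
    extDAdj a (testForm S φ) = fun x T => ∑ A : {A // A ∈ S.1}, -sgn A.1 S.1 *
      testForm ⟨S.1.erase A.1, card_erase_eq S A⟩ (cderiv (field A.1 a) φ) x T := by
  funext x T
  have h1 : ∀ A : {A // A ∉ T.1},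
      nablaConj A.1 a (fun y => testForm S φ y ⟨insert A.1 T.1, by
        rw [Finset.card_insert_of_notMem A.2, T.2]⟩) x =
      if insert A.1 T.1 = S.1 then star (cderiv (field A.1 a) φ x) else 0 := by
    rintro ⟨A, hA⟩
    dsimp only
    split_ifs with h
    · rw [← nablaConj_star A a cφ]
      congr 1
      funext y
      have : (⟨insert A T.1, by rw [Finset.card_insert_of_notMem hA, T.2]⟩ :
        {S : Finset (Idx n) // S.card = τ + 1}) = S := Subtype.ext h
      rw [this, testForm, Pi.single_eq_same]
    · have : ∀ y, testForm S φ y ⟨insert A T.1, by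
          rw [Finset.card_insert_of_notMem hA, T.2]⟩ = 0 := fun y => by
        rw [testForm, Pi.single_eq_of_ne]
        exact fun h' => h (congrArg Subtype.val h')
      simp [this, nablaConj, partialDeriv]
  have h2 : ∀ A : {A // A ∈ S.1},
      testForm ⟨S.1.erase A.1, card_erase_eq S A⟩ (cderiv (field A.1 a) φ) x T =
      if T.1 = S.1.erase A.1 then star (cderiv (field A.1 a) φ x) else 0 := by
    intro A
    split_ifs with h
    · have : T = ⟨S.1.erase A.1, card_erase_eq S A⟩ := Subtype.ext h
      rw [this, testForm, Pi.single_eq_same]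
    · rw [testForm, Pi.single_eq_of_ne]
      exact fun h' => h (congrArg Subtype.val h')
  simp only [extDAdj, h1, h2, neg_mul, Finset.sum_neg_distrib]
  rw [← Finset.sum_subtype S.1 (p := fun A => A ∈ S.1) (fun _ => Iff.rfl)
      (fun A => sgn A S.1 * if T.1 = S.1.erase A then star (cderiv (field A a) φ x) else 0),
    ← Finset.sum_subtype (T.1ᶜ) (p := fun A => A ∉ T.1) (fun _ => Finset.mem_compl)
      (fun A => sgn A T.1 * if insert A T.1 = S.1 then star (cderiv (field A a) φ x) else 0)]
  congr 1
  simp only [mul_ite, mul_zero]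
  rw [← Finset.sum_filter, ← Finset.sum_filter]
  have hs : (T.1ᶜ).filter (fun A => insert A T.1 = S.1) =
      S.1.filter (fun A => T.1 = S.1.erase A) := by
    ext A
    simp only [Finset.mem_filter, Finset.mem_compl]
    constructor
    · rintro ⟨hA, h⟩
      rw [← h]
      exact ⟨Finset.mem_insert_self _ _, (Finset.erase_insert hA).symm⟩
    · rintro ⟨hA, h⟩
      rw [h]
      exact ⟨Finset.notMem_erase _ _, Finset.insert_erase hA⟩
  rw [hs]
  refine Finset.sum_congr rfl fun A hA => ?_
  obtain ⟨hA, h⟩ := Finset.mem_filter.1 hA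
  rw [h, sgn_erase hA, if_neg (lt_irrefl A)]

lemma star_sgn (A : Idx n) (S : Finset (Idx n)) : star (sgn A S) = sgn A S := by
  simp [sgn]

/-- The pairing with the formal adjoint of `d^{a}`, applied to a function with a single
component. -/
lemma sum_mul_star_extDAdj (a : Fin 2) (S : {S : Finset (Idx n) // S.card = τ + 1})
    {φ : HSpace n → ℂ} (cφ : ContDiff ℝ ∞ φ) (u : Ext n τ) (x : HSpace n) :
    ∑ T, u T * star (extDAdj a (testForm S φ) x T) =
      -∑ A ∈ S.1, sgn A S.1 * (coeff u (S.1.erase A) * cderiv (field A a) φ x) := by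
  rw [extDAdj_testForm a S cφ, Finset.sum_subtype S.1 (p := fun A => A ∈ S.1) (fun _ => Iff.rfl)]
  simp only [star_sum, star_mul', star_neg, star_sgn, Finset.mul_sum]
  rw [Finset.sum_comm, ← Finset.sum_neg_distrib]
  refine Finset.sum_congr rfl fun A _ => ?_
  rw [coeff_eq _ _ (card_erase_eq S A), ← sum_mul_star_testForm, Finset.mul_sum,
    ← Finset.sum_neg_distrib]
  exact Finset.sum_congr rfl fun T _ => by ring

/-- The pairing with the formal adjoint of `d^{0'} d^{1'}`, applied to a function with a single
component. -/
lemma sum_mul_star_extDAdj_extDAdj (S : {S : Finset (Idx n) // S.card = τ + 1 + 1})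
    {φ : HSpace n → ℂ} (cφ : ContDiff ℝ ∞ φ) (u : Ext n τ) (x : HSpace n) :
    ∑ T, u T * star (extDAdj 1 (extDAdj 0 (testForm S φ)) x T) =
      ∑ A ∈ S.1, ∑ B ∈ S.1.erase A, sgn A S.1 * sgn B (S.1.erase A) *
        (coeff u ((S.1.erase A).erase B) * cderiv (field B 1) (cderiv (field A 0) φ) x) := by
  have ct : ∀ A : {A // A ∈ S.1}, ContDiff ℝ ∞ (testForm
      (⟨S.1.erase A.1, card_erase_eq S A⟩ : {S : Finset (Idx n) // S.card = τ + 1})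
      (cderiv (field A.1 0) φ)) := fun A => contDiff_testForm _ (contDiff_cderiv cφ)
  rw [extDAdj_testForm 0 S cφ, extDAdj_sum Finset.univ 1 _ ct,
    Finset.sum_subtype S.1 (p := fun A => A ∈ S.1) (fun _ => Iff.rfl)]
  simp only [star_sum, star_mul', star_neg, star_sgn, Finset.mul_sum]
  rw [Finset.sum_comm]
  refine Finset.sum_congr rfl fun A _ => ?_
  have := sum_mul_star_extDAdj 1 ⟨S.1.erase A.1, card_erase_eq S A⟩
    (contDiff_cderiv (P := field A.1 0) cφ) u x
  have e : ∑ T, u T * (-sgn A.1 S.1 * star (extDAdj 1 (testForm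
      ⟨S.1.erase A.1, card_erase_eq S A⟩ (cderiv (field A.1 0) φ)) x T)) =
      -sgn A.1 S.1 * ∑ T, u T * star (extDAdj 1 (testForm
      ⟨S.1.erase A.1, card_erase_eq S A⟩ (cderiv (field A.1 0) φ)) x T) := by
    rw [Finset.mul_sum]
    exact Finset.sum_congr rfl fun T _ => by ring
  rw [e, this, neg_mul_neg, Finset.mul_sum]
  exact Finset.sum_congr rfl fun B _ => by ring

end Adjoint

/-! ### Translation into scalar components -/

section Components

variable {n k κ : ℕ}

/-- The scalar components of a `⊙^k ℂ²`-valued function; the only basis element of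
`Λ^0 ℂ^{2n+2}` is the one indexed by the empty set. -/
def scalarPart (g : HSpace n → V n k 0) (x : HSpace n) (b : Fin (k + 1)) : ℂ := g x b ⟨∅, rfl⟩

lemma contDiff_scalarPart {g : HSpace n → V n k 0} (cg : ContDiff ℝ ∞ g) :
    ContDiff ℝ ∞ (scalarPart g) :=
  contDiff_pi.2 fun b => contDiff_pi.1 (contDiff_pi.1 cg b) _

lemma apply_eq_scalarPart (g : HSpace n → V n k 0) (x : HSpace n) (b : Fin (k + 1))
    (S : {S : Finset (Idx n) // S.card = 0}) : g x b S = scalarPart g x b := by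
  rw [scalarPart]
  congr 1
  exact Subtype.ext (Finset.card_eq_zero.1 S.2)

lemma coeff_empty (g : HSpace n → V n k 0) (x : HSpace n) (b : Fin (k + 1)) :
    coeff (g x b) ∅ = scalarPart g x b := coeff_eq _ _ rfl

lemma sgn_singleton (A : Idx n) : sgn A {A} = 1 := by
  simp [sgn, Finset.filter_singleton]

lemma extD_singleton (g : HSpace n → V n k 0) (b : Fin (k + 1)) (a : Fin 2) (A : Idx n)
    (x : HSpace n) (h : ({A} : Finset (Idx n)).card = 0 + 1) :
    extD a (fun y => g y b) x ⟨{A}, h⟩ = cderiv (field A a) (fun y => scalarPart g y b) x := by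
  rw [extD_eq]
  simp [sgn_singleton, coeff_empty]

lemma coeff_partialD (g : HSpace n → V n (κ + 1) 0) (b : Fin (κ + 1)) (A : Idx n)
    (x : HSpace n) :
    coeff (partialD g x b) {A} = cauchyFueter (scalarPart g) b A x := by
  rw [coeff_eq _ _ (Finset.card_singleton A)]
  change extD 0 (fun y => g y b.castSucc) x _ + extD 1 (fun y => g y b.succ) x _ = _
  rw [extD_singleton, extD_singleton, cauchyFueter]

lemma erase_pair_left {A B : Idx n} (h : A ≠ B) : ({A, B} : Finset (Idx n)).erase A = {B} :=
  Finset.erase_insert (by simpa using h)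

lemma erase_pair_right {A B : Idx n} (h : A ≠ B) : ({A, B} : Finset (Idx n)).erase B = {A} := by
  rw [Finset.pair_comm, erase_pair_left h.symm]

lemma sgn_pair_left {A B : Idx n} (h : A < B) : sgn A {A, B} = 1 := by
  simp [sgn, Finset.filter_insert, Finset.filter_singleton, h.not_gt]

lemma sgn_pair_right {A B : Idx n} (h : A < B) : sgn B {A, B} = -1 := by
  simp [sgn, Finset.filter_insert, Finset.filter_singleton, h]

lemma coeff_dd {g : HSpace n → V n 0 0} (cg : ContDiff ℝ ∞ g) {A B : Idx n} (h : A < B)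
    (x : HSpace n) :
    coeff (dd g x 0) {A, B} = boxOp A B (fun y => scalarPart g y 0) x := by
  rw [coeff_eq _ _ (Finset.card_pair h.ne)]
  change extD 0 (extD 1 fun y => g y 0) x _ = _
  rw [extD_extD 0 1 (contDiff_pi.1 cg 0)]
  simp only [Finset.sum_pair h.ne, erase_pair_left h.ne, erase_pair_right h.ne,
    Finset.sum_singleton, sgn_pair_left h, sgn_pair_right h, sgn_singleton,
    Finset.erase_singleton, coeff_empty, boxOp]
  ring

lemma partialD_eq_zero {g : HSpace n → V n (κ + 1) 0} {x : HSpace n}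
    (h : ∀ b A, cauchyFueter (scalarPart g) b A x = 0) : partialD g x = 0 := by
  funext b S
  obtain ⟨A, hA⟩ := Finset.card_eq_one.1 S.2
  have h' := coeff_partialD g b A x
  rw [← hA, coeff_eq _ S.1 S.2] at h'
  exact h'.trans (h b A)

lemma dd_eq_zero {g : HSpace n → V n 0 0} (cg : ContDiff ℝ ∞ g) {x : HSpace n}
    (h : ∀ A B, boxOp A B (fun y => scalarPart g y 0) x = 0) : dd g x = 0 := by
  funext b S
  obtain ⟨A, B, hAB, hS⟩ : ∃ A B, A < B ∧ S.1 = {A, B} := by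
    obtain ⟨A, B, hne, hS⟩ := Finset.card_eq_two.1 S.2
    rcases lt_or_gt_of_ne hne with h | h
    · exact ⟨A, B, h, hS⟩
    · exact ⟨B, A, h, hS.trans (Finset.pair_comm A B)⟩
  have h' := coeff_dd cg hAB x
  rw [← hS, coeff_eq _ S.1 S.2] at h'
  exact h'.trans (h A B)

variable {A B C : Idx n}

lemma card_triple (h1 : A < B) (h2 : B < C) : ({A, B, C} : Finset (Idx n)).card = 3 :=
  Finset.card_eq_three.2 ⟨A, B, C, h1.ne, (h1.trans h2).ne, h2.ne, rfl⟩

lemma erase_triple₁ (h1 : A < B) (h2 : B < C) :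
    ({A, B, C} : Finset (Idx n)).erase A = {B, C} :=
  Finset.erase_insert (by simp [h1.ne, (h1.trans h2).ne])

lemma erase_triple₂ (h1 : A < B) (h2 : B < C) :
    ({A, B, C} : Finset (Idx n)).erase B = {A, C} := by
  rw [Finset.insert_comm]
  exact Finset.erase_insert (by simp [h1.ne', h2.ne])

lemma erase_triple₃ (h1 : A < B) (h2 : B < C) :
    ({A, B, C} : Finset (Idx n)).erase C = {A, B} := by
  rw [Finset.pair_comm B C, Finset.insert_comm]
  exact Finset.erase_insert (by simp [(h1.trans h2).ne', h2.ne'])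

lemma sgn_triple₁ (h1 : A < B) (h2 : B < C) : sgn A {A, B, C} = 1 := by
  simp [sgn, Finset.filter_insert, Finset.filter_singleton, h1.not_gt, (h1.trans h2).not_gt]

lemma sgn_triple₂ (h1 : A < B) (h2 : B < C) : sgn B {A, B, C} = -1 := by
  simp [sgn, Finset.filter_insert, Finset.filter_singleton, h1, h2.not_gt]

lemma sgn_triple₃ (h1 : A < B) (h2 : B < C) : sgn C {A, B, C} = 1 := by
  simp [sgn, Finset.filter_insert, Finset.filter_singleton, h1.trans h2, h2, h1.ne]

lemma sum_triple (h1 : A < B) (h2 : B < C) (f : Idx n → ℂ) :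
    ∑ X ∈ {A, B, C}, f X = f A + f B + f C := by
  rw [Finset.sum_insert (by simp [h1.ne, (h1.trans h2).ne]), Finset.sum_pair h2.ne, add_assoc]

/-- A statement about triples of indices that is invariant under permutations and holds for
triples with a repetition need only be proved for increasing triples. -/
lemma forall_of_forall_lt {p : Idx n → Idx n → Idx n → Prop} (swap : ∀ A B C, p A B C → p B A C)
    (rot : ∀ A B C, p A B C → p B C A) (diag : ∀ A B, p A A B)
    (h : ∀ A B C, A < B → B < C → p A B C) (A B C : Idx n) : p A B C := by
  rcases lt_trichotomy A B with hAB | rfl | hAB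
  · rcases lt_trichotomy B C with hBC | rfl | hBC
    · exact h _ _ _ hAB hBC
    · exact rot _ _ _ (rot _ _ _ (diag _ _))
    · rcases lt_trichotomy A C with hAC | rfl | hAC
      · exact rot _ _ _ (swap _ _ _ (h _ _ _ hAC hBC))
      · exact rot _ _ _ (diag _ _)
      · exact rot _ _ _ (h _ _ _ hAC hAB)
  · exact diag _ _
  · rcases lt_trichotomy B C with hBC | rfl | hBC
    · rcases lt_trichotomy A C with hAC | rfl | hAC
      · exact swap _ _ _ (h _ _ _ hAB hAC)
      · exact rot _ _ _ (diag _ _)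
      · exact rot _ _ _ (rot _ _ _ (h _ _ _ hBC hAC))
    · exact rot _ _ _ (rot _ _ _ (diag _ _))
    · exact swap _ _ _ (rot _ _ _ (h _ _ _ hBC hAB))

end Components

/-! ### The Cauchy data in scalar form -/

section Weak

variable {n κ : ℕ} {D : Set (HSpace n)}

lemma ZeroCauchyData.integral_eq_zero {σ τ σ' τ' : ℕ}
    {P : (HSpace n → V n σ τ) → (HSpace n → V n σ' τ')}
    {Q : (HSpace n → V n σ' τ') → (HSpace n → V n σ τ)} {u : HSpace n → V n σ τ}
    (h : ZeroCauchyData D P Q u) (hu : P u = 0) {ψ : HSpace n → V n σ' τ'}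
    (cψ : ContDiff ℝ ∞ ψ) (hψ : HasCompactSupport ψ) : ∫ x in D, herm (u x) (Q ψ x) = 0 := by
  rw [← h ψ cψ hψ, hu]
  simp [herm]

lemma herm_partialDAdj {σ τ : ℕ} (u : V n (σ + 1) τ) (ψ : HSpace n → V n σ (τ + 1))
    (x : HSpace n) : herm u (partialDAdj ψ x) =
      ∑ b : Fin (σ + 1), ((∑ T, u b.castSucc T * star (extDAdj 0 (fun y => ψ y b) x T)) +
        ∑ T, u b.succ T * star (extDAdj 1 (fun y => ψ y b) x T)) := by
  simp only [herm, partialDAdj, Pi.add_apply, star_add, mul_add, Finset.sum_add_distrib]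
  congr 1
  · rw [Fin.sum_univ_castSucc]
    simp
  · rw [Fin.sum_univ_succ]
    simp

/-- The function with the single component `conj φ`, at the place `(b, S)`. -/
noncomputable def testSection {σ τ : ℕ} (b : Fin (σ + 1)) (S : {S : Finset (Idx n) // S.card = τ})
    (φ : HSpace n → ℂ) (y : HSpace n) : V n σ τ := Pi.single b (testForm S φ y)

variable {σ τ : ℕ} (b : Fin (σ + 1)) (S : {S : Finset (Idx n) // S.card = τ}) {φ : HSpace n → ℂ}

lemma testSection_same : (fun y => testSection b S φ y b) = testForm S φ := by
  simp [testSection]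

lemma testSection_of_ne {b b' : Fin (σ + 1)} (h : b' ≠ b) :
    (fun y => testSection b S φ y b') = fun _ => 0 := by
  simp [testSection, Pi.single_eq_of_ne h]

lemma contDiff_testSection (cφ : ContDiff ℝ ∞ φ) : ContDiff ℝ ∞ (testSection b S φ) := by
  refine contDiff_pi.2 fun b' => ?_
  by_cases h : b' = b
  · subst h
    rw [testSection_same]
    exact contDiff_testForm S cφ
  · rw [testSection_of_ne S h]
    exact contDiff_const

lemma hasCompactSupport_testSection (hφ : HasCompactSupport φ) :
    HasCompactSupport (testSection b S φ) := by
  refine (hasCompactSupport_testForm S hφ).mono fun x hx => ?_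
  simp only [Function.mem_support] at hx ⊢
  exact fun h => hx (by simp [testSection, h])

lemma weakFirstOrder_of_zeroCauchyData {g : HSpace n → V n (κ + 2) 0} (cg : ContDiff ℝ ∞ g)
    (h : ZeroCauchyData D partialD partialDAdj (partialD g)) :
    WeakFirstOrder D (scalarPart g) := by
  intro b A B φ cφ hφ
  have key : ∀ A B, A < B → ∫ x in D, (cauchyFueter (scalarPart g) b.castSucc B x *
      cderiv (field A 0) φ x - cauchyFueter (scalarPart g) b.castSucc A x * cderiv (field B 0) φ x
      + cauchyFueter (scalarPart g) b.succ B x * cderiv (field A 1) φ x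
      - cauchyFueter (scalarPart g) b.succ A x * cderiv (field B 1) φ x) = 0 := by
    intro A B hAB
    let S : {S : Finset (Idx n) // S.card = 1 + 1} := ⟨{A, B}, Finset.card_pair hAB.ne⟩
    have h0 := h.integral_eq_zero (partialD_partialD cg) (contDiff_testSection b S cφ)
      (hasCompactSupport_testSection b S hφ)
    rw [← neg_eq_zero, ← integral_neg, ← h0]
    congr 1
    funext x
    rw [herm_partialDAdj, Finset.sum_eq_single b]
    · rw [testSection_same, sum_mul_star_extDAdj 0 S cφ, sum_mul_star_extDAdj 1 S cφ]
      simp only [S, Finset.sum_pair hAB.ne, sgn_pair_left hAB, sgn_pair_right hAB,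
        erase_pair_left hAB.ne, erase_pair_right hAB.ne, coeff_partialD]
      ring
    · intro b' _ hb
      simp [testSection_of_ne S hb, extDAdj_zero]
    · simp
  rcases lt_trichotomy A B with hAB | rfl | hAB
  · exact key A B hAB
  · simp
  · rw [← neg_eq_zero, ← integral_neg, ← key B A hAB]
    congr 1
    funext x
    ring

lemma weakSecondOrder_of_zeroCauchyData {g : HSpace n → V n 1 0} (cg : ContDiff ℝ ∞ g)
    (h : ZeroCauchyData D dd ddAdj (partialD g)) : WeakSecondOrder D (scalarPart g) := by
  intro A B C φ cφ hφ
  refine forall_of_forall_lt (p := fun A B C => ∫ x in D,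
    (cauchyFueter (scalarPart g) 0 C x * boxOp A B φ x +
      cauchyFueter (scalarPart g) 0 A x * boxOp B C φ x +
      cauchyFueter (scalarPart g) 0 B x * boxOp C A φ x) = 0) ?_ ?_ ?_ ?_ A B C
  · intro A B C h
    rw [← neg_eq_zero, ← integral_neg, ← h]
    congr 1
    funext x
    simp only [boxOp]
    ring
  · intro A B C h
    rw [← h]
    congr 1
    funext x
    ring
  · intro A B
    rw [← integral_zero (HSpace n) ℂ (μ := volume.restrict D)]
    congr 1
    funext x
    simp only [boxOp]
    ring
  · intro A B C h1 h2
    let S : {S : Finset (Idx n) // S.card = 1 + 1 + 1} := ⟨{A, B, C}, card_triple h1 h2⟩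
    have h0 := h.integral_eq_zero (dd_partialD cg) (contDiff_testSection 0 S cφ)
      (hasCompactSupport_testSection 0 S hφ)
    rw [← h0]
    congr 1
    funext x
    simp only [herm, ddAdj, testSection_same]
    rw [Fin.sum_univ_one, sum_mul_star_extDAdj_extDAdj S cφ]
    simp only [S, sum_triple h1 h2, erase_triple₁ h1 h2, erase_triple₂ h1 h2, erase_triple₃ h1 h2,
      sgn_triple₁ h1 h2, sgn_triple₂ h1 h2, sgn_triple₃ h1 h2, Finset.sum_pair h1.ne,
      Finset.sum_pair h2.ne, Finset.sum_pair (h1.trans h2).ne, sgn_pair_left h1, sgn_pair_right h1,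
      sgn_pair_left h2, sgn_pair_right h2, sgn_pair_left (h1.trans h2),
      sgn_pair_right (h1.trans h2), erase_pair_left h1.ne, erase_pair_right h1.ne,
      erase_pair_left h2.ne, erase_pair_right h2.ne, erase_pair_left (h1.trans h2).ne,
      erase_pair_right (h1.trans h2).ne, coeff_partialD, boxOp,
      cderiv_comm (P := field _ 1) (Q := field _ 0) cφ]
    ring

lemma weakExterior_of_zeroCauchyData {g : HSpace n → V n 0 0} (cg : ContDiff ℝ ∞ g)
    (h : ZeroCauchyData D mulD mulDAdj (dd g)) : WeakExterior D fun x => scalarPart g x 0 := by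
  intro a A B C φ cφ hφ
  set f : HSpace n → ℂ := fun x => scalarPart g x 0 with hf
  refine forall_of_forall_lt (p := fun A B C => ∫ x in D,
    (boxOp B C f x * cderiv (field A a) φ x + boxOp C A f x * cderiv (field B a) φ x
      + boxOp A B f x * cderiv (field C a) φ x) = 0) ?_ ?_ ?_ ?_ A B C
  · intro A B C h
    rw [← neg_eq_zero, ← integral_neg, ← h]
    congr 1
    funext x
    simp only [boxOp]
    ring
  · intro A B C h
    rw [← h]
    congr 1
    funext x
    ring
  · intro A B
    rw [← integral_zero (HSpace n) ℂ (μ := volume.restrict D)]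
    congr 1
    funext x
    simp only [boxOp]
    ring
  · intro A B C h1 h2
    let S : {S : Finset (Idx n) // S.card = 2 + 1} := ⟨{A, B, C}, card_triple h1 h2⟩
    have h0 := h.integral_eq_zero (mulD_dd cg) (contDiff_testSection a S cφ)
      (hasCompactSupport_testSection a S hφ)
    rw [← neg_eq_zero, ← integral_neg, ← h0]
    congr 1
    funext x
    have e : herm (dd g x) (mulDAdj (testSection a S φ) x) =
        ∑ T, dd g x 0 T * star (extDAdj a (testForm S φ) x T) := by
      simp only [herm, mulDAdj]
      rw [Fin.sum_univ_one]
      fin_cases a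
      · simp only [Fin.zero_eta]
        rw [testSection_same, testSection_of_ne S (by decide : (1 : Fin 2) ≠ 0), extDAdj_zero,
          add_zero]
      · simp only [Fin.mk_one]
        rw [testSection_same, testSection_of_ne S (by decide : (0 : Fin 2) ≠ 1), extDAdj_zero,
          zero_add (extDAdj 1 (testForm S φ) x)]
    rw [e, sum_mul_star_extDAdj a S cφ]
    simp only [S, sum_triple h1 h2, erase_triple₁ h1 h2, erase_triple₂ h1 h2, erase_triple₃ h1 h2,
      sgn_triple₁ h1 h2, sgn_triple₂ h1 h2, sgn_triple₃ h1 h2, coeff_dd cg h1, coeff_dd cg h2,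
      coeff_dd cg (h1.trans h2), ← hf]
    simp only [boxOp]
    ring

end Weak

/-! ### Conclusion -/

section Conclusion

variable {n κ : ℕ} {D : Set (HSpace n)}

lemma exists_regular_extension_succ (hn : 1 ≤ n) (hD : IsSmoothBoundedDomain D)
    (hconn : IsConnected (closure D)ᶜ) {g : HSpace n → V n (κ + 1) 0}
    (hg : IsCFClass (κ + 1) D g) :
    ∃ F : HSpace n → V n (κ + 1) 0, ContDiff ℝ ∞ F ∧ IsRegular (κ + 1) D F ∧
      ∀ x ∈ frontier D, F x = g x := by
  obtain ⟨ρ, θ, N, hρ, hDρ, cθ, hθ, hθ1, hext⟩ := hD.exists_isDefining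
  obtain ⟨cg, hg⟩ := hg
  have formal : ∃ G : HSpace n → Fin (κ + 2) → ℂ, ContDiff ℝ ∞ G ∧
      VanishesOn (frontier D) 1 (fun x => G x - scalarPart g x) ∧
      ∀ b A m, VanishesOn (frontier D) m (cauchyFueter G b A) := by
    match κ, g, cg, hg with
    | 0, g, cg, hg =>
      exact exists_formal_solution_second_order hρ hDρ hext cθ hθ hθ1 (contDiff_scalarPart cg)
        (weakSecondOrder_of_zeroCauchyData cg hg)
    | κ + 1, g, cg, hg =>
      exact exists_formal_solution_first_order hρ hDρ hext cθ hθ hθ1 (contDiff_scalarPart cg)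
        (weakFirstOrder_of_zeroCauchyData cg hg)
  obtain ⟨G, cG, hGg, hG⟩ := formal
  obtain ⟨F, cF, hF, hFG⟩ := exists_extension hn hD.isOpen hD.isBounded hext hconn cG hG
  have cF' : ContDiff ℝ ∞ (fun x b _ => F x b : HSpace n → V n (κ + 1) 0) :=
    contDiff_pi.2 fun b => contDiff_pi.2 fun _ => contDiff_pi.1 cF b
  refine ⟨fun x b _ => F x b, cF', ⟨cF'.contDiffOn, fun x hx => ?_⟩, fun x hx => ?_⟩
  · exact partialD_eq_zero (g := fun x b _ => F x b) (hF x hx)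
  · funext b S
    beta_reduce
    rw [apply_eq_scalarPart g x b S, hFG x hx, sub_eq_zero.1 (hGg.eq_zero one_pos hx)]

lemma exists_regular_extension_zero (hn : 1 ≤ n) (hD : IsSmoothBoundedDomain D)
    (hconn : IsConnected (closure D)ᶜ) {g : HSpace n → V n 0 0} (hg : IsCFClass 0 D g) :
    ∃ F : HSpace n → V n 0 0, ContDiff ℝ ∞ F ∧ IsRegular 0 D F ∧
      ∀ x ∈ frontier D, F x = g x ∧ fderiv ℝ F x = fderiv ℝ g x := by
  obtain ⟨ρ, θ, N, hρ, hDρ, cθ, hθ, hθ1, hext⟩ := hD.exists_isDefining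
  obtain ⟨cg, hg⟩ := hg
  have cg' : ContDiff ℝ ∞ fun x => scalarPart g x 0 := contDiff_pi.1 (contDiff_scalarPart cg) 0
  obtain ⟨G, cG, hGg, hG⟩ := exists_formal_solution_exterior hρ hDρ hext cθ hθ hθ1 cg'
    (weakExterior_of_zeroCauchyData cg hg)
  obtain ⟨F, cF, hF, hFG⟩ := exists_extension_exterior hn hD.isOpen hD.isBounded hext hconn cG hG
  let L : ℂ →L[ℝ] V n 0 0 := ContinuousLinearMap.pi fun _ => ContinuousLinearMap.pi fun _ =>
    ContinuousLinearMap.id ℝ ℂ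
  have hgL : g = fun x => L (scalarPart g x 0) := by
    funext x b S
    rw [apply_eq_scalarPart g x b S, Fin.fin_one_eq_zero b]
    rfl
  have cFL : ContDiff ℝ ∞ fun x => L (F x) := L.contDiff.comp cF
  have dL : ∀ {f : HSpace n → ℂ}, ContDiff ℝ ∞ f → ∀ x,
      fderiv ℝ (fun x => L (f x)) x = L.comp (fderiv ℝ f x) := fun cf x =>
    (L.hasFDerivAt.comp x (differentiable_of_smooth cf x).hasFDerivAt).fderiv
  refine ⟨fun x => L (F x), cFL, ⟨cFL.contDiffOn, fun x hx => ?_⟩, fun x hx => ?_⟩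
  · exact dd_eq_zero cFL (hF x hx)
  · have h0 : G x = scalarPart g x 0 := sub_eq_zero.1 (hGg.eq_zero two_pos hx)
    have h1 : fderiv ℝ G x = fderiv ℝ (fun x => scalarPart g x 0) x := by
      have := (VanishesOn.fderiv hGg).eq_zero one_pos hx
      rwa [fderiv_fun_sub (differentiable_of_smooth cG x) (differentiable_of_smooth cg' x),
        sub_eq_zero] at this
    rw [hgL]
    beta_reduce
    rw [dL cF, dL cg', (hFG x hx).1, (hFG x hx).2, h0, h1]
    exact ⟨rfl, rfl⟩

end Conclusion

end KCF


/-- The extension is the restriction to `D` of a smooth function on all of `ℍ^{n+1}`, so it is smooth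
up to the boundary. For `k = 0`, where a section over `bD` in the boundary complex consists of the
values and the normal derivative, both are attained. -/
theorem theorem1p2 (n k : ℕ) (hn : 1 ≤ n) (D : Set (KCF.HSpace n))
    (hD : KCF.IsSmoothBoundedDomain D) (hconn : IsConnected (closure D)ᶜ) :
    (∀ f : frontier D → KCF.V n k 0, KCF.IsCF k D f →
      ∃ F : KCF.HSpace n → KCF.V n k 0, ContDiff ℝ ∞ F ∧ KCF.IsRegular k D F ∧
        ∀ x : frontier D, F x = f x) ∧
    (k = 0 → ∀ g : KCF.HSpace n → KCF.V n k 0, KCF.IsCFClass k D g →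
      ∃ F : KCF.HSpace n → KCF.V n k 0, ContDiff ℝ ∞ F ∧ KCF.IsRegular k D F ∧
        ∀ x ∈ frontier D, F x = g x ∧ fderiv ℝ F x = fderiv ℝ g x) := by
  constructor
  · rintro f ⟨g, hg, hgf⟩
    match k, f, g, hg, hgf with
    | 0, f, g, hg, hgf =>
      obtain ⟨F, cF, hF, hFg⟩ := KCF.exists_regular_extension_zero hn hD hconn hg
      exact ⟨F, cF, hF, fun x => (hFg x x.2).1.trans (hgf x)⟩
    | κ + 1, f, g, hg, hgf =>
      obtain ⟨F, cF, hF, hFg⟩ := KCF.exists_regular_extension_succ hn hD hconn hg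
      exact ⟨F, cF, hF, fun x => (hFg x x.2).trans (hgf x)⟩
  · rintro rfl g hg
    exact KCF.exists_regular_extension_zero hn hD hconn hg
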